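/- **Setting.** Let $\mathcal S$ be a measurable space with a $\sigma$-finite reference measure $dx'$, let $\mathcal A$ be a finite non-empty action set, and let $H\ge 1$. A CMDP consists of transition kernels $\mathbb P_h(\cdot\mid x,a)$, deterministic rewards $r_h:\mathcal S\times\mathcal A\to[0,1]$ and utilities $g_h:\mathcal S\times\mathcal A\to[0,1]$ ($h=1,\dots,H$), a fixed initial state $x_1$ and a level $b\in(0,H]$. For a (measurable, randomized, Markov) policy $\pi=\{\pi_h(\cdot\mid x)\}_{h=1}^H$ and $\diamond\in\{r,g\}$ put $V^\pi_{\diamond,1}(x_1)=\mathbb E_\pi\big[\sum_{h=1}^H\diamond_h(x_h,a_h)\big]$. Let $\pi^\star$ be a solution of $\max_\pi V^\pi_{r,1}(x_1)$ subject to $V^\pi_{g,1}(x_1)\ge b$. *Slater condition with constant $\gamma>0$:* some policy $\bar\pi$ satisfies $V_{g,1}^{\bar\pi}(x_1)\ge b+\gamma$. *Linear kernel CMDP of dimension $d$:* there are known measurable feature maps $\psi:\mathcal S\times\mathcal A\times\mathcal S\to\mathbb R^{d_1}$ and $\varphi:\mathcal S\times\mathcal A\to\mathbb R^{d_2}$ with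 $\max(d_1,d_2)\le d$ and, for each $h$, vectors $\theta_h,\theta_{r,h},\theta_{g,h}$ with $\|\theta_h\|_2\le\sqrt{d_1}$ and $\max(\|\theta_{r,h}\|_2,\|\theta_{g,h}\|_2)\le\sqrt{d_2}$ such that $\mathbb P_h(\cdot\mid x,a)$ has the density $\langle\psi(x,a,x'),\theta_h\rangle$ with respect to $dx'$, $r_h=\langle\varphi,\theta_{r,h}\rangle$ and $g_h=\langle\varphi,\theta_{g,h}\rangle$; moreover $\|\int\psi(x,a,x')V(x')\,dx'\|_2\le\sqrt{d_1}\,H$ for all measurable $V:\mathcal S\to[0,H]$, and $\|\varphi(x,a)\|_2\le\sqrt d$, for all $(x,a)$. **Algorithm (OPDOP with LSTD+UCB policy evaluation, bandit feedback).** Put $T=HK$ and $\chi=2H/\gamma$. Start from $\pi^0_h=\mathrm{Unif}(\mathcal A)$, $Q^0_{r,h}=Q^0_{g,h}=0$, $Y^0=0$, $V^0_{g,1}=b$. In episode $k$ the learner plays $$\pi_h^k(a\mid x)\ \propto\ \Big((1-\theta)\pi_h^{k-1}(a\mid x)+\tfrac{\theta}{|\mathcal A|}\Big)\exp\!\big(\alpha\,(Q_{r,h}^{k-1}+Y^{k-1}Q_{g,h}^{k-1})(x,a)\big)$$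 from $x_1^k=x_1$, observes the trajectory $x_1^k,a_1^k,\dots,x_H^k,a_H^k,x_{H+1}^k$ and the values of $r_h,g_h$ at the visited pairs only, sets $Y^k=\mathrm{Proj}_{[0,\chi]}\big(Y^{k-1}+\eta(b-V^{k-1}_{g,1}(x_1))\big)$, and computes backwards from $V^k_{\diamond,H+1}=0$, for $h=H,\dots,1$ and $\diamond\in\{r,g\}$, with $\phi_{\diamond,h}^\tau(x,a)=\int\psi(x,a,x')V_{\diamond,h+1}^\tau(x')\,dx'$, $$\Lambda_{\diamond,h}^k=\sum_{\tau<k}\phi_{\diamond,h}^\tau(\phi_{\diamond,h}^\tau)^\top(x_h^\tau,a_h^\tau)+\lambda I,\qquad w_{\diamond,h}^k=(\Lambda_{\diamond,h}^k)^{-1}\sum_{\tau<k}\phi_{\diamond,h}^\tau(x_h^\tau,a_h^\tau)V_{\diamond,h+1}^\tau(x_{h+1}^\tau),$$ $$\Lambda_h^k=\sum_{\tau<k}\varphi\varphi^\top(x_h^\tau,a_h^\tau)+\lambda I,\qquad u_{\diamond,h}^k=(\Lambda_h^k)^{-1}\sum_{\tau<k}\varphi(x_h^\tau,a_h^\tau)\,\diamond_h(x_h^\tau,a_h^\tau),$$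 $$\Gamma_h^k=\beta\big(\varphi^\top(\Lambda_h^k)^{-1}\varphi\big)^{1/2},\qquad \Gamma_{\diamond,h}^k=\beta\big((\phi_{\diamond,h}^k)^\top(\Lambda_{\diamond,h}^k)^{-1}\phi_{\diamond,h}^k\big)^{1/2},$$ $$Q_{\diamond,h}^k=\min\big(\varphi^\top u_{\diamond,h}^k+(\phi_{\diamond,h}^k)^\top w_{\diamond,h}^k+\Gamma_h^k+\Gamma_{\diamond,h}^k,\ H-h+1\big)^+,\qquad V_{\diamond,h}^k(x)=\sum_a Q_{\diamond,h}^k(x,a)\,\pi_h^k(a\mid x).$$ **Theorem.** There is an absolute constant $c_1>0$ such that for every $C_1\ge c_1$, every $\gamma>0$ and every $c_{\mathcal A}>0$ there are constants $C,C'>0$, depending only on $C_1,\gamma,c_{\mathcal A}$, with the following property. For every linear kernel CMDP of dimension $d$ that satisfies the Slater condition with constant $\gamma$, every solution $\pi^\star$, every $K\ge1$ and every $p\in(0,1)$ with $\log|\mathcal A|\le c_{\mathcal A}\,d^2\log^2(dT/p)$, if the algorithm is run with $$\alpha=\frac{\sqrt{\log|\mathcal A|}}{H^2\sqrt K},\quad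 \beta=C_1\sqrt{dH^2\log(dT/p)},\quad \eta=\frac1{\sqrt K},\quad \theta=\frac1K,\quad \lambda=1,\quad\chi=\frac{2H}{\gamma},$$ then with probability at least $1-p$ both $$\sum_{k=1}^K\big(V^{\pi^\star}_{r,1}(x_1)-V^{\pi^k}_{r,1}(x_1)\big)\le C\,dH^{2.5}\sqrt T\,\log\frac{dT}{p}\quad\text{and}\quad\Big[\sum_{k=1}^K\big(b-V^{\pi^k}_{g,1}(x_1)\big)\Big]_+\le C'\,dH^{2.5}\sqrt T\,\log\frac{dT}{p}.$$ -/

import Mathlib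

open MeasureTheory ProbabilityTheory
open scoped Matrix

namespace OPDOP

/-! Episodic constrained Markov decision processes. Steps are indexed by `Fin H`: the index `h`
stands for step `h + 1`. -/

/-- A constrained episodic MDP with horizon `H`: transition kernels, deterministic reward and
utility functions with values in `[0, 1]`, the fixed initial state and the constraint level. -/
structure CMDP (S A : Type*) [MeasurableSpace S] [MeasurableSpace A] (H : ℕ) where
  P : Fin H → Kernel (S × A) S
  markov : ∀ h, IsMarkovKernel (P h)
  r : Fin H → S → A → ℝ
  g : Fin H → S → A → ℝ
  measurable_r : ∀ h a, Measurable fun x => r h x a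
  measurable_g : ∀ h a, Measurable fun x => g h x a
  r_mem : ∀ h x a, r h x a ∈ Set.Icc (0 : ℝ) 1
  g_mem : ∀ h x a, g h x a ∈ Set.Icc (0 : ℝ) 1
  x₁ : S
  b : ℝ
  b_mem : b ∈ Set.Ioc (0 : ℝ) H

/-- `π h x a` is the probability of taking action `a` in state `x` at step `h`. -/
abbrev PolicyFun (S A : Type*) (H : ℕ) := Fin H → S → A → ℝ

/-- A (measurable, randomized, Markov) policy, that is, an element of `Δ(A | S, H)`. -/
structure IsPolicy {S A : Type*} [MeasurableSpace S] [Fintype A] {H : ℕ}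
    (π : PolicyFun S A H) : Prop where
  measurable : ∀ h a, Measurable fun x => π h x a
  nonneg : ∀ h x a, 0 ≤ π h x a
  sum_eq_one : ∀ h x, ∑ a, π h x a = 1

/-- The trajectory of one episode: the states `x_1, …, x_{H+1}` and the actions `a_1, …, a_H`. -/
abbrev Episode (S A : Type*) (H : ℕ) := (Fin (H + 1) → S) × (Fin H → A)

/-- The law of the trajectory that starts in `x`, draws the actions from `π` and the next states
from the kernels `P`: draw the first action and the second state, then continue from there. -/
noncomputable def trajLaw {S A : Type*} [MeasurableSpace S] [MeasurableSpace A] [Fintype A] :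
    (n : ℕ) → (Fin n → Kernel (S × A) S) → PolicyFun S A n → S → Measure (Episode S A n)
  | 0, _, _, x => Measure.dirac (fun _ => x, Fin.elim0)
  | n + 1, P, π, x =>
      ∑ a, ENNReal.ofReal (π 0 x a) •
        (P 0 (x, a)).bind fun x' =>
          (trajLaw n (fun h => P h.succ) (fun h => π h.succ) x').map
            fun e => (Fin.cons x e.1, Fin.cons a e.2)

section Model

variable {S A : Type*} [MeasurableSpace S] [MeasurableSpace A] [Fintype A] {H : ℕ}

/-- `V_{f,1}^π(x₁) = E_π [∑_h f_h(x_h, a_h)]`, for `f` the reward or the utility function. -/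
noncomputable def CMDP.value (M : CMDP S A H) (f : Fin H → S → A → ℝ)
    (π : PolicyFun S A H) : ℝ :=
  ∫ e, ∑ h, f h (e.1 h.castSucc) (e.2 h) ∂(trajLaw H M.P π M.x₁)

/-- `π` solves: maximize `V_{r,1}^π(x₁)` over all policies subject to `V_{g,1}^π(x₁) ≥ b`. -/
def CMDP.IsSolution (M : CMDP S A H) (π : PolicyFun S A H) : Prop :=
  IsPolicy π ∧ M.b ≤ M.value M.g π ∧
    ∀ π' : PolicyFun S A H, IsPolicy π' → M.b ≤ M.value M.g π' →
      M.value M.r π' ≤ M.value M.r π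

/-- The Slater condition with constant `γ`. -/
def CMDP.Slater (M : CMDP S A H) (γ : ℝ) : Prop :=
  0 < γ ∧ ∃ π : PolicyFun S A H, IsPolicy π ∧ M.b + γ ≤ M.value M.g π

/-- The linear kernel structure. The reference measure `μ` on the state space is written `dx'`: the
transition probabilities have the densities `⟨ψ(x, a, ·), θ_h⟩` with respect to it. -/
structure CMDP.IsLinearKernel (M : CMDP S A H) (μ : Measure S) {d₁ d₂ : ℕ}
    (ψ : S → A → S → EuclideanSpace ℝ (Fin d₁)) (φ : S → A → EuclideanSpace ℝ (Fin d₂))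
    (d : ℕ) : Prop where
  measurable_psi : ∀ a, Measurable fun z : S × S => ψ z.1 a z.2
  measurable_phi : ∀ a, Measurable fun x => φ x a
  integrable_psi : ∀ x a, Integrable (fun x' => ψ x a x') μ
  transition : ∀ h, ∃ θ : EuclideanSpace ℝ (Fin d₁), ‖θ‖ ≤ √(d₁ : ℝ) ∧ ∀ x a,
    (∀ x', 0 ≤ inner ℝ (ψ x a x') θ) ∧
      M.P h (x, a) = μ.withDensity fun x' => ENNReal.ofReal (inner ℝ (ψ x a x') θ)
  reward : ∀ h, ∃ θr θg : EuclideanSpace ℝ (Fin d₂),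
    max ‖θr‖ ‖θg‖ ≤ √(d₂ : ℝ) ∧ ∀ x a,
      M.r h x a = inner ℝ (φ x a) θr ∧ M.g h x a = inner ℝ (φ x a) θg
  norm_integral_psi_le : ∀ V : S → ℝ, Measurable V → (∀ x, V x ∈ Set.Icc (0 : ℝ) H) →
    ∀ x a, ‖∫ x', V x' • ψ x a x' ∂μ‖ ≤ √(d₁ : ℝ) * H
  norm_phi_le : ∀ x a, ‖φ x a‖ ≤ √(d : ℝ)
  dim_le : max d₁ d₂ ≤ d

end Model

/-! Regularized least squares. -/

section Ridge

variable {n m : ℕ}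

/-- `Λ = ∑_τ v_τ v_τᵀ + λ I`. -/
noncomputable def gram (lam : ℝ) (v : Fin n → EuclideanSpace ℝ (Fin m)) :
    Matrix (Fin m) (Fin m) ℝ :=
  ∑ τ, Matrix.vecMulVec (v τ).ofLp (v τ).ofLp + lam • (1 : Matrix (Fin m) (Fin m) ℝ)

/-- `Λ⁻¹ ∑_τ y_τ v_τ`. -/
noncomputable def ridge (lam : ℝ) (v : Fin n → EuclideanSpace ℝ (Fin m)) (y : Fin n → ℝ) :
    Fin m → ℝ :=
  (gram lam v)⁻¹ *ᵥ ∑ τ, y τ • (v τ).ofLp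

/-- The exploration bonus `β (uᵀ Λ⁻¹ u)^{1/2}`. -/
noncomputable def bonus (β lam : ℝ) (v : Fin n → EuclideanSpace ℝ (Fin m))
    (u : EuclideanSpace ℝ (Fin m)) : ℝ :=
  β * √(u.ofLp ⬝ᵥ ((gram lam v)⁻¹ *ᵥ u.ofLp))

end Ridge

/-- The parameters of the algorithm. -/
structure Params where
  α : ℝ
  β : ℝ
  η : ℝ
  θ : ℝ
  lam : ℝ
  χ : ℝ

/-- What one episode of the algorithm computes: the policy, the dual variable, and the estimated
action-value functions and value functions; `Vr h`, `Vg h` belong to step `h + 1 ≤ H + 1`. -/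
structure Iterate (S A : Type*) (H : ℕ) where
  pol : PolicyFun S A H
  Y : ℝ
  Qr : Fin H → S → A → ℝ
  Qg : Fin H → S → A → ℝ
  Vr : Fin (H + 1) → S → ℝ
  Vg : Fin (H + 1) → S → ℝ

section Algorithm

variable {S A : Type*} [MeasurableSpace S] [MeasurableSpace A] [Fintype A] {H d₁ d₂ : ℕ}

/-! Policy evaluation: least-squares temporal differences with UCB exploration. In the following
`D` is the data of the `n` past episodes, `V τ` are the value functions that were estimated in
episode `τ`, and `f` is the reward or the utility function; `f` is read at visited pairs only. -/

/-- `φ_V(x, a) = ∫ ψ(x, a, x') V(x') dx'`. -/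
noncomputable def kernelFeature (μ : Measure S) (ψ : S → A → S → EuclideanSpace ℝ (Fin d₁))
    (V : S → ℝ) (x : S) (a : A) : EuclideanSpace ℝ (Fin d₁) :=
  ∫ x', V x' • ψ x a x' ∂μ

/-- The estimate of the action-value function at step `h` for the episode after the `n` past
ones, given the estimate `Vnext` of the value function of that episode at the next step. -/
noncomputable def qEstimate (μ : Measure S) (ψ : S → A → S → EuclideanSpace ℝ (Fin d₁))
    (φ : S → A → EuclideanSpace ℝ (Fin d₂)) (par : Params) (f : Fin H → S → A → ℝ)
    {n : ℕ} (D : Fin n → Episode S A H) (V : Fin n → Fin (H + 1) → S → ℝ)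
    (h : Fin H) (Vnext : S → ℝ) (x : S) (a : A) : ℝ :=
  let xs : Fin n → S := fun τ => (D τ).1 h.castSucc
  let as : Fin n → A := fun τ => (D τ).2 h
  let kf : Fin n → EuclideanSpace ℝ (Fin d₁) :=
    fun τ => kernelFeature μ ψ (V τ h.succ) (xs τ) (as τ)
  let vf : Fin n → EuclideanSpace ℝ (Fin d₂) := fun τ => φ (xs τ) (as τ)
  let w : Fin d₁ → ℝ := ridge par.lam kf fun τ => V τ h.succ ((D τ).1 h.succ)
  let u : Fin d₂ → ℝ := ridge par.lam vf fun τ => f h (xs τ) (as τ)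
  let k : EuclideanSpace ℝ (Fin d₁) := kernelFeature μ ψ Vnext x a
  max (min ((φ x a).ofLp ⬝ᵥ u + k.ofLp ⬝ᵥ w
    + (bonus par.β par.lam vf (φ x a) + bonus par.β par.lam kf k)) ((H : ℝ) - (h : ℕ))) 0

/-- The estimated value functions of `π`, by backward recursion from zero at step `H + 1`. -/
noncomputable def vEval (μ : Measure S) (ψ : S → A → S → EuclideanSpace ℝ (Fin d₁))
    (φ : S → A → EuclideanSpace ℝ (Fin d₂)) (par : Params) (f : Fin H → S → A → ℝ)
    {n : ℕ} (D : Fin n → Episode S A H) (V : Fin n → Fin (H + 1) → S → ℝ)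
    (π : PolicyFun S A H) (h : Fin (H + 1)) : S → ℝ :=
  Fin.reverseInduction (motive := fun _ => S → ℝ) (fun _ => 0)
    (fun h Vnext x => ∑ a, qEstimate μ ψ φ par f D V h Vnext x a * π h x a) h

/-- The estimated action-value functions of `π`. -/
noncomputable def qEval (μ : Measure S) (ψ : S → A → S → EuclideanSpace ℝ (Fin d₁))
    (φ : S → A → EuclideanSpace ℝ (Fin d₂)) (par : Params) (f : Fin H → S → A → ℝ)
    {n : ℕ} (D : Fin n → Episode S A H) (V : Fin n → Fin (H + 1) → S → ℝ)
    (π : PolicyFun S A H) (h : Fin H) : S → A → ℝ :=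
  qEstimate μ ψ φ par f D V h (vEval μ ψ φ par f D V π h.succ)

/-! Policy improvement and dual update. -/

/-- `(1 - θ) π + θ Unif(A)`. -/
noncomputable def mix (θ : ℝ) (π : PolicyFun S A H) : PolicyFun S A H :=
  fun h x a => (1 - θ) * π h x a + θ / Fintype.card A

/-- The policy proportional to `(mixed previous policy) * exp (α (Q_r + Y Q_g))`. -/
noncomputable def improve (par : Params) (prev : Iterate S A H) : PolicyFun S A H :=
  fun h x a =>
    mix par.θ prev.pol h x a * Real.exp (par.α * (prev.Qr h x a + prev.Y * prev.Qg h x a)) /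
      ∑ a', mix par.θ prev.pol h x a' *
        Real.exp (par.α * (prev.Qr h x a' + prev.Y * prev.Qg h x a'))

/-- The projected dual update onto `[0, χ]`. -/
noncomputable def dualUpdate (par : Params) (b : ℝ) (x₁ : S) (prev : Iterate S A H) : ℝ :=
  max 0 (min par.χ (prev.Y + par.η * (b - prev.Vg 0 x₁)))

/-- The initialization (iterate `0`). Of the value functions only `V_{g,1}^0 = b` is ever read. -/
noncomputable def initial (b : ℝ) : Iterate S A H where
  pol := fun _ _ _ => 1 / Fintype.card A
  Y := 0
  Qr := fun _ _ _ => 0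
  Qg := fun _ _ _ => 0
  Vr := fun _ _ => 0
  Vg := fun _ _ => b

/-- Episode `n + 1`, from the data `D` and the iterates of the episodes `1, …, n`. -/
noncomputable def episodeStep (M : CMDP S A H) (μ : Measure S)
    (ψ : S → A → S → EuclideanSpace ℝ (Fin d₁)) (φ : S → A → EuclideanSpace ℝ (Fin d₂))
    (par : Params) {n : ℕ} (D : Fin n → Episode S A H) (past : Fin n → Iterate S A H) :
    Iterate S A H :=
  let prev : Iterate S A H :=
    if hn : 0 < n then past ⟨n - 1, Nat.sub_lt hn Nat.one_pos⟩ else initial M.b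
  let π : PolicyFun S A H := improve par prev
  { pol := π
    Y := dualUpdate par M.b M.x₁ prev
    Qr := qEval μ ψ φ par M.r D (fun τ => (past τ).Vr) π
    Qg := qEval μ ψ φ par M.g D (fun τ => (past τ).Vg) π
    Vr := vEval μ ψ φ par M.r D (fun τ => (past τ).Vr) π
    Vg := vEval μ ψ φ par M.g D (fun τ => (past τ).Vg) π }

/-- The algorithm: the iterate of episode `n + 1` as a function of the first `n` episodes. -/
noncomputable def opdop (M : CMDP S A H) (μ : Measure S)
    (ψ : S → A → S → EuclideanSpace ℝ (Fin d₁)) (φ : S → A → EuclideanSpace ℝ (Fin d₂))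
    (par : Params) (n : ℕ) (D : Fin n → Episode S A H) : Iterate S A H :=
  episodeStep M μ ψ φ par D fun τ : Fin n =>
    opdop M μ ψ φ par τ fun i => D (Fin.castLE τ.2.le i)
termination_by n
decreasing_by exact τ.2

/-- The joint law of the first `n` episodes when the algorithm interacts with the CMDP: episode
`n + 1` starts in `x₁` and follows the policy computed from the first `n` episodes. -/
noncomputable def runLaw (M : CMDP S A H) (μ : Measure S)
    (ψ : S → A → S → EuclideanSpace ℝ (Fin d₁)) (φ : S → A → EuclideanSpace ℝ (Fin d₂))
    (par : Params) : (n : ℕ) → Measure (Fin n → Episode S A H)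
  | 0 => Measure.dirac Fin.elim0
  | n + 1 => (runLaw M μ ψ φ par n).bind fun D =>
      (trajLaw H M.P (opdop M μ ψ φ par n D).pol M.x₁).map
        fun e => Fin.snoc (α := fun _ => Episode S A H) D e

/-- The policy played in episode `k + 1`. -/
noncomputable def played (M : CMDP S A H) (μ : Measure S)
    (ψ : S → A → S → EuclideanSpace ℝ (Fin d₁)) (φ : S → A → EuclideanSpace ℝ (Fin d₂))
    (par : Params) {K : ℕ} (D : Fin K → Episode S A H) (k : Fin K) : PolicyFun S A H :=
  (opdop M μ ψ φ par k fun i => D (Fin.castLE k.2.le i)).pol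

/-- `Regret(K) = ∑_k (V_{r,1}^{π⋆}(x₁) - V_{r,1}^{π^k}(x₁))`. -/
noncomputable def regret (M : CMDP S A H) (μ : Measure S)
    (ψ : S → A → S → EuclideanSpace ℝ (Fin d₁)) (φ : S → A → EuclideanSpace ℝ (Fin d₂))
    (par : Params) (πstar : PolicyFun S A H) {K : ℕ} (D : Fin K → Episode S A H) : ℝ :=
  ∑ k, (M.value M.r πstar - M.value M.r (played M μ ψ φ par D k))

/-- `Violation(K) = [∑_k (b - V_{g,1}^{π^k}(x₁))]₊`. -/
noncomputable def violation (M : CMDP S A H) (μ : Measure S)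
    (ψ : S → A → S → EuclideanSpace ℝ (Fin d₁)) (φ : S → A → EuclideanSpace ℝ (Fin d₂))
    (par : Params) {K : ℕ} (D : Fin K → Episode S A H) : ℝ :=
  max (∑ k, (M.b - M.value M.g (played M μ ψ φ par D k))) 0

end Algorithm

/-- `log (dT / p)` with `T = H K`. -/
noncomputable def logTerm (d H K : ℕ) (p : ℝ) : ℝ :=
  Real.log ((d : ℝ) * ((H : ℝ) * K) / p)

/-- `α = √(log |A|) / (H² √K)`, `β = C₁ √(d H² log (dT / p))`, `η = 1 / √K`, `θ = 1 / K`,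
`λ = 1`, `χ = 2H / γ`. -/
noncomputable def tuned (C₁ γ p : ℝ) (cardA d H K : ℕ) : Params where
  α := √(Real.log cardA) / ((H : ℝ) ^ 2 * √(K : ℝ))
  β := C₁ * √((d : ℝ) * (H : ℝ) ^ 2 * logTerm d H K p)
  η := 1 / √(K : ℝ)
  θ := 1 / (K : ℝ)
  lam := 1
  χ := 2 * (H : ℝ) / γ

end OPDOP

/-! Write L for log(dT/p), V_r^k and V_g^k for the estimated values in episode k, Y^k for the dual
variable. The proof combines concentration of the regressions, an online primal-dual argument, and a
consequence of Slater's condition.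

Concentration. By linearity of the kernel the feature of V^τ at (x,a) has inner product with θ_h
equal to the expectation of V^τ under P_h(·|x,a). The parameter θ_h is the same for all τ, and V^τ
is determined by the episodes before τ. The targets are therefore a linear model with martingale
noise, and no uniform bound over a class of value functions is needed. If S_n is the sum of noise
times feature and u_k is the squared norm of the k-th feature in the inverse Gram matrix of its
predecessors, then exp((‖S_n‖² - ∑_{k<n} u_k/(1+u_k))/2), with the norm taken in Λ_n⁻¹, is a
supermartingale: a rank-one update gives the increment, and Hoeffding's lemma bounds its exponential
moment (`lintegral_selfNormalized_step`, `runLaw_selfNormalized`). The compensator is at most log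
det Λ_n, of order dL (`sum_leverage_le`). Hence each estimated Q lies between its Bellman backup and
that backup plus a capped bonus (`optimism`). The expected bonuses are dominated by twice the
realized ones up to a logarithm (`runLaw_errorBound`), and these sum to order H²√K dL by the
elliptical potential lemma and Cauchy-Schwarz (`sum_cost_errorBound_le`).

Primal-dual argument, on the event of optimism. The estimated value of the played policy exceeds its
true value by at most the expected bonuses (`iter_V_le_value`). At every state exponentiated
gradient has small regret for the payoffs Q_r^k + Y^k Q_g^k, and summing over episodes inside the
Bellman recursion compares π⋆ with the estimates (`value_le_sum_iter_V`). Projected gradient ascent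
replaces Y^k by any fixed y in [0,χ] (`dual_regret`). Since π⋆ is feasible, these combine into an
upper bound for Regret + y ∑(b - V_g^{π^k}) (`lagrangian_regret`).

Conclusion. Taking y = 0 bounds the regret. For the violation, the set of achievable pairs (V_r,
V_g) is convex, because two policies can be merged into one Markov policy (`exists_merged_policy`).
Together with Slater's condition this shows that violating the constraint by ε gains at most (H/γ)ε
of reward, so the regret is at least -(H/γ) times the violation (`sum_value_sub_ge`). With y = χ =
2H/γ half of the dual term survives and bounds the violation. -/

namespace OPDOP

set_option linter.unusedSectionVars false

/-! ### Regularized least squares: rank-one updates and self-normalized quadratic forms -/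

section Ridge

variable {n m : ℕ}

lemma vecMulVec_self_mulVec (a x : Fin m → ℝ) :
    Matrix.vecMulVec a a *ᵥ x = (a ⬝ᵥ x) • a := by
  rw [Matrix.vecMulVec_mulVec]; ext i; simp [mul_comm]

lemma gram_posDef {lam : ℝ} (hlam : 0 < lam) (v : Fin n → EuclideanSpace ℝ (Fin m)) :
    (gram lam v).PosDef := by
  unfold gram
  refine Matrix.PosDef.posSemidef_add ?_ (Matrix.PosDef.one.smul hlam)
  exact Matrix.posSemidef_sum _ fun τ _ => by
    simpa using Matrix.posSemidef_vecMulVec_self_star (v τ).ofLp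

lemma isUnit_det_of_posDef {M : Matrix (Fin m) (Fin m) ℝ} (hM : M.PosDef) : IsUnit M.det :=
  hM.det_pos.ne'.isUnit

lemma dotProduct_mulVec_symm {M : Matrix (Fin m) (Fin m) ℝ} (hM : M.PosSemidef)
    (x y : Fin m → ℝ) : x ⬝ᵥ (M *ᵥ y) = y ⬝ᵥ (M *ᵥ x) := by
  have h : Mᵀ = M := by simpa [Matrix.IsSymm] using hM.isHermitian
  rw [Matrix.dotProduct_mulVec, ← Matrix.mulVec_transpose, h, dotProduct_comm]

lemma posSemidef_quad_nonneg {M : Matrix (Fin m) (Fin m) ℝ} (hM : M.PosSemidef)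
    (x : Fin m → ℝ) : 0 ≤ x ⬝ᵥ (M *ᵥ x) := by
  simpa using hM.dotProduct_mulVec_nonneg x

/-- The Cauchy-Schwarz inequality for a positive semidefinite matrix. -/
lemma posSemidef_cauchy_schwarz {M : Matrix (Fin m) (Fin m) ℝ} (hM : M.PosSemidef)
    (x y : Fin m → ℝ) :
    |x ⬝ᵥ (M *ᵥ y)| ≤ √(x ⬝ᵥ (M *ᵥ x)) * √(y ⬝ᵥ (M *ᵥ y)) := by
  have key : (x ⬝ᵥ (M *ᵥ y)) ^ 2 ≤ (x ⬝ᵥ (M *ᵥ x)) * (y ⬝ᵥ (M *ᵥ y)) := by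
    have h := discrim_le_zero (a := x ⬝ᵥ (M *ᵥ x)) (b := 2 * (x ⬝ᵥ (M *ᵥ y)))
      (c := y ⬝ᵥ (M *ᵥ y)) fun t => by
        have h1 := posSemidef_quad_nonneg hM (t • x + y)
        have h2 : (t • x + y) ⬝ᵥ (M *ᵥ (t • x + y)) = (x ⬝ᵥ (M *ᵥ x)) * (t * t)
            + 2 * (x ⬝ᵥ (M *ᵥ y)) * t + y ⬝ᵥ (M *ᵥ y) := by
          simp only [Matrix.mulVec_add, Matrix.mulVec_smul, dotProduct_add, add_dotProduct,
            dotProduct_smul, smul_dotProduct, smul_eq_mul, dotProduct_mulVec_symm hM y x]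
          ring
        linarith
    unfold discrim at h
    nlinarith
  rw [← Real.sqrt_mul (posSemidef_quad_nonneg hM x)]
  exact Real.abs_le_sqrt key

lemma quad_nonneg (v : Fin n → EuclideanSpace ℝ (Fin m)) (x : Fin m → ℝ) :
    0 ≤ x ⬝ᵥ ((gram 1 v)⁻¹ *ᵥ x) :=
  posSemidef_quad_nonneg (gram_posDef one_pos v).inv.posSemidef x

lemma dotProduct_self_eq_norm_sq (x : EuclideanSpace ℝ (Fin m)) : x.ofLp ⬝ᵥ x.ofLp = ‖x‖ ^ 2 := by
  rw [EuclideanSpace.norm_eq, Real.sq_sqrt (Finset.sum_nonneg fun i _ => by positivity)]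
  simp [dotProduct, pow_two]

lemma inner_eq_dotProduct (x y : EuclideanSpace ℝ (Fin m)) :
    inner ℝ x y = x.ofLp ⬝ᵥ y.ofLp := by
  rw [EuclideanSpace.inner_eq_star_dotProduct, dotProduct_comm]; simp

/-- `⟨θ, Λ⁻¹ θ⟩ ≤ ‖θ‖²`, since `Λ ≥ I`. -/
lemma quad_le_norm_sq (v : Fin n → EuclideanSpace ℝ (Fin m)) (θ : EuclideanSpace ℝ (Fin m)) :
    θ.ofLp ⬝ᵥ ((gram 1 v)⁻¹ *ᵥ θ.ofLp) ≤ ‖θ‖ ^ 2 := by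
  -- With z = Λ⁻¹θ, the bound Λ ≥ I reads ‖z‖² ≤ ⟨z, Λz⟩ = ⟨θ, z⟩. Expanding ‖θ - z‖² ≥ 0 then gives
  -- ⟨θ, z⟩ ≤ ‖θ‖².
  set z : Fin m → ℝ := (gram 1 v)⁻¹ *ᵥ θ.ofLp with hz
  have hΛ : gram 1 v *ᵥ z = θ.ofLp := by
    rw [hz, Matrix.mulVec_mulVec, Matrix.mul_nonsing_inv _ (isUnit_det_of_posDef
      (gram_posDef one_pos v)), Matrix.one_mulVec]
  have h1 : z ⬝ᵥ z ≤ θ.ofLp ⬝ᵥ z := by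
    have : z ⬝ᵥ (gram 1 v *ᵥ z) = ∑ τ, ((v τ).ofLp ⬝ᵥ z) ^ 2 + z ⬝ᵥ z := by
      unfold gram
      simp only [Matrix.add_mulVec, Matrix.sum_mulVec, vecMulVec_self_mulVec, one_smul,
        Matrix.one_mulVec, dotProduct_add, dotProduct_sum, dotProduct_smul, smul_eq_mul]
      congr 1
      exact Finset.sum_congr rfl fun τ _ => by rw [dotProduct_comm z]; ring
    rw [hΛ, dotProduct_comm] at this
    rw [this]
    have : 0 ≤ ∑ τ, ((v τ).ofLp ⬝ᵥ z) ^ 2 := Finset.sum_nonneg fun _ _ => sq_nonneg _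
    linarith
  have h2 : 0 ≤ (θ.ofLp - z) ⬝ᵥ (θ.ofLp - z) := by
    simpa [dotProduct] using Finset.sum_nonneg fun i _ => mul_self_nonneg ((θ.ofLp - z) i)
  have h3 : (θ.ofLp - z) ⬝ᵥ (θ.ofLp - z) = ‖θ‖ ^ 2 - 2 * (θ.ofLp ⬝ᵥ z) + z ⬝ᵥ z := by
    rw [sub_dotProduct, dotProduct_sub, dotProduct_sub, dotProduct_self_eq_norm_sq,
      dotProduct_comm z θ.ofLp]; ring
  linarith

/-- The error of ridge regression in the direction `k`. -/
lemma ridge_error (v : Fin n → EuclideanSpace ℝ (Fin m)) (y ε : Fin n → ℝ)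
    (θ : EuclideanSpace ℝ (Fin m)) (hy : ∀ τ, y τ = (v τ).ofLp ⬝ᵥ θ.ofLp + ε τ)
    (k : Fin m → ℝ) :
    |k ⬝ᵥ ridge 1 v y - k ⬝ᵥ θ.ofLp| ≤ √(k ⬝ᵥ ((gram 1 v)⁻¹ *ᵥ k)) *
      (√((∑ τ, ε τ • (v τ).ofLp) ⬝ᵥ ((gram 1 v)⁻¹ *ᵥ ∑ τ, ε τ • (v τ).ofLp)) + ‖θ‖) := by
  set s : Fin m → ℝ := ∑ τ, ε τ • (v τ).ofLp with hs
  have hpd := gram_posDef one_pos v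
  -- The term -θ is the bias of the regularizer I; it costs the summand ‖θ‖ of the bound.
  have h1 : ∑ τ, y τ • (v τ).ofLp = gram 1 v *ᵥ θ.ofLp + (s - θ.ofLp) := by
    unfold gram
    simp only [Matrix.add_mulVec, Matrix.sum_mulVec, vecMulVec_self_mulVec, one_smul,
      Matrix.one_mulVec, hs, hy, add_smul, Finset.sum_add_distrib]
    abel
  have h2 : ridge 1 v y = θ.ofLp + (gram 1 v)⁻¹ *ᵥ (s - θ.ofLp) := by
    rw [ridge, h1, Matrix.mulVec_add, Matrix.mulVec_mulVec,
      Matrix.nonsing_inv_mul _ (isUnit_det_of_posDef hpd), Matrix.one_mulVec]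
  have h3 : k ⬝ᵥ ridge 1 v y - k ⬝ᵥ θ.ofLp
      = k ⬝ᵥ ((gram 1 v)⁻¹ *ᵥ s) - k ⬝ᵥ ((gram 1 v)⁻¹ *ᵥ θ.ofLp) := by
    rw [h2, dotProduct_add, Matrix.mulVec_sub, dotProduct_sub]; ring
  rw [h3, mul_add]
  refine (abs_sub _ _).trans (add_le_add (posSemidef_cauchy_schwarz hpd.inv.posSemidef _ _)
    ((posSemidef_cauchy_schwarz hpd.inv.posSemidef _ _).trans ?_))
  refine mul_le_mul_of_nonneg_left ?_ (Real.sqrt_nonneg _)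
  rw [Real.sqrt_le_left (norm_nonneg _)]
  exact quad_le_norm_sq v θ

/-! Rank-one updates. -/

lemma posDef_add_vecMulVec {M : Matrix (Fin m) (Fin m) ℝ} (hM : M.PosDef) (a : Fin m → ℝ) :
    (M + Matrix.vecMulVec a a).PosDef :=
  hM.add_posSemidef (by simpa using Matrix.posSemidef_vecMulVec_self_star a)

/-- The matrix determinant lemma: each new feature multiplies the determinant by one plus its
leverage, so log det is a sum over the features. -/
lemma det_add_vecMulVec {M : Matrix (Fin m) (Fin m) ℝ} (hM : M.PosDef) (a : Fin m → ℝ) :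
    (M + Matrix.vecMulVec a a).det = M.det * (1 + a ⬝ᵥ (M⁻¹ *ᵥ a)) := by
  rw [Matrix.vecMulVec_eq Unit, Matrix.det_add_replicateCol_mul_replicateRow
    (isUnit_det_of_posDef hM), Matrix.det_unique (n := Unit)]
  congr 1
  simp [Matrix.mul_apply, dotProduct, Matrix.mulVec, Matrix.replicateCol, Matrix.replicateRow,
    Finset.sum_mul, Finset.mul_sum]
  rw [Finset.sum_comm]
  simp [mul_assoc]

/-- The Sherman-Morrison formula. -/
lemma inv_add_vecMulVec_mulVec {M : Matrix (Fin m) (Fin m) ℝ} (hM : M.PosDef)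
    (a s : Fin m → ℝ) :
    (M + Matrix.vecMulVec a a)⁻¹ *ᵥ s
      = M⁻¹ *ᵥ s - ((a ⬝ᵥ (M⁻¹ *ᵥ s)) / (1 + a ⬝ᵥ (M⁻¹ *ᵥ a))) • (M⁻¹ *ᵥ a) := by
  have hu : 0 < 1 + a ⬝ᵥ (M⁻¹ *ᵥ a) := by
    have := posSemidef_quad_nonneg hM.inv.posSemidef a; linarith
  have hMs : ∀ x, M *ᵥ (M⁻¹ *ᵥ x) = x := fun x => by
    rw [Matrix.mulVec_mulVec, Matrix.mul_nonsing_inv _ (isUnit_det_of_posDef hM),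
      Matrix.one_mulVec]
  have h : (M + Matrix.vecMulVec a a) *ᵥ (M⁻¹ *ᵥ s
      - ((a ⬝ᵥ (M⁻¹ *ᵥ s)) / (1 + a ⬝ᵥ (M⁻¹ *ᵥ a))) • (M⁻¹ *ᵥ a)) = s := by
    rw [Matrix.mulVec_sub, Matrix.mulVec_smul, Matrix.add_mulVec, Matrix.add_mulVec, hMs, hMs,
      vecMulVec_self_mulVec, vecMulVec_self_mulVec]
    ext i
    simp only [Pi.sub_apply, Pi.add_apply, Pi.smul_apply, smul_eq_mul]
    field_simp
    ring
  calc _ = (M + Matrix.vecMulVec a a)⁻¹ *ᵥ ((M + Matrix.vecMulVec a a) *ᵥ _) := by rw [h]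
    _ = _ := by
      rw [Matrix.mulVec_mulVec, Matrix.nonsing_inv_mul _
        (isUnit_det_of_posDef (posDef_add_vecMulVec hM a)), Matrix.one_mulVec]

/-- The quadratic form of the updated inverse at the updated vector. -/
lemma quad_rank_one_update {M : Matrix (Fin m) (Fin m) ℝ} (hM : M.PosDef) (a s : Fin m → ℝ)
    (ε : ℝ) :
    (s + ε • a) ⬝ᵥ ((M + Matrix.vecMulVec a a)⁻¹ *ᵥ (s + ε • a))
      = s ⬝ᵥ (M⁻¹ *ᵥ s) + (2 * ε * (a ⬝ᵥ (M⁻¹ *ᵥ s)) + ε ^ 2 * (a ⬝ᵥ (M⁻¹ *ᵥ a))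
          - (a ⬝ᵥ (M⁻¹ *ᵥ s)) ^ 2) / (1 + a ⬝ᵥ (M⁻¹ *ᵥ a)) := by
  have hu : 0 < 1 + a ⬝ᵥ (M⁻¹ *ᵥ a) := by
    have := posSemidef_quad_nonneg hM.inv.posSemidef a; linarith
  rw [inv_add_vecMulVec_mulVec hM]
  simp only [Matrix.mulVec_add, Matrix.mulVec_smul, dotProduct_add, add_dotProduct,
    dotProduct_sub, dotProduct_smul, smul_dotProduct, smul_eq_mul,
    dotProduct_mulVec_symm hM.inv.posSemidef s a]
  field_simp
  ring

/-! Sequences of features `v 0, v 1, …`. -/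

/-- `⟨x, Λ_n⁻¹ y⟩` where `Λ_n` is the regularized Gram matrix of the first `n` features. -/
noncomputable def invForm (v : ℕ → EuclideanSpace ℝ (Fin m)) (n : ℕ) (x y : Fin m → ℝ) : ℝ :=
  x ⬝ᵥ ((gram 1 fun τ : Fin n => v τ)⁻¹ *ᵥ y)

/-- `S_n = ∑_{τ < n} ε_τ v_τ`. -/
noncomputable def noiseSum (v : ℕ → EuclideanSpace ℝ (Fin m)) (ε : ℕ → ℝ) (n : ℕ) : Fin m → ℝ :=
  ∑ τ : Fin n, ε τ • (v τ).ofLp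

/-- The squared norm of the `n`-th feature in the geometry of the previous ones. -/
noncomputable def leverage (v : ℕ → EuclideanSpace ℝ (Fin m)) (n : ℕ) : ℝ :=
  invForm v n (v n).ofLp (v n).ofLp

lemma leverage_nonneg (v : ℕ → EuclideanSpace ℝ (Fin m)) (n : ℕ) : 0 ≤ leverage v n :=
  quad_nonneg _ _

lemma gram_succ (v : ℕ → EuclideanSpace ℝ (Fin m)) (n : ℕ) :
    (gram 1 fun τ : Fin (n + 1) => v τ)
      = (gram 1 fun τ : Fin n => v τ) + Matrix.vecMulVec (v n).ofLp (v n).ofLp := by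
  unfold gram
  rw [Fin.sum_univ_castSucc]
  simp only [Fin.val_castSucc, Fin.val_last]
  abel

/-- Telescopes the rank-one update of the quadratic form. The resulting increments are explicit in
the new noise variable, which makes the self-normalized norm accessible to a one-step
supermartingale argument. -/
lemma invForm_noiseSum (v : ℕ → EuclideanSpace ℝ (Fin m)) (ε : ℕ → ℝ) (n : ℕ) :
    invForm v n (noiseSum v ε n) (noiseSum v ε n)
      = ∑ k ∈ Finset.range n, (2 * ε k * invForm v k (v k).ofLp (noiseSum v ε k)
          + ε k ^ 2 * leverage v k - invForm v k (v k).ofLp (noiseSum v ε k) ^ 2)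
            / (1 + leverage v k) := by
  induction n with
  | zero => simp [noiseSum, invForm]
  | succ n ih =>
    rw [Finset.sum_range_succ, ← ih]
    have : noiseSum v ε (n + 1) = noiseSum v ε n + ε n • (v n).ofLp := by
      simp [noiseSum, Fin.sum_univ_castSucc]
    rw [this, invForm, gram_succ, quad_rank_one_update (gram_posDef one_pos _)]
    rfl

/-- Each factor 1 + u of the determinant contributes log(1 + u) ≥ 1 - 1/(1 + u) = u/(1 + u). -/
lemma log_det_gram (v : ℕ → EuclideanSpace ℝ (Fin m)) (n : ℕ) :
    ∑ k ∈ Finset.range n, leverage v k / (1 + leverage v k)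
      ≤ Real.log (gram 1 fun τ : Fin n => v τ).det := by
  induction n with
  | zero => simp [gram]
  | succ n ih =>
    have hu := leverage_nonneg v n
    rw [Finset.sum_range_succ, gram_succ, det_add_vecMulVec (gram_posDef one_pos _),
      Real.log_mul (gram_posDef one_pos _).det_pos.ne' (by
        have : leverage v n = (v n).ofLp ⬝ᵥ ((gram 1 fun τ : Fin n => v τ)⁻¹ *ᵥ (v n).ofLp) := rfl
        linarith)]
    refine add_le_add ih ?_
    have h := Real.one_sub_inv_le_log_of_pos (x := 1 + leverage v n) (by linarith)
    refine le_trans (le_of_eq ?_) h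
    field_simp
    ring

/-- Every eigenvalue is at most the trace. This is cruder than the arithmetic-geometric mean
inequality, but only the logarithm of the bound is used. -/
lemma det_le_trace_pow {M : Matrix (Fin m) (Fin m) ℝ} (hM : M.PosSemidef) :
    M.det ≤ M.trace ^ m := by
  have hH := hM.isHermitian
  have h1 : M.det = ∏ i, hH.eigenvalues i := by simpa using hH.det_eq_prod_eigenvalues
  have h2 : M.trace = ∑ i, hH.eigenvalues i := by simpa using hH.trace_eq_sum_eigenvalues
  rw [h1, h2]
  calc _ ≤ ∏ _i : Fin m, ∑ i, hH.eigenvalues i :=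
        Finset.prod_le_prod (fun i _ => hM.eigenvalues_nonneg i) fun i _ =>
          Finset.single_le_sum (fun j _ => hM.eigenvalues_nonneg j) (Finset.mem_univ i)
    _ = _ := by simp

/-- The elliptical potential lemma. -/
lemma sum_leverage_le (v : ℕ → EuclideanSpace ℝ (Fin m)) (n : ℕ) {B : ℝ}
    (hB : ∀ k < n, ‖v k‖ ^ 2 ≤ B) :
    ∑ k ∈ Finset.range n, leverage v k / (1 + leverage v k) ≤ m * Real.log (m + n * B) := by
  refine (log_det_gram v n).trans ?_
  have hpd := gram_posDef one_pos fun τ : Fin n => v τ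
  have htr : (gram 1 fun τ : Fin n => v τ).trace ≤ m + n * B := by
    unfold gram
    rw [Matrix.trace_add, Matrix.trace_sum]
    simp only [Matrix.trace_vecMulVec, dotProduct_self_eq_norm_sq, one_smul, Matrix.trace_one,
      Fintype.card_fin]
    have : ∑ τ : Fin n, ‖v τ‖ ^ 2 ≤ ∑ _τ : Fin n, B := Finset.sum_le_sum fun τ _ => hB τ τ.2
    simp at this
    linarith
  calc _ ≤ Real.log ((m + n * B) ^ m) := by
        refine Real.log_le_log hpd.det_pos ((det_le_trace_pow hpd.posSemidef).trans ?_)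
        exact pow_le_pow_left₀ hpd.posSemidef.trace_nonneg htr m
    _ = _ := Real.log_pow _ _

end Ridge

/-! ### Elementary exponential inequalities -/

/-- The chord of the exponential function over `[-c, c]` lies above it. -/
lemma mul_exp_le_chord {x c : ℝ} (hc : 0 ≤ c) (hx : |x| ≤ c) :
    c * Real.exp x ≤ c * Real.cosh c + x * Real.sinh c := by
  rcases hc.eq_or_lt with rfl | hc
  · simp [abs_nonpos_iff.mp hx]
  obtain ⟨h1, h2⟩ := abs_le.mp hx
  have h := convexOn_exp.2 (Set.mem_univ (-c)) (Set.mem_univ c)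
    (show 0 ≤ (c - x) / (2 * c) by apply div_nonneg <;> linarith)
    (show 0 ≤ (c + x) / (2 * c) by apply div_nonneg <;> linarith) (by field_simp; ring)
  have e : (c - x) / (2 * c) * -c + (c + x) / (2 * c) * c = x := by field_simp; ring
  simp only [smul_eq_mul, e] at h
  rw [Real.cosh_eq, Real.sinh_eq]
  calc c * Real.exp x ≤ c * _ := mul_le_mul_of_nonneg_left h hc.le
    _ = _ := by field_simp; ring

/-- Hoeffding's bound in pointwise form. -/
lemma exp_le_hoeffding {x c : ℝ} (hc : 0 < c) (hx : |x| ≤ c) :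
    Real.exp x ≤ Real.exp (c ^ 2 / 2) + x * (Real.sinh c / c) := by
  -- The chord is affine in x, so its linear term vanishes after averaging a centered variable. The
  -- pointwise form serves both for integrals and for the finite sums of mirror descent.
  have h1 := mul_exp_le_chord hc.le hx
  have h2 := Real.cosh_le_exp_half_sq c
  have h3 : Real.exp x ≤ Real.cosh c + x * (Real.sinh c / c) := by
    rw [← mul_le_mul_iff_right₀ hc]
    refine h1.trans (le_of_eq ?_)
    field_simp
  linarith

/-- The graph of exp over [-1, 0] lies below its chord, and exp(-1) ≤ 1/2. -/
lemma exp_neg_le_one_sub_half {x : ℝ} (h0 : 0 ≤ x) (h1 : x ≤ 1) : Real.exp (-x) ≤ 1 - x / 2 := by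
  have h := convexOn_exp.2 (Set.mem_univ (-1 : ℝ)) (Set.mem_univ 0) h0
    (show 0 ≤ 1 - x by linarith) (by ring)
  simp only [smul_eq_mul, mul_neg, mul_one, mul_zero, add_zero, Real.exp_zero] at h
  have h2 : Real.exp (-1) ≤ 1 / 2 := by
    rw [Real.exp_neg, inv_le_comm₀ (Real.exp_pos _) (by norm_num)]
    have := Real.add_one_le_exp (1 : ℝ)
    norm_num at this ⊢
    linarith
  nlinarith

/-! ### The law of a trajectory -/

section Trajectory

variable {S A : Type*} [MeasurableSpace S] [MeasurableSpace A] [Fintype A]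

/-- The trajectory that starts with the pair `(x, a)` and continues as `e`. -/
def Episode.cons {n : ℕ} (x : S) (a : A) (e : Episode S A n) : Episode S A (n + 1) :=
  (Fin.cons x e.1, Fin.cons a e.2)

lemma measurable_episode_cons {n : ℕ} (a : A) :
    Measurable fun z : S × Episode S A n => Episode.cons z.1 a z.2 := by
  unfold Episode.cons
  refine Measurable.prodMk (measurable_pi_iff.mpr fun i => ?_) (measurable_pi_iff.mpr fun i => ?_)
  · refine Fin.cases ?_ (fun j => ?_) i
    · simpa using measurable_fst
    · simpa [Function.comp_def] using (measurable_pi_apply j).comp (measurable_fst.comp measurable_snd)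
  · refine Fin.cases ?_ (fun j => ?_) i
    · simp
    · simpa [Function.comp_def] using (measurable_pi_apply j).comp (measurable_snd.comp measurable_snd)

lemma measurable_episode_cons_right {n : ℕ} (x : S) (a : A) :
    Measurable (Episode.cons x a : Episode S A n → _) :=
  (measurable_episode_cons a).comp measurable_prodMk_left

lemma trajLaw_succ {n : ℕ} (P : Fin (n + 1) → Kernel (S × A) S) (π : PolicyFun S A (n + 1))
    (x : S) :
    trajLaw (n + 1) P π x = ∑ a, ENNReal.ofReal (π 0 x a) • (P 0 (x, a)).bind fun x' =>
      (trajLaw n (fun h => P h.succ) (fun h => π h.succ) x').map (Episode.cons x a) := rfl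

lemma IsPolicy.succ {n : ℕ} {π : PolicyFun S A (n + 1)} (hπ : IsPolicy π) :
    IsPolicy (fun h => π h.succ : PolicyFun S A n) :=
  ⟨fun h => hπ.measurable h.succ, fun h => hπ.nonneg h.succ, fun h => hπ.sum_eq_one h.succ⟩

lemma IsPolicy.sum_ofReal {n : ℕ} {π : PolicyFun S A n} (hπ : IsPolicy π) (h : Fin n) (x : S) :
    ∑ a, ENNReal.ofReal (π h x a) = 1 := by
  rw [← ENNReal.ofReal_sum_of_nonneg fun a _ => hπ.nonneg h x a, hπ.sum_eq_one, ENNReal.ofReal_one]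

/-- The policy carries a parameter because the algorithm plays a policy that depends on the past
data. Both claims go through one induction: measurability at the next stage uses that the law of the
remaining trajectory is a Markov kernel. -/
theorem measurable_and_isProbabilityMeasure_trajLaw {Ω : Type*} [MeasurableSpace Ω] (n : ℕ) :
    ∀ (P : Fin n → Kernel (S × A) S) (_ : ∀ h, IsMarkovKernel (P h)) (π : Ω → PolicyFun S A n)
      (_ : ∀ ω, IsPolicy (π ω)) (_ : ∀ h a, Measurable fun z : Ω × S => π z.1 h z.2 a),
      Measurable (fun z : Ω × S => trajLaw n P (π z.1) z.2) ∧
        ∀ z : Ω × S, IsProbabilityMeasure (trajLaw n P (π z.1) z.2) := by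
  induction n with
  | zero =>
    intro P _ π _ _
    refine ⟨Measure.measurable_dirac.comp ?_, fun z => ?_⟩
    · exact Measurable.prodMk (measurable_pi_iff.mpr fun _ => measurable_snd) measurable_const
    · exact Measure.dirac.isProbabilityMeasure
  | succ n ih =>
    intro P hP π hπ hm
    obtain ⟨ihm, ihp⟩ := ih (fun h => P h.succ) (fun h => hP h.succ) (fun ω h => π ω h.succ)
      (fun ω => (hπ ω).succ) (fun h a => hm h.succ a)
    have hin : ∀ (z : Ω × S) (a : A), Measurable fun x' =>
        (trajLaw n (fun h => P h.succ) (fun h => π z.1 h.succ) x').map (Episode.cons z.2 a) :=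
      fun z a => (Measure.measurable_map _
        ((measurable_episode_cons a).comp measurable_prodMk_left)).comp
          (ihm.comp measurable_prodMk_left)
    have happ : ∀ (z : Ω × S) (B : Set (Episode S A (n + 1))), MeasurableSet B →
        trajLaw (n + 1) P (π z.1) z.2 B = ∑ a, ENNReal.ofReal (π z.1 0 z.2 a) *
          ∫⁻ x', trajLaw n (fun h => P h.succ) (fun h => π z.1 h.succ) x'
            (Episode.cons z.2 a ⁻¹' B) ∂(P 0 (z.2, a)) := by
      intro z B hB
      rw [trajLaw_succ, Measure.finsetSum_apply]
      refine Finset.sum_congr rfl fun a _ => ?_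
      rw [Measure.smul_apply, Measure.bind_apply hB (hin z a).aemeasurable, smul_eq_mul]
      congr 1
      refine lintegral_congr fun x' => ?_
      rw [Measure.map_apply (measurable_episode_cons_right _ a) hB]
    refine ⟨Measure.measurable_of_measurable_coe _ fun B hB => ?_, fun z => ⟨?_⟩⟩
    · simp_rw [fun z => happ z B hB]
      refine Finset.measurable_sum _ fun a _ => Measurable.mul
        (ENNReal.measurable_ofReal.comp (hm 0 a)) ?_
      let κ : Kernel ((Ω × S) × S) (Episode S A n) :=
        ⟨fun z => trajLaw n (fun h => P h.succ) (fun h => π z.1.1 h.succ) z.2,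
          ihm.comp (Measurable.prodMk (measurable_fst.comp measurable_fst) measurable_snd)⟩
      have : IsMarkovKernel κ := ⟨fun z => ihp (z.1.1, z.2)⟩
      have := hP 0
      have hc : Measurable fun z : Ω × S => (z.2, a) := measurable_snd.prodMk measurable_const
      have ht : MeasurableSet ((fun q : ((Ω × S) × S) × Episode S A n =>
          Episode.cons q.1.1.2 a q.2) ⁻¹' B) :=
        ((measurable_episode_cons a).comp (Measurable.prodMk
          (measurable_snd.comp (measurable_fst.comp measurable_fst)) measurable_snd)) hB
      exact (Kernel.measurable_kernel_prodMk_left (κ := κ) ht).lintegral_kernel_prod_right'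
        (κ := (P 0).comap _ hc)
    · rw [happ z _ MeasurableSet.univ]
      have h1 : ∀ x', trajLaw n (fun h => P h.succ) (fun h => π z.1 h.succ) x' Set.univ = 1 :=
        fun x' => (ihp (z.1, x')).measure_univ
      have h2 : ∀ a, P 0 (z.2, a) Set.univ = 1 := fun a => ((hP 0).isProbabilityMeasure _).measure_univ
      simp only [Set.preimage_univ, h1, lintegral_const, h2, mul_one, (hπ z.1).sum_ofReal]

variable {n : ℕ} {P : Fin n → Kernel (S × A) S} {π : PolicyFun S A n}

lemma measurable_trajLaw (hP : ∀ h, IsMarkovKernel (P h)) (hπ : IsPolicy π) :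
    Measurable (trajLaw n P π) :=
  ((measurable_and_isProbabilityMeasure_trajLaw (Ω := Unit) n P hP (fun _ => π) (fun _ => hπ)
    fun h a => (hπ.measurable h a).comp measurable_snd).1).comp
      (measurable_prodMk_left (x := ()))

lemma isProbabilityMeasure_trajLaw (hP : ∀ h, IsMarkovKernel (P h)) (hπ : IsPolicy π) (x : S) :
    IsProbabilityMeasure (trajLaw n P π x) :=
  (measurable_and_isProbabilityMeasure_trajLaw (Ω := Unit) n P hP (fun _ => π) (fun _ => hπ)
    fun h a => (hπ.measurable h a).comp measurable_snd).2 ((), x)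

lemma lintegral_trajLaw_succ {P : Fin (n + 1) → Kernel (S × A) S} {π : PolicyFun S A (n + 1)}
    (hP : ∀ h, IsMarkovKernel (P h)) (hπ : IsPolicy π) {F : Episode S A (n + 1) → ENNReal}
    (hF : Measurable F) (x : S) :
    ∫⁻ e, F e ∂(trajLaw (n + 1) P π x) = ∑ a, ENNReal.ofReal (π 0 x a) *
      ∫⁻ x', ∫⁻ e, F (Episode.cons x a e) ∂(trajLaw n (fun h => P h.succ) (fun h => π h.succ) x')
        ∂(P 0 (x, a)) := by
  have hc : ∀ a : A, Measurable (Episode.cons x a : Episode S A n → _) := fun a =>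
    (measurable_episode_cons a).comp measurable_prodMk_left
  rw [trajLaw_succ, lintegral_finsetSum_measure]
  refine Finset.sum_congr rfl fun a _ => ?_
  rw [lintegral_smul_measure, smul_eq_mul, Measure.lintegral_bind _ hF.aemeasurable]
  · congr 1
    exact lintegral_congr fun x' => lintegral_map hF (hc a)
  · exact ((Measure.measurable_map _ (hc a)).comp
      (measurable_trajLaw (fun h => hP h.succ) hπ.succ)).aemeasurable

/-- A bound for the transitions at step `h`, uniform in the state and the action, is a bound for
the expectation over a trajectory. -/
lemma lintegral_trajLaw_step_le (n : ℕ) :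
    ∀ (P : Fin n → Kernel (S × A) S) (_ : ∀ h, IsMarkovKernel (P h)) (π : PolicyFun S A n)
      (_ : IsPolicy π) (h : Fin n) (G : S → A → S → ENNReal)
      (_ : Measurable fun e : Episode S A n => G (e.1 h.castSucc) (e.2 h) (e.1 h.succ))
      (c : ENNReal) (_ : ∀ x a, ∫⁻ x', G x a x' ∂(P h (x, a)) ≤ c) (x : S),
      ∫⁻ e, G (e.1 h.castSucc) (e.2 h) (e.1 h.succ) ∂(trajLaw n P π x) ≤ c := by
  have avg : ∀ {n : ℕ} {π : PolicyFun S A (n + 1)} (_ : IsPolicy π) (x : S) (f : A → ENNReal)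
      (c : ENNReal), (∀ a, f a ≤ c) → ∑ a, ENNReal.ofReal (π 0 x a) * f a ≤ c := by
    intro n π hπ x f c hf
    calc _ ≤ ∑ a, ENNReal.ofReal (π 0 x a) * c :=
          Finset.sum_le_sum fun a _ => mul_le_mul_right (hf a) _
      _ = c := by rw [← Finset.sum_mul, hπ.sum_ofReal, one_mul]
  induction n with
  | zero => intro _ _ _ _ h; exact h.elim0
  | succ n ih =>
    intro P hP π hπ h G hG c hc x
    rw [lintegral_trajLaw_succ hP hπ hG]
    refine avg hπ x _ c fun a => ?_
    have hcons : Measurable (Episode.cons x a : Episode S A n → _) :=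
      (measurable_episode_cons a).comp measurable_prodMk_left
    refine Fin.cases (fun hG hc => ?_) (fun h hG hc => ?_) h hG hc
    · refine le_trans (le_of_eq (lintegral_congr fun x' => ?_)) (hc x a)
      -- For the first transition, the remaining trajectory enters only through its initial state,
      -- which is deterministic.
      have hstart : ∀ (n : ℕ) (P : Fin n → Kernel (S × A) S) (_ : ∀ h, IsMarkovKernel (P h))
          (π : PolicyFun S A n) (_ : IsPolicy π) (F : S → ENNReal)
          (_ : Measurable fun e : Episode S A n => F (e.1 0)) (x : S),
          ∫⁻ e, F (e.1 0) ∂(trajLaw n P π x) = F x := by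
        intro n P hP π hπ F hF x
        cases n with
        | zero => exact lintegral_dirac' _ hF
        | succ n =>
          rw [lintegral_trajLaw_succ hP hπ hF]
          have := fun x' => isProbabilityMeasure_trajLaw (fun h => hP h.succ) hπ.succ x'
          have := fun a => (hP 0).isProbabilityMeasure (x, a)
          simp [Episode.cons, ← Finset.sum_mul, hπ.sum_ofReal]
      have := hstart n (fun h => P h.succ) (fun h => hP h.succ) _ hπ.succ (G x a)
        (by simpa [Episode.cons, Function.comp_def] using hG.comp hcons) x'
      simpa [Episode.cons] using this
    · have := (hP 0).isProbabilityMeasure (x, a)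
      calc _ ≤ ∫⁻ _, c ∂(P 0 (x, a)) := by
            refine lintegral_mono fun x' => ?_
            exact ih (fun h => P h.succ) (fun h => hP h.succ) _ hπ.succ h G
              (by simpa [Episode.cons, Function.comp_def] using hG.comp hcons) c hc x'
        _ = c := by simp

end Trajectory

/-! ### Expected cumulative costs -/

section Value

variable {S A : Type*} [MeasurableSpace S] [MeasurableSpace A] [Fintype A]
  [DiscreteMeasurableSpace A]

/-- The cost of a trajectory. -/
def Episode.cost {n : ℕ} (c : Fin n → S → A → ℝ) (e : Episode S A n) : ℝ :=
  ∑ h, c h (e.1 h.castSucc) (e.2 h)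

/-- A bounded measurable cost function. -/
structure IsCost {n : ℕ} (c : Fin n → S → A → ℝ) : Prop where
  measurable : ∀ h a, Measurable fun x => c h x a
  bounded : ∃ C, ∀ h x a, |c h x a| ≤ C

lemma measurable_uncurry_of_forall {Ω Y : Type*} [MeasurableSpace Ω] [MeasurableSpace Y]
    {f : Ω → A → Y}
    (hf : ∀ a, Measurable fun x => f x a) : Measurable fun z : Ω × A => f z.1 z.2 :=
  measurable_from_prod_countable_left hf

lemma measurable_visited {n : ℕ} {Y : Type*} [MeasurableSpace Y] {f : S → A → Y}
    (hf : ∀ a, Measurable fun x => f x a) (h : Fin n) :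
    Measurable fun e : Episode S A n => f (e.1 h.castSucc) (e.2 h) :=
  (measurable_uncurry_of_forall hf).comp (Measurable.prodMk
    ((measurable_pi_apply _).comp measurable_fst) ((measurable_pi_apply _).comp measurable_snd))

lemma measurable_cost {n : ℕ} {c : Fin n → S → A → ℝ} (hc : ∀ h a, Measurable fun x => c h x a) :
    Measurable (Episode.cost c) :=
  Finset.measurable_sum _ fun h _ => measurable_visited (hc h) h

lemma Episode.cost_cons {n : ℕ} (c : Fin (n + 1) → S → A → ℝ) (x : S) (a : A)
    (e : Episode S A n) :
    (Episode.cons x a e).cost c = c 0 x a + e.cost fun h => c h.succ := by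
  simp [Episode.cost, Episode.cons, Fin.sum_univ_succ]

lemma Episode.abs_cost_le {n : ℕ} {c : Fin n → S → A → ℝ} {C : ℝ} (hC : ∀ h x a, |c h x a| ≤ C)
    (e : Episode S A n) : |e.cost c| ≤ n * C :=
  (Finset.abs_sum_le_sum_abs _ _).trans
    ((Finset.sum_le_sum fun h _ => hC h _ _).trans (by simp))

/-- The expected cumulative cost from the state `x`. -/
noncomputable def trajValue (n : ℕ) (P : Fin n → Kernel (S × A) S) (π : PolicyFun S A n)
    (c : Fin n → S → A → ℝ) (x : S) : ℝ :=
  ∫ e, e.cost c ∂(trajLaw n P π x)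

lemma integrable_of_measurable_of_bounded {Ω : Type*} [MeasurableSpace Ω] {μ : Measure Ω}
    [IsFiniteMeasure μ] {f : Ω → ℝ} (hf : Measurable f) {C : ℝ} (hC : ∀ ω, |f ω| ≤ C) :
    Integrable f μ :=
  Integrable.of_bound hf.aestronglyMeasurable C (Filter.Eventually.of_forall hC)

lemma abs_integral_le_of_bounded {Ω : Type*} [MeasurableSpace Ω] {μ : Measure Ω}
    [IsProbabilityMeasure μ] {f : Ω → ℝ} {C : ℝ} (hC : ∀ ω, |f ω| ≤ C) :
    |∫ ω, f ω ∂μ| ≤ C := by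
  simpa using norm_integral_le_of_norm_le_const (μ := μ) (f := f) (Filter.Eventually.of_forall hC)

variable {n : ℕ} {P : Fin n → Kernel (S × A) S} {π : PolicyFun S A n}

lemma IsCost.integrable {c : Fin n → S → A → ℝ} (hc : IsCost c)
    (hP : ∀ h, IsMarkovKernel (P h)) (hπ : IsPolicy π) (x : S) :
    Integrable (Episode.cost c) (trajLaw n P π x) := by
  have := isProbabilityMeasure_trajLaw hP hπ x
  obtain ⟨C, hC⟩ := hc.bounded
  exact integrable_of_measurable_of_bounded (measurable_cost hc.measurable)
    (Episode.abs_cost_le hC)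

lemma IsCost.succ {c : Fin (n + 1) → S → A → ℝ} (hc : IsCost c) : IsCost fun h => c h.succ :=
  ⟨fun h => hc.measurable h.succ, hc.bounded.imp fun _ hC h => hC h.succ⟩

lemma IsCost.add {c c' : Fin n → S → A → ℝ} (hc : IsCost c) (hc' : IsCost c') :
    IsCost fun h x a => c h x a + c' h x a := by
  obtain ⟨C, hC⟩ := hc.bounded
  obtain ⟨C', hC'⟩ := hc'.bounded
  exact ⟨fun h a => (hc.measurable h a).add (hc'.measurable h a), C + C', fun h x a =>
    (abs_add_le _ _).trans (add_le_add (hC h x a) (hC' h x a))⟩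

lemma IsCost.const_mul {c : Fin n → S → A → ℝ} (hc : IsCost c) (t : ℝ) :
    IsCost fun h x a => t * c h x a := by
  obtain ⟨C, hC⟩ := hc.bounded
  exact ⟨fun h a => (hc.measurable h a).const_mul t, |t| * C, fun h x a => by
    rw [abs_mul]; exact mul_le_mul_of_nonneg_left (hC h x a) (abs_nonneg t)⟩

lemma trajValue_add {c c' : Fin n → S → A → ℝ} (hc : IsCost c) (hc' : IsCost c')
    (hP : ∀ h, IsMarkovKernel (P h)) (hπ : IsPolicy π) (x : S) :
    trajValue n P π (fun h x a => c h x a + c' h x a) x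
      = trajValue n P π c x + trajValue n P π c' x := by
  unfold trajValue
  rw [← integral_add (hc.integrable hP hπ x) (hc'.integrable hP hπ x)]
  simp [Episode.cost, Finset.sum_add_distrib]

lemma trajValue_const_mul (t : ℝ) (c : Fin n → S → A → ℝ) (x : S) :
    trajValue n P π (fun h x a => t * c h x a) x = t * trajValue n P π c x := by
  unfold trajValue
  rw [← integral_const_mul]
  simp [Episode.cost, Finset.mul_sum]

lemma measurable_trajValue {c : Fin n → S → A → ℝ} (hc : IsCost c)
    (hP : ∀ h, IsMarkovKernel (P h)) (hπ : IsPolicy π) : Measurable (trajValue n P π c) :=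
  ((measurable_cost hc.measurable).stronglyMeasurable.integral_kernel
    (κ := ⟨trajLaw n P π, measurable_trajLaw hP hπ⟩)).measurable

lemma abs_trajValue_le {c : Fin n → S → A → ℝ} {C : ℝ} (hC : ∀ h x a, |c h x a| ≤ C)
    (hP : ∀ h, IsMarkovKernel (P h)) (hπ : IsPolicy π) (x : S) :
    |trajValue n P π c x| ≤ n * C :=
  have := isProbabilityMeasure_trajLaw hP hπ x
  abs_integral_le_of_bounded (Episode.abs_cost_le hC)

/-- The integral of a bounded function over a mixture of probability measures. -/
lemma integral_bind_of_bounded {Ω Ω' : Type*} [MeasurableSpace Ω] [MeasurableSpace Ω']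
    {ρ : Measure Ω} [IsProbabilityMeasure ρ] {f : Ω → Measure Ω'} (hf : Measurable f)
    (hp : ∀ ω, IsProbabilityMeasure (f ω)) {F : Ω' → ℝ} (hF : Measurable F) {C : ℝ}
    (hC : ∀ ω, |F ω| ≤ C) :
    Integrable F (ρ.bind f) ∧ ∫ y, F y ∂(ρ.bind f) = ∫ x, ∫ y, F y ∂(f x) ∂ρ := by
  let κ : Kernel Ω Ω' := ⟨f, hf⟩
  have hκ : IsMarkovKernel κ := ⟨hp⟩
  have hb : ρ.bind f = (κ ∘ₖ Kernel.const Unit ρ) () := by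
    rw [Kernel.comp_apply, Kernel.const_apply]; rfl
  have hint : Integrable F ((κ ∘ₖ Kernel.const Unit ρ) ()) :=
    integrable_of_measurable_of_bounded hF hC
  rw [hb]
  refine ⟨hint, ?_⟩
  rw [Kernel.integral_comp hint, Kernel.const_apply]
  rfl

/-- The Bellman equation of a fixed policy. The comparisons of values with sub- and supersolutions
below rest on it. -/
lemma trajValue_succ {P : Fin (n + 1) → Kernel (S × A) S} {π : PolicyFun S A (n + 1)}
    {c : Fin (n + 1) → S → A → ℝ} (hc : IsCost c)
    (hP : ∀ h, IsMarkovKernel (P h)) (hπ : IsPolicy π) (x : S) :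
    trajValue (n + 1) P π c x = ∑ a, π 0 x a * (c 0 x a +
      ∫ x', trajValue n (fun h => P h.succ) (fun h => π h.succ) (fun h => c h.succ) x'
        ∂(P 0 (x, a))) := by
  have hP' : ∀ h : Fin n, IsMarkovKernel (P h.succ) := fun h => hP h.succ
  have hcons := fun a : A => measurable_episode_cons_right (n := n) x a
  obtain ⟨C, hC⟩ := hc.bounded
  have hm := measurable_cost hc.measurable
  have := fun a => (hP 0).isProbabilityMeasure (x, a)
  have hprob := isProbabilityMeasure_trajLaw hP' hπ.succ
  have hval := measurable_trajValue hc.succ hP' hπ.succ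
  have hvalb := abs_trajValue_le (fun h => hC h.succ) hP' hπ.succ
  have hci := hc.succ.integrable hP' hπ.succ
  have hmeas := measurable_trajLaw hP' hπ.succ
  unfold trajValue at hval hvalb ⊢
  rw [trajLaw_succ]
  generalize (trajLaw n (fun h => P h.succ) fun h => π h.succ) = L at *
  have key := fun a => integral_bind_of_bounded (ρ := P 0 (x, a))
    (f := fun x' => (L x').map (Episode.cons x a)) ((Measure.measurable_map _ (hcons a)).comp hmeas)
    (fun x' => Measure.isProbabilityMeasure_map (hcons a).aemeasurable) hm
    (Episode.abs_cost_le hC)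
  rw [integral_finsetSum_measure fun a _ => (key a).1.smul_measure ENNReal.ofReal_ne_top]
  refine Finset.sum_congr rfl fun a _ => ?_
  rw [integral_smul_measure, (key a).2, ENNReal.toReal_ofReal (hπ.nonneg 0 x a), smul_eq_mul]
  congr 1
  have h1 : ∀ x', ∫ e, e.cost c ∂((L x').map (Episode.cons x a)) = c 0 x a +
      ∫ e, e.cost (fun h => c h.succ) ∂(L x') := by
    intro x'
    rw [integral_map (hcons a).aemeasurable hm.aestronglyMeasurable]
    simp_rw [Episode.cost_cons]
    rw [integral_add (integrable_const _) (hci x')]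
    simp
  simp_rw [h1]
  rw [integral_add (integrable_const _) (integrable_of_measurable_of_bounded hval hvalb)]
  simp

lemma sum_policy_mul_mono {n : ℕ} {π : PolicyFun S A n} (hπ : IsPolicy π) (h : Fin n) (x : S)
    {f g : A → ℝ} (hfg : ∀ a, f a ≤ g a) : ∑ a, π h x a * f a ≤ ∑ a, π h x a * g a :=
  Finset.sum_le_sum fun a _ => mul_le_mul_of_nonneg_left (hfg a) (hπ.nonneg h x a)

/-- A subsolution of the Bellman equation is a lower bound for the value function. -/
theorem le_trajValue_of_subsolution (n : ℕ) :
    ∀ (P : Fin n → Kernel (S × A) S) (_ : ∀ h, IsMarkovKernel (P h)) (π : PolicyFun S A n)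
      (_ : IsPolicy π) (c : Fin n → S → A → ℝ) (_ : IsCost c) (v : Fin (n + 1) → S → ℝ)
      (_ : ∀ h, Measurable (v h)) (_ : ∃ C, ∀ h x, |v h x| ≤ C)
      (_ : ∀ x, v (Fin.last n) x ≤ 0)
      (_ : ∀ h x, v h.castSucc x ≤
        ∑ a, π h x a * (c h x a + ∫ x', v h.succ x' ∂(P h (x, a)))) (x : S),
      v 0 x ≤ trajValue n P π c x := by
  induction n with
  | zero =>
    intro P _ π _ c _ v _ _ hlast _ x
    simpa [trajValue, Episode.cost] using hlast x
  | succ n ih =>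
    intro P hP π hπ c hc v hv hb hlast hsub x
    have hP' : ∀ h : Fin n, IsMarkovKernel (P h.succ) := fun h => hP h.succ
    have := hP 0
    obtain ⟨C, hC⟩ := hc.bounded
    obtain ⟨C', hC'⟩ := hb
    rw [trajValue_succ hc hP hπ]
    refine (hsub 0 x).trans (sum_policy_mul_mono hπ 0 x fun a => ?_)
    refine (add_le_add_iff_left _).mpr (integral_mono
      (integrable_of_measurable_of_bounded (hv _) (hC' _))
      (integrable_of_measurable_of_bounded (measurable_trajValue hc.succ hP' hπ.succ)
        (abs_trajValue_le (fun h => hC h.succ) hP' hπ.succ)) fun x' => ?_)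
    exact ih _ hP' _ hπ.succ _ hc.succ (fun h => v h.succ) (fun h => hv h.succ)
      ⟨C', fun h => hC' h.succ⟩ hlast (fun h x => hsub h.succ x) x'

/-- A supersolution of the Bellman equation is an upper bound for the value function. -/
theorem trajValue_le_of_supersolution (hP : ∀ h, IsMarkovKernel (P h)) (hπ : IsPolicy π)
    {c : Fin n → S → A → ℝ} (hc : IsCost c) {v : Fin (n + 1) → S → ℝ}
    (hv : ∀ h, Measurable (v h)) (hb : ∃ C, ∀ h x, |v h x| ≤ C)
    (hlast : ∀ x, 0 ≤ v (Fin.last n) x)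
    (hsup : ∀ h x, ∑ a, π h x a * (c h x a + ∫ x', v h.succ x' ∂(P h (x, a)))
      ≤ v h.castSucc x) (x : S) :
    trajValue n P π c x ≤ v 0 x := by
  have h := le_trajValue_of_subsolution n P hP π hπ _ (hc.const_mul (-1)) (fun h x => -v h x)
    (fun h => (hv h).neg) (by simpa using hb) (by simpa using hlast) (fun h x => by
      have := hsup h x
      simp only [integral_neg, mul_add, Finset.sum_add_distrib, mul_neg, neg_mul, one_mul,
        Finset.sum_neg_distrib] at this ⊢
      linarith) x
  rw [trajValue_const_mul] at h
  linarith

lemma trajValue_mem_Icc {c : Fin n → S → A → ℝ} (hc : ∀ h x a, c h x a ∈ Set.Icc (0 : ℝ) 1)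
    (hP : ∀ h, IsMarkovKernel (P h)) (hπ : IsPolicy π) (x : S) :
    trajValue n P π c x ∈ Set.Icc (0 : ℝ) n := by
  constructor
  · exact integral_nonneg fun e => Finset.sum_nonneg fun h _ => (hc h _ _).1
  · have := abs_trajValue_le (c := c) (C := 1) (fun h x a => by
      rw [abs_of_nonneg (hc h x a).1]; exact (hc h x a).2) hP hπ x
    linarith [le_abs_self (trajValue n P π c x)]

end Value

/-! ### Convexity of the set of achievable values -/

section Convexity

variable {S A : Type*} [MeasurableSpace S] [MeasurableSpace A] [Fintype A]
  [DiscreteMeasurableSpace A]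

/-- The expected cumulative cost for costs with values in `[0, ∞]`. -/
noncomputable def trajLValue (n : ℕ) (P : Fin n → Kernel (S × A) S) (π : PolicyFun S A n)
    (F : Fin n → S → A → ENNReal) (x : S) : ENNReal :=
  ∫⁻ e, ∑ h, F h (e.1 h.castSucc) (e.2 h) ∂(trajLaw n P π x)

variable {n : ℕ}

lemma measurable_lcost {F : Fin n → S → A → ENNReal}
    (hF : ∀ h a, Measurable fun x => F h x a) :
    Measurable fun e : Episode S A n => ∑ h, F h (e.1 h.castSucc) (e.2 h) :=
  Finset.measurable_sum _ fun h _ => measurable_visited (hF h) h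

lemma measurable_trajLValue {P : Fin n → Kernel (S × A) S} {π : PolicyFun S A n}
    {F : Fin n → S → A → ENNReal} (hF : ∀ h a, Measurable fun x => F h x a)
    (hP : ∀ h, IsMarkovKernel (P h)) (hπ : IsPolicy π) : Measurable (trajLValue n P π F) :=
  (measurable_lcost hF).lintegral_kernel (κ := ⟨trajLaw n P π, measurable_trajLaw hP hπ⟩)

/-- The Bellman equation with values in [0, ∞], where policies can be merged without carrying
integrability conditions along. -/
lemma trajLValue_succ {P : Fin (n + 1) → Kernel (S × A) S} {π : PolicyFun S A (n + 1)}
    {F : Fin (n + 1) → S → A → ENNReal} (hF : ∀ h a, Measurable fun x => F h x a)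
    (hP : ∀ h, IsMarkovKernel (P h)) (hπ : IsPolicy π) (x : S) :
    trajLValue (n + 1) P π F x = ∑ a, ENNReal.ofReal (π 0 x a) * (F 0 x a +
      ∫⁻ x', trajLValue n (fun h => P h.succ) (fun h => π h.succ) (fun h => F h.succ) x'
        ∂(P 0 (x, a))) := by
  unfold trajLValue
  rw [lintegral_trajLaw_succ hP hπ (measurable_lcost hF)]
  refine Finset.sum_congr rfl fun a _ => ?_
  congr 1
  have := (hP 0).isProbabilityMeasure (x, a)
  have hprob := isProbabilityMeasure_trajLaw (fun h => hP h.succ) hπ.succ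
  have h1 : ∀ x', ∫⁻ e, ∑ h : Fin (n + 1), F h ((Episode.cons x a e).1 h.castSucc)
      ((Episode.cons x a e).2 h) ∂(trajLaw n (fun h => P h.succ) (fun h => π h.succ) x')
      = F 0 x a + ∫⁻ e, ∑ h : Fin n, F h.succ (e.1 h.castSucc) (e.2 h)
        ∂(trajLaw n (fun h => P h.succ) (fun h => π h.succ) x') := by
    intro x'
    have := hprob x'
    simp only [Episode.cons, Fin.sum_univ_succ, Fin.castSucc_zero, Fin.cons_zero, Fin.cons_succ,
      Fin.castSucc_succ]
    rw [lintegral_add_left measurable_const]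
    simp
  simp_rw [h1]
  rw [lintegral_add_left measurable_const]
  simp

/-- The law of the next state. -/
noncomputable def nextLaw (ρ : Measure S) (P : Kernel (S × A) S) (q : S → A → ℝ) : Measure S :=
  ∑ a, (ρ.withDensity fun x => ENNReal.ofReal (q x a)).bind fun x => P (x, a)

lemma lintegral_nextLaw (ρ : Measure S) (P : Kernel (S × A) S) {q : S → A → ℝ}
    (hq : ∀ a, Measurable fun x => q x a) {g : S → ENNReal} (hg : Measurable g) :
    ∫⁻ x, g x ∂(nextLaw ρ P q)
      = ∫⁻ x, ∑ a, ENNReal.ofReal (q x a) * ∫⁻ x', g x' ∂(P (x, a)) ∂ρ := by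
  have hm : ∀ a, Measurable fun x => ∫⁻ x', g x' ∂(P (x, a)) := fun a =>
    hg.lintegral_kernel.comp (measurable_id.prodMk measurable_const)
  unfold nextLaw
  have hqm : ∀ a, Measurable fun x => ENNReal.ofReal (q x a) * ∫⁻ x', g x' ∂(P (x, a)) :=
    fun a => (hq a).ennreal_ofReal.mul (hm a)
  rw [lintegral_finsetSum_measure, lintegral_finsetSum _ fun a _ => hqm a]
  refine Finset.sum_congr rfl fun a _ => ?_
  have hk : Measurable fun x => P (x, a) :=
    P.measurable.comp (measurable_id.prodMk measurable_const)
  rw [Measure.lintegral_bind hk.aemeasurable hg.aemeasurable,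
    lintegral_withDensity_eq_lintegral_mul _ (hq a).ennreal_ofReal (hm a)]
  rfl

lemma isFiniteMeasure_nextLaw (ρ : Measure S) [IsFiniteMeasure ρ] (P : Kernel (S × A) S)
    [IsMarkovKernel P] {n : ℕ} {π : PolicyFun S A n} (hπ : IsPolicy π) (h : Fin n) :
    IsFiniteMeasure (nextLaw ρ P (π h)) := by
  refine ⟨?_⟩
  have := lintegral_nextLaw ρ P (hπ.measurable h) (measurable_const (a := (1 : ENNReal)))
  simp only [lintegral_const, measure_univ, mul_one, one_mul, hπ.sum_ofReal] at this
  rw [this]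
  exact measure_lt_top ρ _

/-- Take w to be the density of ρ₁ with respect to ρ₁ + ρ₂. It is at most 1 almost everywhere;
capping it at 1 makes the bound hold everywhere. That 1 - w is the density of ρ₂ follows by
cancelling the finite measure ρ₁. -/
lemma exists_density_split (ρ₁ ρ₂ : Measure S) [IsFiniteMeasure ρ₁] [IsFiniteMeasure ρ₂] :
    ∃ w : S → ℝ, Measurable w ∧ (∀ x, 0 ≤ w x) ∧ (∀ x, w x ≤ 1) ∧
      (∀ g : S → ENNReal, Measurable g →
        ∫⁻ x, ENNReal.ofReal (w x) * g x ∂(ρ₁ + ρ₂) = ∫⁻ x, g x ∂ρ₁) ∧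
      ∀ g : S → ENNReal, Measurable g →
        ∫⁻ x, ENNReal.ofReal (1 - w x) * g x ∂(ρ₁ + ρ₂) = ∫⁻ x, g x ∂ρ₂ := by
  set ρ := ρ₁ + ρ₂ with hρ
  have hle : ρ₁ ≤ ρ := Measure.le_add_right le_rfl
  have hw1 : ρ₁.rnDeriv ρ ≤ᵐ[ρ] 1 := Measure.rnDeriv_le_one_of_le hle
  refine ⟨fun x => min 1 (ρ₁.rnDeriv ρ x).toReal,
    measurable_const.min (Measure.measurable_rnDeriv _ _).ennreal_toReal,
    fun x => le_min zero_le_one ENNReal.toReal_nonneg, fun x => min_le_left _ _, ?_⟩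
  set w : S → ℝ := fun x => min 1 (ρ₁.rnDeriv ρ x).toReal with hw
  have hwm : Measurable w := measurable_const.min (Measure.measurable_rnDeriv _ _).ennreal_toReal
  have hwd : ρ.withDensity (fun x => ENNReal.ofReal (w x)) = ρ₁ := by
    conv_rhs => rw [← Measure.withDensity_rnDeriv_eq _ _ (Measure.absolutelyContinuous_of_le hle)]
    refine withDensity_congr_ae ?_
    filter_upwards [hw1] with x hx
    have hx : ρ₁.rnDeriv ρ x ≤ 1 := hx
    have hx' : (ρ₁.rnDeriv ρ x).toReal ≤ 1 := by
      simpa using ENNReal.toReal_mono ENNReal.one_ne_top hx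
    rw [hw]
    simp only [min_eq_right hx']
    exact ENNReal.ofReal_toReal (hx.trans_lt ENNReal.one_lt_top).ne
  have h1 : ∀ g : S → ENNReal, Measurable g →
      ∫⁻ x, ENNReal.ofReal (w x) * g x ∂ρ = ∫⁻ x, g x ∂ρ₁ := by
    intro g hg
    conv_rhs => rw [← hwd, lintegral_withDensity_eq_lintegral_mul _ hwm.ennreal_ofReal hg]
    rfl
  have hwd2 : ρ.withDensity (fun x => ENNReal.ofReal (1 - w x)) = ρ₂ := by
    have hsum : ρ₁ + ρ.withDensity (fun x => ENNReal.ofReal (1 - w x)) = ρ₁ + ρ₂ := by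
      conv_lhs => rw [← hwd]
      rw [← withDensity_add_left hwm.ennreal_ofReal, ← hρ]
      have : ((fun x => ENNReal.ofReal (w x)) + fun x => ENNReal.ofReal (1 - w x)) = 1 := by
        funext x
        rw [Pi.add_apply, ← ENNReal.ofReal_add (le_min zero_le_one ENNReal.toReal_nonneg)
          (sub_nonneg.mpr (min_le_left _ _))]
        simp
      rw [this, withDensity_one]
    ext B hB
    have := congrArg (fun m : Measure S => m B) hsum
    simp only [Measure.add_apply] at this
    exact (ENNReal.add_right_inj (measure_ne_top ρ₁ B)).mp this
  refine ⟨h1, fun g hg => ?_⟩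
  have hwm' : Measurable fun x => ENNReal.ofReal (1 - w x) :=
    (measurable_const.sub hwm).ennreal_ofReal
  conv_rhs => rw [← hwd2, lintegral_withDensity_eq_lintegral_mul _ hwm' hg]
  rfl

/-- Two policies started from two initial distributions can be merged into a single Markov policy
started from the sum of the distributions. -/
theorem exists_merged_policy (n : ℕ) :
    ∀ (P : Fin n → Kernel (S × A) S) (_ : ∀ h, IsMarkovKernel (P h)) (π₁ π₂ : PolicyFun S A n)
      (_ : IsPolicy π₁) (_ : IsPolicy π₂) (ρ₁ ρ₂ : Measure S) (_ : IsFiniteMeasure ρ₁)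
      (_ : IsFiniteMeasure ρ₂), ∃ π : PolicyFun S A n, IsPolicy π ∧
      ∀ F : Fin n → S → A → ENNReal, (∀ h a, Measurable fun x => F h x a) →
        ∫⁻ x, trajLValue n P π F x ∂(ρ₁ + ρ₂)
          = ∫⁻ x, trajLValue n P π₁ F x ∂ρ₁ + ∫⁻ x, trajLValue n P π₂ F x ∂ρ₂ := by
  induction n with
  | zero =>
    intro P _ π₁ _ h₁ _ ρ₁ ρ₂ _ _
    exact ⟨π₁, h₁, fun F _ => by simp [trajLValue]⟩
  | succ n ih =>
    intro P hP π₁ π₂ h₁ h₂ ρ₁ ρ₂ hρ₁ hρ₂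
    have hP' : ∀ h : Fin n, IsMarkovKernel (P h.succ) := fun h => hP h.succ
    have := hP 0
    -- The later steps merge the two tails started from the laws of the second state under each
    -- policy; the first step of the merged policy turns ρ₁ + ρ₂ into the sum of these laws.
    obtain ⟨π', hπ', hF'⟩ := ih (fun h => P h.succ) hP' _ _ h₁.succ h₂.succ
      (nextLaw ρ₁ (P 0) (π₁ 0)) (nextLaw ρ₂ (P 0) (π₂ 0)) (isFiniteMeasure_nextLaw _ _ h₁ 0)
      (isFiniteMeasure_nextLaw _ _ h₂ 0)
    obtain ⟨w, hwm, hw0, hw1, hwg1, hwg2⟩ := exists_density_split ρ₁ ρ₂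
    -- Conditional law of the action given the state: `w x` is the posterior weight of the first
    -- policy at `x`.
    let q : S → A → ℝ := fun x a => w x * π₁ 0 x a + (1 - w x) * π₂ 0 x a
    let π : PolicyFun S A (n + 1) := Fin.cons q π'
    have hπ : IsPolicy π := by
      refine ⟨fun h a => ?_, fun h x a => ?_, fun h x => ?_⟩ <;>
        refine Fin.cases ?_ (fun j => ?_) h
      · exact (hwm.mul (h₁.measurable 0 a)).add
          ((measurable_const.sub hwm).mul (h₂.measurable 0 a))
      · exact hπ'.measurable j a
      · exact add_nonneg (mul_nonneg (hw0 x) (h₁.nonneg 0 x a))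
          (mul_nonneg (sub_nonneg.mpr (hw1 x)) (h₂.nonneg 0 x a))
      · exact hπ'.nonneg j x a
      · change ∑ a, (w x * π₁ 0 x a + (1 - w x) * π₂ 0 x a) = 1
        rw [Finset.sum_add_distrib, ← Finset.mul_sum, ← Finset.mul_sum, h₁.sum_eq_one,
          h₂.sum_eq_one]
        ring
      · exact hπ'.sum_eq_one j x
    refine ⟨π, hπ, fun F hF => ?_⟩
    have hmix : ∀ G : S → A → ENNReal, (∀ a, Measurable fun x => G x a) →
        ∫⁻ x, ∑ a, ENNReal.ofReal (q x a) * G x a ∂(ρ₁ + ρ₂)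
          = ∫⁻ x, ∑ a, ENNReal.ofReal (π₁ 0 x a) * G x a ∂ρ₁
            + ∫⁻ x, ∑ a, ENNReal.ofReal (π₂ 0 x a) * G x a ∂ρ₂ := by
      intro G hG
      have hm : ∀ {π : PolicyFun S A (n + 1)}, IsPolicy π →
          Measurable fun x => ∑ a, ENNReal.ofReal (π 0 x a) * G x a := fun hπ =>
        Finset.measurable_sum _ fun a _ => (hπ.measurable 0 a).ennreal_ofReal.mul (hG a)
      have hm' : Measurable fun x =>
          ENNReal.ofReal (w x) * ∑ a, ENNReal.ofReal (π₁ 0 x a) * G x a :=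
        hwm.ennreal_ofReal.mul (hm h₁)
      rw [← hwg1 _ (hm h₁), ← hwg2 _ (hm h₂), ← lintegral_add_left hm']
      refine lintegral_congr fun x => ?_
      rw [Finset.mul_sum, Finset.mul_sum, ← Finset.sum_add_distrib]
      refine Finset.sum_congr rfl fun a _ => ?_
      have h1w := sub_nonneg.mpr (hw1 x)
      rw [ENNReal.ofReal_add (mul_nonneg (hw0 x) (h₁.nonneg 0 x a))
        (mul_nonneg h1w (h₂.nonneg 0 x a)), ENNReal.ofReal_mul (hw0 x), ENNReal.ofReal_mul h1w]
      ring
    have hsplit : ∀ (ρ : Measure S) {π : PolicyFun S A (n + 1)}, IsPolicy π → ∀ {g : S → ENNReal},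
        Measurable g →
        ∫⁻ x, ∑ a, ENNReal.ofReal (π 0 x a) * (F 0 x a + ∫⁻ x', g x' ∂(P 0 (x, a))) ∂ρ
          = ∫⁻ x, ∑ a, ENNReal.ofReal (π 0 x a) * F 0 x a ∂ρ
            + ∫⁻ x, g x ∂(nextLaw ρ (P 0) (π 0)) := by
      intro ρ π hπ g hg
      have hm : Measurable fun x => ∑ a, ENNReal.ofReal (π 0 x a) * F 0 x a :=
        Finset.measurable_sum _ fun a _ => (hπ.measurable 0 a).ennreal_ofReal.mul (hF 0 a)
      rw [lintegral_nextLaw _ _ (hπ.measurable 0) hg, ← lintegral_add_left hm]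
      simp_rw [mul_add, Finset.sum_add_distrib]
    have hFs : ∀ (h : Fin n) a, Measurable fun x => F h.succ x a := fun h => hF h.succ
    have hg := measurable_trajLValue hFs hP' hπ'
    have hg₁ := measurable_trajLValue hFs hP' h₁.succ
    have hg₂ := measurable_trajLValue hFs hP' h₂.succ
    have e0 : ∀ x, trajLValue (n + 1) P π F x = ∑ a, ENNReal.ofReal (q x a) * (F 0 x a +
        ∫⁻ x', trajLValue n (fun h => P h.succ) π' (fun h => F h.succ) x' ∂(P 0 (x, a))) :=
      fun x => trajLValue_succ hF hP hπ x
    simp_rw [e0, trajLValue_succ hF hP h₁, trajLValue_succ hF hP h₂]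
    have hG : ∀ a, Measurable fun x => F 0 x a + ∫⁻ x', trajLValue n (fun h => P h.succ) π'
        (fun h => F h.succ) x' ∂(P 0 (x, a)) := fun a => (hF 0 a).add
      (hg.lintegral_kernel.comp (measurable_id.prodMk measurable_const))
    rw [hmix _ hG, hsplit ρ₁ h₁ hg, hsplit ρ₂ h₂ hg, hsplit ρ₁ h₁ hg₁, hsplit ρ₂ h₂ hg₂]
    have := hF' (fun h => F h.succ) hFs
    rw [lintegral_add_measure] at this
    rw [add_add_add_comm, this, add_add_add_comm]

lemma ofReal_trajValue {P : Fin n → Kernel (S × A) S} {π : PolicyFun S A n}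
    {c : Fin n → S → A → ℝ} (hc : IsCost c) (h0 : ∀ h x a, 0 ≤ c h x a)
    (hP : ∀ h, IsMarkovKernel (P h)) (hπ : IsPolicy π) (x : S) :
    ENNReal.ofReal (trajValue n P π c x)
      = trajLValue n P π (fun h x a => ENNReal.ofReal (c h x a)) x := by
  unfold trajValue trajLValue
  rw [ofReal_integral_eq_lintegral_ofReal (hc.integrable hP hπ x)
    (Filter.Eventually.of_forall fun e => Finset.sum_nonneg fun h _ => h0 h _ _)]
  refine lintegral_congr fun e => ?_
  exact ENNReal.ofReal_sum_of_nonneg fun h _ => h0 h _ _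

/-- A convex combination of two policies, in terms of their expected costs. -/
theorem exists_policy_convexCombination {P : Fin n → Kernel (S × A) S}
    (hP : ∀ h, IsMarkovKernel (P h)) {π₁ π₂ : PolicyFun S A n} (h₁ : IsPolicy π₁)
    (h₂ : IsPolicy π₂) (x : S) {s t : ℝ} (hs : 0 ≤ s) (ht : 0 ≤ t) :
    ∃ π : PolicyFun S A n, IsPolicy π ∧ ∀ c : Fin n → S → A → ℝ, IsCost c →
      (∀ h x a, 0 ≤ c h x a) → (s + t) * trajValue n P π c x
        = s * trajValue n P π₁ c x + t * trajValue n P π₂ c x := by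
  -- The weights s and t are encoded as the masses of two point measures at the same initial state.
  obtain ⟨π, hπ, hF⟩ := exists_merged_policy n P hP π₁ π₂ h₁ h₂
    (ENNReal.ofReal s • Measure.dirac x) (ENNReal.ofReal t • Measure.dirac x)
    (Measure.smul_finite _ ENNReal.ofReal_ne_top) (Measure.smul_finite _ ENNReal.ofReal_ne_top)
  refine ⟨π, hπ, fun c hc h0 => ?_⟩
  have hm : ∀ h a, Measurable fun x => ENNReal.ofReal (c h x a) := fun h a =>
    (hc.measurable h a).ennreal_ofReal
  have key := hF (fun h x a => ENNReal.ofReal (c h x a)) hm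
  have hn : ∀ {π' : PolicyFun S A n}, 0 ≤ trajValue n P π' c x := fun {π'} =>
    integral_nonneg fun e => Finset.sum_nonneg fun h _ => h0 h _ _
  rw [lintegral_add_measure, lintegral_smul_measure, lintegral_smul_measure,
    lintegral_smul_measure, lintegral_smul_measure,
    lintegral_dirac' _ (measurable_trajLValue hm hP hπ),
    lintegral_dirac' _ (measurable_trajLValue hm hP h₁),
    lintegral_dirac' _ (measurable_trajLValue hm hP h₂), ← ofReal_trajValue hc h0 hP hπ,
    ← ofReal_trajValue hc h0 hP h₁, ← ofReal_trajValue hc h0 hP h₂, smul_eq_mul, smul_eq_mul,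
    smul_eq_mul, smul_eq_mul, ← ENNReal.ofReal_mul hs, ← ENNReal.ofReal_mul ht,
    ← ENNReal.ofReal_mul hs, ← ENNReal.ofReal_mul ht,
    ← ENNReal.ofReal_add (mul_nonneg hs hn) (mul_nonneg ht hn),
    ← ENNReal.ofReal_add (mul_nonneg hs hn) (mul_nonneg ht hn),
    ENNReal.ofReal_eq_ofReal_iff (add_nonneg (mul_nonneg hs hn) (mul_nonneg ht hn))
      (add_nonneg (mul_nonneg hs hn) (mul_nonneg ht hn))] at key
  linarith

end Convexity

/-! ### Slater's condition and the set of achievable values -/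

section Duality

variable {S A : Type*} [MeasurableSpace S] [MeasurableSpace A] [Fintype A]
  [DiscreteMeasurableSpace A] {H : ℕ}

lemma isCost_of_mem_Icc {c : Fin H → S → A → ℝ} (hm : ∀ h a, Measurable fun x => c h x a)
    (hc : ∀ h x a, c h x a ∈ Set.Icc (0 : ℝ) 1) : IsCost c :=
  ⟨hm, 1, fun h x a => abs_le.mpr ⟨by linarith [(hc h x a).1], (hc h x a).2⟩⟩

lemma CMDP.isCost_r (M : CMDP S A H) : IsCost M.r := isCost_of_mem_Icc M.measurable_r M.r_mem

lemma CMDP.isCost_g (M : CMDP S A H) : IsCost M.g := isCost_of_mem_Icc M.measurable_g M.g_mem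

lemma CMDP.value_r_mem (M : CMDP S A H) {π : PolicyFun S A H} (hπ : IsPolicy π) :
    M.value M.r π ∈ Set.Icc (0 : ℝ) H := trajValue_mem_Icc M.r_mem M.markov hπ _

lemma CMDP.value_g_mem (M : CMDP S A H) {π : PolicyFun S A H} (hπ : IsPolicy π) :
    M.value M.g π ∈ Set.Icc (0 : ℝ) H := trajValue_mem_Icc M.g_mem M.markov hπ _

/-- The set of achievable pairs of values. -/
def CMDP.valueSet (M : CMDP S A H) : Set (ℝ × ℝ) :=
  {z | ∃ π : PolicyFun S A H, IsPolicy π ∧ (M.value M.r π, M.value M.g π) = z}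

lemma CMDP.convex_valueSet (M : CMDP S A H) : Convex ℝ M.valueSet := by
  rintro _ ⟨π₁, h₁, rfl⟩ _ ⟨π₂, h₂, rfl⟩ s t hs ht hst
  obtain ⟨π, hπ, hv⟩ := exists_policy_convexCombination M.markov h₁ h₂ M.x₁ hs ht
  have hr := hv M.r M.isCost_r fun h x a => (M.r_mem h x a).1
  have hg := hv M.g M.isCost_g fun h x a => (M.g_mem h x a).1
  rw [hst, one_mul] at hr hg
  exact ⟨π, hπ, Prod.ext hr hg⟩

/-- Under Slater's condition the optimal value is Lipschitz in the violation of the constraint. -/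
lemma CMDP.value_sub_le_of_mem_valueSet (M : CMDP S A H) {γ : ℝ} (hM : M.Slater γ)
    {πstar : PolicyFun S A H} (hstar : M.IsSolution πstar) {z : ℝ × ℝ} (hz : z ∈ M.valueSet) :
    z.1 - M.value M.r πstar ≤ H / γ * max (M.b - z.2) 0 := by
  obtain ⟨hγ, πbar, hbar, hbg⟩ := hM
  obtain ⟨hsp, hsb, hopt⟩ := hstar
  have hH := (M.value_r_mem hsp).2
  rcases le_or_gt M.b z.2 with hb | hb
  · obtain ⟨π, hπ, rfl⟩ := hz
    have := hopt π hπ hb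
    have h0 : 0 ≤ (H : ℝ) / γ * max (M.b - M.value M.g π) 0 := by positivity
    linarith
  · set G := M.value M.g πbar with hG
    have hD : 0 < G - z.2 := by linarith
    -- The weights are chosen so that mixing with the Slater policy gives utility exactly b; the
    -- mixture is feasible and cannot beat the optimum.
    have hmem := M.convex_valueSet ⟨πbar, hbar, rfl⟩ hz (a := (M.b - z.2) / (G - z.2))
      (b := (G - M.b) / (G - z.2)) (by apply div_nonneg <;> linarith)
      (by apply div_nonneg <;> linarith) (by field_simp; ring)
    obtain ⟨π, hπ, he⟩ := hmem
    have h1 := congrArg Prod.fst he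
    have h2 := congrArg Prod.snd he
    simp only [Prod.fst_add, Prod.snd_add, Prod.smul_fst, Prod.smul_snd, smul_eq_mul] at h1 h2
    have hgb : M.b ≤ M.value M.g π := by
      rw [h2, ← hG]
      apply le_of_eq
      field_simp
      ring
    have h3 := hopt π hπ hgb
    rw [h1] at h3
    have h4 := (M.value_r_mem hbar).1
    rw [max_eq_left (by linarith), div_mul_eq_mul_div, le_div_iff₀ hγ]
    have h5 : (M.b - z.2) * M.value M.r πbar + (G - M.b) * z.1
        ≤ (G - z.2) * M.value M.r πstar := by
      have := mul_le_mul_of_nonneg_left h3 hD.le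
      field_simp at this
      linarith
    -- Rearranged, `h5` gives (G - b)(z₁ - V⋆) ≤ (b - z₂)V⋆ ≤ (b - z₂)H. Replacing G - b by the
    -- smaller γ requires z₁ - V⋆ to be positive; otherwise the claim is trivial.
    rcases le_or_gt (z.1 - M.value M.r πstar) 0 with h6 | h6
    · have : 0 ≤ (H : ℝ) * (M.b - z.2) := mul_nonneg (Nat.cast_nonneg H) (by linarith)
      nlinarith
    · nlinarith

end Duality

/-! ### Measurability of the algorithm -/

section MatrixMeasurability

variable {Ω : Type*} [MeasurableSpace Ω] {n m : ℕ}

lemma measurable_matrix_det {M : Ω → Matrix (Fin m) (Fin m) ℝ}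
    (hM : ∀ i j, Measurable fun ω => M ω i j) : Measurable fun ω => (M ω).det := by
  simp_rw [Matrix.det_apply, Units.smul_def, zsmul_eq_mul]
  exact Finset.measurable_sum _ fun σ _ => (Finset.measurable_prod _ fun i _ => hM _ _).const_mul _

/-- The adjugate formula covers singular matrices too, since both sides are then zero by convention.
-/
lemma measurable_matrix_inv {M : Ω → Matrix (Fin m) (Fin m) ℝ}
    (hM : ∀ i j, Measurable fun ω => M ω i j) (i j : Fin m) :
    Measurable fun ω => (M ω)⁻¹ i j := by
  simp_rw [Matrix.inv_def, Matrix.smul_apply, Ring.inverse_eq_inv', Matrix.adjugate_apply,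
    smul_eq_mul]
  refine (measurable_matrix_det hM).inv.mul (measurable_matrix_det fun k l => ?_)
  by_cases hk : k = j
  · subst hk; simp
  · simpa [Matrix.updateRow_ne hk] using hM k l

lemma measurable_ofLp_apply {v : Ω → EuclideanSpace ℝ (Fin m)} (hv : Measurable v) (i : Fin m) :
    Measurable fun ω => v ω i :=
  (EuclideanSpace.proj (𝕜 := ℝ) i).continuous.measurable.comp hv

lemma measurable_gram_inv (lam : ℝ) {v : Fin n → Ω → EuclideanSpace ℝ (Fin m)}
    (hv : ∀ τ, Measurable (v τ)) (i j : Fin m) :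
    Measurable fun ω => (gram lam fun τ => v τ ω)⁻¹ i j := by
  refine measurable_matrix_inv (fun k l => ?_) i j
  unfold gram
  simp only [Matrix.add_apply, Matrix.sum_apply, Matrix.vecMulVec_apply]
  exact (Finset.measurable_sum _ fun τ _ => (measurable_ofLp_apply (hv τ) k).mul
    (measurable_ofLp_apply (hv τ) l)).add_const _

lemma measurable_ridge (lam : ℝ) {v : Fin n → Ω → EuclideanSpace ℝ (Fin m)}
    (hv : ∀ τ, Measurable (v τ)) {y : Fin n → Ω → ℝ} (hy : ∀ τ, Measurable (y τ)) (i : Fin m) :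
    Measurable fun ω => ridge lam (fun τ => v τ ω) (fun τ => y τ ω) i := by
  unfold ridge Matrix.mulVec dotProduct
  refine Finset.measurable_sum _ fun j _ => (measurable_gram_inv lam hv i j).mul ?_
  simp only [Finset.sum_apply, Pi.smul_apply, smul_eq_mul]
  exact Finset.measurable_sum _ fun τ _ => (hy τ).mul (measurable_ofLp_apply (hv τ) j)

lemma measurable_quad (lam : ℝ) {v : Fin n → Ω → EuclideanSpace ℝ (Fin m)}
    (hv : ∀ τ, Measurable (v τ)) {x y : Ω → Fin m → ℝ} (hx : ∀ i, Measurable fun ω => x ω i)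
    (hy : ∀ i, Measurable fun ω => y ω i) :
    Measurable fun ω => x ω ⬝ᵥ ((gram lam fun τ => v τ ω)⁻¹ *ᵥ y ω) := by
  unfold Matrix.mulVec dotProduct
  exact Finset.measurable_sum _ fun i _ => (hx i).mul
    (Finset.measurable_sum _ fun j _ => (measurable_gram_inv lam hv i j).mul (hy j))

lemma measurable_bonus (β lam : ℝ) {v : Fin n → Ω → EuclideanSpace ℝ (Fin m)}
    (hv : ∀ τ, Measurable (v τ)) {u : Ω → EuclideanSpace ℝ (Fin m)} (hu : Measurable u) :
    Measurable fun ω => bonus β lam (fun τ => v τ ω) (u ω) :=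
  ((measurable_quad lam hv (measurable_ofLp_apply hu) (measurable_ofLp_apply hu)).sqrt).const_mul β

end MatrixMeasurability

section Algorithm

variable {S A : Type*} [MeasurableSpace S] [MeasurableSpace A] [Fintype A]
  [DiscreteMeasurableSpace A] {H d₁ d₂ : ℕ} {Ω : Type*} [MeasurableSpace Ω]

/-- The reward function for `true`, the utility function for `false`. -/
def CMDP.fn (M : CMDP S A H) (i : Bool) : Fin H → S → A → ℝ := cond i M.r M.g

/-- The estimated action-value function of the reward or of the utility. -/
def Iterate.Q (I : Iterate S A H) (i : Bool) : Fin H → S → A → ℝ := cond i I.Qr I.Qg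

/-- The estimated value function of the reward or of the utility. -/
def Iterate.V (I : Iterate S A H) (i : Bool) : Fin (H + 1) → S → ℝ := cond i I.Vr I.Vg

lemma CMDP.measurable_fn (M : CMDP S A H) (i : Bool) (h : Fin H) (a : A) :
    Measurable fun x => M.fn i h x a := by
  cases i
  exacts [M.measurable_g h a, M.measurable_r h a]

lemma CMDP.fn_mem (M : CMDP S A H) (i : Bool) (h : Fin H) (x : S) (a : A) :
    M.fn i h x a ∈ Set.Icc (0 : ℝ) 1 := by
  cases i
  exacts [M.g_mem h x a, M.r_mem h x a]

lemma CMDP.isCost_fn (M : CMDP S A H) (i : Bool) : IsCost (M.fn i) :=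
  isCost_of_mem_Icc (M.measurable_fn i) (M.fn_mem i)

/-- A family of iterates that depends measurably on a parameter. -/
structure MeasurableIterate (I : Ω → Iterate S A H) : Prop where
  pol : ∀ h a, Measurable fun z : Ω × S => (I z.1).pol h z.2 a
  Y : Measurable fun ω => (I ω).Y
  Q : ∀ i h a, Measurable fun z : Ω × S => (I z.1).Q i h z.2 a
  V : ∀ i h, Measurable fun z : Ω × S => (I z.1).V i h z.2

lemma measurable_kernelFeature (μ : Measure S) [SFinite μ]
    {ψ : S → A → S → EuclideanSpace ℝ (Fin d₁)}
    (hψ : ∀ a, Measurable fun z : S × S => ψ z.1 a z.2) {V : Ω → S → ℝ}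
    (hV : Measurable fun z : Ω × S => V z.1 z.2) {X : Ω → S} (hX : Measurable X) {B : Ω → A}
    (hB : Measurable B) : Measurable fun ω => kernelFeature μ ψ (V ω) (X ω) (B ω) := by
  have h : ∀ a, Measurable fun z : Ω × S => kernelFeature μ ψ (V z.1) z.2 a := fun a => by
    have hm : Measurable fun q : (Ω × S) × S => V q.1.1 q.2 • ψ q.1.2 a q.2 :=
      (hV.comp ((measurable_fst.comp measurable_fst).prodMk measurable_snd)).smul
        ((hψ a).comp ((measurable_snd.comp measurable_fst).prodMk measurable_snd))
    exact (hm.stronglyMeasurable.integral_prod_right' (ν := μ)).measurable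
  exact (measurable_uncurry_of_forall (f := fun (z : Ω × S) a =>
    kernelFeature μ ψ (V z.1) z.2 a) h).comp ((measurable_id.prodMk hX).prodMk hB)

lemma measurable_state {n : ℕ} (τ : Fin n) (h : Fin (H + 1)) :
    Measurable fun D : Fin n → Episode S A H => (D τ).1 h :=
  (measurable_pi_apply h).comp (measurable_fst.comp (measurable_pi_apply τ))

lemma measurable_action {n : ℕ} (τ : Fin n) (h : Fin H) :
    Measurable fun D : Fin n → Episode S A H => (D τ).2 h :=
  (measurable_pi_apply h).comp (measurable_snd.comp (measurable_pi_apply τ))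

section

variable {μ : Measure S} [SFinite μ] {ψ : S → A → S → EuclideanSpace ℝ (Fin d₁)}
  {φ : S → A → EuclideanSpace ℝ (Fin d₂)}

lemma measurable_qEstimate (hψ : ∀ a, Measurable fun z : S × S => ψ z.1 a z.2)
    (hφ : ∀ a, Measurable fun x => φ x a) (par : Params) {f : Fin H → S → A → ℝ}
    (hf : ∀ h a, Measurable fun x => f h x a) {n : ℕ} {D : Ω → Fin n → Episode S A H}
    (hD : Measurable D) {V : Ω → Fin n → Fin (H + 1) → S → ℝ}
    (hV : ∀ τ h, Measurable fun z : Ω × S => V z.1 τ h z.2) (h : Fin H) {Vnext : Ω → S → ℝ}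
    (hVn : Measurable fun z : Ω × S => Vnext z.1 z.2) (a : A) :
    Measurable fun z : Ω × S => qEstimate μ ψ φ par f (D z.1) (V z.1) h (Vnext z.1) z.2 a := by
  have hD' : Measurable fun z : Ω × S => D z.1 := hD.comp measurable_fst
  have hxs : ∀ τ, Measurable fun z : Ω × S => (D z.1 τ).1 h.castSucc := fun τ =>
    (measurable_state τ _).comp hD'
  have hxs' : ∀ τ, Measurable fun z : Ω × S => (D z.1 τ).1 h.succ := fun τ =>
    (measurable_state τ _).comp hD'
  have has : ∀ τ, Measurable fun z : Ω × S => (D z.1 τ).2 h := fun τ =>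
    (measurable_action τ _).comp hD'
  have hkf : ∀ τ, Measurable fun z : Ω × S =>
      kernelFeature μ ψ (V z.1 τ h.succ) ((D z.1 τ).1 h.castSucc) ((D z.1 τ).2 h) := fun τ =>
    measurable_kernelFeature μ hψ
      (V := fun (z : Ω × S) => V z.1 τ h.succ)
      ((hV τ h.succ).comp ((measurable_fst.comp measurable_fst).prodMk measurable_snd))
      (hxs τ) (has τ)
  have hvf : ∀ τ, Measurable fun z : Ω × S => φ ((D z.1 τ).1 h.castSucc) ((D z.1 τ).2 h) :=
    fun τ => (measurable_uncurry_of_forall hφ).comp ((hxs τ).prodMk (has τ))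
  have hk : Measurable fun z : Ω × S => kernelFeature μ ψ (Vnext z.1) z.2 a :=
    measurable_kernelFeature μ hψ (V := fun (z : Ω × S) => Vnext z.1)
      (hVn.comp ((measurable_fst.comp measurable_fst).prodMk measurable_snd))
      measurable_snd measurable_const
  have hφa : Measurable fun z : Ω × S => φ z.2 a := (hφ a).comp measurable_snd
  have hw := measurable_ridge par.lam hkf (y := fun τ (z : Ω × S) =>
    V z.1 τ h.succ ((D z.1 τ).1 h.succ)) fun τ => (hV τ h.succ).comp (measurable_fst.prodMk (hxs' τ))
  have hu := measurable_ridge par.lam hvf (y := fun τ (z : Ω × S) =>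
    f h ((D z.1 τ).1 h.castSucc) ((D z.1 τ).2 h)) fun τ =>
      (measurable_uncurry_of_forall (hf h)).comp ((hxs τ).prodMk (has τ))
  unfold qEstimate
  refine Measurable.max (Measurable.min (Measurable.add (Measurable.add ?_ ?_) (Measurable.add
    (measurable_bonus _ _ hvf hφa) (measurable_bonus _ _ hkf hk))) measurable_const)
    measurable_const
  · exact Finset.measurable_sum _ fun i _ => (measurable_ofLp_apply hφa i).mul (hu i)
  · exact Finset.measurable_sum _ fun i _ => (measurable_ofLp_apply hk i).mul (hw i)

lemma vEval_last (par : Params) (f : Fin H → S → A → ℝ) {n : ℕ} (D : Fin n → Episode S A H)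
    (V : Fin n → Fin (H + 1) → S → ℝ) (π : PolicyFun S A H) :
    vEval μ ψ φ par f D V π (Fin.last H) = fun _ => 0 := by
  simp [vEval]

lemma vEval_castSucc (par : Params) (f : Fin H → S → A → ℝ) {n : ℕ} (D : Fin n → Episode S A H)
    (V : Fin n → Fin (H + 1) → S → ℝ) (π : PolicyFun S A H) (h : Fin H) (x : S) :
    vEval μ ψ φ par f D V π h.castSucc x
      = ∑ a, qEval μ ψ φ par f D V π h x a * π h x a := by
  simp [vEval, qEval]

lemma measurable_vEval (hψ : ∀ a, Measurable fun z : S × S => ψ z.1 a z.2)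
    (hφ : ∀ a, Measurable fun x => φ x a) (par : Params) {f : Fin H → S → A → ℝ}
    (hf : ∀ h a, Measurable fun x => f h x a) {n : ℕ} {D : Ω → Fin n → Episode S A H}
    (hD : Measurable D) {V : Ω → Fin n → Fin (H + 1) → S → ℝ}
    (hV : ∀ τ h, Measurable fun z : Ω × S => V z.1 τ h z.2) {π : Ω → PolicyFun S A H}
    (hπ : ∀ h a, Measurable fun z : Ω × S => π z.1 h z.2 a) (h : Fin (H + 1)) :
    Measurable fun z : Ω × S => vEval μ ψ φ par f (D z.1) (V z.1) (π z.1) h z.2 := by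
  induction h using Fin.reverseInduction with
  | last => simp only [vEval_last]; exact measurable_const
  | cast h ih =>
    simp only [vEval_castSucc]
    have hq : ∀ a, Measurable fun z : Ω × S =>
        qEval μ ψ φ par f (D z.1) (V z.1) (π z.1) h z.2 a := fun a =>
      measurable_qEstimate hψ hφ par hf hD hV h
        (Vnext := fun ω => vEval μ ψ φ par f (D ω) (V ω) (π ω) h.succ) ih a
    exact Finset.measurable_sum _ fun a _ => (hq a).mul (hπ h a)

lemma measurableIterate_initial (b : ℝ) :
    MeasurableIterate fun _ : Ω => (initial b : Iterate S A H) :=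
  ⟨fun _ _ => measurable_const, measurable_const, fun i _ _ => by
    cases i <;> exact measurable_const, fun i _ => by cases i <;> exact measurable_const⟩

lemma measurable_improve {I : Ω → Iterate S A H} (hI : MeasurableIterate I) (par : Params)
    (h : Fin H) (a : A) : Measurable fun z : Ω × S => improve par (I z.1) h z.2 a := by
  have hr : ∀ a, Measurable fun z : Ω × S => (I z.1).Qr h z.2 a := hI.Q true h
  have hg : ∀ a, Measurable fun z : Ω × S => (I z.1).Qg h z.2 a := hI.Q false h
  have hp : ∀ a, Measurable fun z : Ω × S => (I z.1).pol h z.2 a := hI.pol h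
  have hY : Measurable fun z : Ω × S => (I z.1).Y := hI.Y.comp measurable_fst
  have hexp : ∀ a, Measurable fun z : Ω × S =>
      Real.exp (par.α * ((I z.1).Qr h z.2 a + (I z.1).Y * (I z.1).Qg h z.2 a)) := fun a =>
    (((hr a).add (hY.mul (hg a))).const_mul par.α).exp
  have hmix : ∀ a, Measurable fun z : Ω × S => mix par.θ (I z.1).pol h z.2 a := fun a =>
    ((hp a).const_mul (1 - par.θ)).add_const _
  exact ((hmix a).mul (hexp a)).div
    (Finset.measurable_sum _ fun a _ => (hmix a).mul (hexp a))

lemma measurableIterate_episodeStep (M : CMDP S A H)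
    (hψ : ∀ a, Measurable fun z : S × S => ψ z.1 a z.2)
    (hφ : ∀ a, Measurable fun x => φ x a) (par : Params) {n : ℕ} {D : Ω → Fin n → Episode S A H}
    (hD : Measurable D) {past : Ω → Fin n → Iterate S A H}
    (hpast : ∀ τ, MeasurableIterate fun ω => past ω τ) :
    MeasurableIterate fun ω => episodeStep M μ ψ φ par (D ω) (past ω) := by
  let prev : Ω → Iterate S A H := fun ω => if hn : 0 < n then
      past ω ⟨n - 1, Nat.sub_lt hn Nat.one_pos⟩ else initial M.b
  have hprev : MeasurableIterate prev := by
    by_cases hn : 0 < n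
    · simpa [prev, hn] using hpast _
    · simpa [prev, hn] using measurableIterate_initial (Ω := Ω) M.b
  have hV : ∀ i, ∀ τ h, Measurable fun z : Ω × S => (past z.1 τ).V i h z.2 := fun i τ h =>
    (hpast τ).V i h
  have hπ := fun h a => measurable_improve hprev par h a
  have hv := fun i h => measurable_vEval (μ := μ) hψ hφ par (M.measurable_fn i) hD
    (V := fun ω τ => (past ω τ).V i) (hV i) (π := fun ω => improve par (prev ω)) hπ h
  have hq := fun i (h : Fin H) a =>
    measurable_qEstimate (μ := μ) hψ hφ par (M.measurable_fn i) hD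
      (V := fun ω τ => (past ω τ).V i) (hV i) h
      (Vnext := fun ω => vEval μ ψ φ par (M.fn i) (D ω) (fun τ => (past ω τ).V i)
        (improve par (prev ω)) h.succ) (hv i h.succ) a
  refine ⟨hπ, ?_, fun i h a => ?_, fun i h => ?_⟩
  · exact measurable_const.max (measurable_const.min (hprev.Y.add (((measurable_const.sub
      ((hprev.V false 0).comp (measurable_id.prodMk measurable_const)))).const_mul _)))
  · cases i
    exacts [hq false h a, hq true h a]
  · cases i
    exacts [hv false h, hv true h]

lemma opdop_eq (M : CMDP S A H) (par : Params) (n : ℕ) (D : Fin n → Episode S A H) :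
    opdop M μ ψ φ par n D = episodeStep M μ ψ φ par D fun τ : Fin n =>
      opdop M μ ψ φ par τ fun i => D (Fin.castLE τ.2.le i) := by
  rw [opdop]

/-- The induction is strong because an episode reads the value functions of all earlier episodes, as
regression targets and inside the features. -/
theorem measurableIterate_opdop (M : CMDP S A H)
    (hψ : ∀ a, Measurable fun z : S × S => ψ z.1 a z.2)
    (hφ : ∀ a, Measurable fun x => φ x a) (par : Params) (n : ℕ) :
    ∀ {D : Ω → Fin n → Episode S A H} (_ : Measurable D),
      MeasurableIterate fun ω => opdop M μ ψ φ par n (D ω) := by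
  induction n using Nat.strong_induction_on with
  | _ n ih =>
    intro D hD
    simp_rw [opdop_eq M par n]
    refine measurableIterate_episodeStep M hψ hφ par hD fun τ => ih τ τ.2 ?_
    exact measurable_pi_iff.mpr fun i => (measurable_pi_apply _).comp hD

end

end Algorithm

/-! ### Basic properties of the iterates -/

/-- The first `n` terms of a sequence. -/
def hist {E : Type*} (ω : ℕ → E) (n : ℕ) : Fin n → E := fun i => ω i

section RunDefinitions

variable {S A : Type*} [MeasurableSpace S] [MeasurableSpace A] [Fintype A] {H d₁ d₂ : ℕ}
  (M : CMDP S A H) (μ : Measure S) (ψ : S → A → S → EuclideanSpace ℝ (Fin d₁))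
  (φ : S → A → EuclideanSpace ℝ (Fin d₂)) (par : Params)

/-- The iterate of episode `n + 1` along a sequence of episodes. -/
noncomputable def iter (ω : ℕ → Episode S A H) (n : ℕ) : Iterate S A H :=
  opdop M μ ψ φ par n (hist ω n)

/-- The conditional law of the next episode. -/
noncomputable def episodeLaw (n : ℕ) (D : Fin n → Episode S A H) : Measure (Episode S A H) :=
  trajLaw H M.P (opdop M μ ψ φ par n D).pol M.x₁

/-- An arbitrary episode. -/
noncomputable def defaultEpisode [Nonempty A] : Episode S A H :=
  (fun _ => M.x₁, fun _ => Classical.arbitrary A)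

end RunDefinitions

section Iterates

variable {S A : Type*} [MeasurableSpace S] [MeasurableSpace A] [Fintype A]
  [DiscreteMeasurableSpace A] {H d₁ d₂ : ℕ}

lemma mix_nonneg {θ : ℝ} (h0 : 0 ≤ θ) (h1 : θ ≤ 1) {π : PolicyFun S A H}
    (hπ : ∀ h x a, 0 ≤ π h x a) (h : Fin H) (x : S) (a : A) : 0 ≤ mix θ π h x a :=
  add_nonneg (mul_nonneg (by linarith) (hπ h x a)) (by positivity)

lemma sum_mix [Nonempty A] (θ : ℝ) {π : PolicyFun S A H}
    (hπ : ∀ h x, ∑ a, π h x a = 1) (h : Fin H) (x : S) : ∑ a, mix θ π h x a = 1 := by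
  have : (Fintype.card A : ℝ) ≠ 0 := Nat.cast_ne_zero.mpr Fintype.card_ne_zero
  simp only [mix, Finset.sum_add_distrib, ← Finset.mul_sum, hπ, Finset.sum_const,
    Finset.card_univ, nsmul_eq_mul]
  field_simp
  ring

/-- The normalization in the policy improvement step. -/
lemma improve_denom_pos [Nonempty A] {par : Params} (h0 : 0 ≤ par.θ) (h1 : par.θ ≤ 1)
    {I : Iterate S A H} (hn : ∀ h x a, 0 ≤ I.pol h x a) (hs : ∀ h x, ∑ a, I.pol h x a = 1)
    (h : Fin H) (x : S) : 0 < ∑ a, mix par.θ I.pol h x a *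
      Real.exp (par.α * (I.Qr h x a + I.Y * I.Qg h x a)) := by
  have hm := mix_nonneg h0 h1 hn h x
  -- Strict positivity does not need θ > 0: a vanishing sum would make all mixed weights zero,
  -- although they sum to one.
  refine (Finset.sum_nonneg fun a _ => mul_nonneg (hm a) (Real.exp_pos _).le).lt_of_ne' fun h => ?_
  rw [Finset.sum_eq_zero_iff_of_nonneg fun a _ => mul_nonneg (hm a) (Real.exp_pos _).le] at h
  have hz : ∀ a, mix par.θ I.pol _ x a = 0 := fun a =>
    (mul_eq_zero.mp (h a (Finset.mem_univ a))).resolve_right (Real.exp_pos _).ne'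
  have := sum_mix par.θ hs ‹_› x
  simp [hz] at this

lemma improve_nonneg [Nonempty A] {par : Params} (h0 : 0 ≤ par.θ) (h1 : par.θ ≤ 1)
    {I : Iterate S A H} (hn : ∀ h x a, 0 ≤ I.pol h x a) (hs : ∀ h x, ∑ a, I.pol h x a = 1)
    (h : Fin H) (x : S) (a : A) : 0 ≤ improve par I h x a :=
  div_nonneg (mul_nonneg (mix_nonneg h0 h1 hn h x a) (Real.exp_pos _).le)
    (improve_denom_pos h0 h1 hn hs h x).le

lemma sum_improve [Nonempty A] {par : Params} (h0 : 0 ≤ par.θ) (h1 : par.θ ≤ 1)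
    {I : Iterate S A H} (hn : ∀ h x a, 0 ≤ I.pol h x a) (hs : ∀ h x, ∑ a, I.pol h x a = 1)
    (h : Fin H) (x : S) : ∑ a, improve par I h x a = 1 := by
  unfold improve
  rw [← Finset.sum_div]
  exact div_self (improve_denom_pos h0 h1 hn hs h x).ne'

variable {M : CMDP S A H} {μ : Measure S} [SFinite μ]
  {ψ : S → A → S → EuclideanSpace ℝ (Fin d₁)} {φ : S → A → EuclideanSpace ℝ (Fin d₂)}
  {par : Params}

/-- Along an infinite sequence of episodes the restrictions to shorter histories disappear, and the
iterates satisfy a plain recursion in `n`. -/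
lemma iter_eq (ω : ℕ → Episode S A H) (n : ℕ) :
    iter M μ ψ φ par ω n
      = episodeStep M μ ψ φ par (hist ω n) fun τ => iter M μ ψ φ par ω τ := by
  unfold iter
  rw [opdop_eq]
  rfl

lemma iter_zero_pol (ω : ℕ → Episode S A H) :
    (iter M μ ψ φ par ω 0).pol = improve par (initial M.b) := by
  rw [iter_eq]; rfl

lemma iter_zero_Y (ω : ℕ → Episode S A H) :
    (iter M μ ψ φ par ω 0).Y = dualUpdate par M.b M.x₁ (initial M.b : Iterate S A H) := by
  rw [iter_eq]; rfl

lemma iter_succ_pol (ω : ℕ → Episode S A H) (n : ℕ) :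
    (iter M μ ψ φ par ω (n + 1)).pol = improve par (iter M μ ψ φ par ω n) := by
  rw [iter_eq]; rfl

lemma iter_succ_Y (ω : ℕ → Episode S A H) (n : ℕ) :
    (iter M μ ψ φ par ω (n + 1)).Y = dualUpdate par M.b M.x₁ (iter M μ ψ φ par ω n) := by
  rw [iter_eq]; rfl

lemma iter_V (ω : ℕ → Episode S A H) (n : ℕ) (i : Bool) :
    (iter M μ ψ φ par ω n).V i = vEval μ ψ φ par (M.fn i) (hist ω n)
      (fun τ => (iter M μ ψ φ par ω τ).V i) (iter M μ ψ φ par ω n).pol := by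
  rw [iter_eq]; cases i <;> rfl

lemma iter_Q (ω : ℕ → Episode S A H) (n : ℕ) (i : Bool) (h : Fin H) :
    (iter M μ ψ φ par ω n).Q i h = qEstimate μ ψ φ par (M.fn i) (hist ω n)
      (fun τ => (iter M μ ψ φ par ω τ).V i) h ((iter M μ ψ φ par ω n).V i h.succ) := by
  rw [iter_V, iter_eq]; cases i <;> rfl

lemma iter_V_last (ω : ℕ → Episode S A H) (n : ℕ) (i : Bool) (x : S) :
    (iter M μ ψ φ par ω n).V i (Fin.last H) x = 0 := by
  rw [iter_V, vEval_last]

lemma iter_V_castSucc (ω : ℕ → Episode S A H) (n : ℕ) (i : Bool) (h : Fin H) (x : S) :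
    (iter M μ ψ φ par ω n).V i h.castSucc x
      = ∑ a, (iter M μ ψ φ par ω n).Q i h x a * (iter M μ ψ φ par ω n).pol h x a := by
  conv_lhs => rw [iter_V, vEval_castSucc]
  refine Finset.sum_congr rfl fun a _ => ?_
  rw [iter_Q, iter_V]
  rfl

lemma iter_Q_nonneg (ω : ℕ → Episode S A H) (n : ℕ) (i : Bool) (h : Fin H) (x : S) (a : A) :
    0 ≤ (iter M μ ψ φ par ω n).Q i h x a := by
  rw [iter_Q]; exact le_max_right _ _

lemma iter_Q_le (ω : ℕ → Episode S A H) (n : ℕ) (i : Bool) (h : Fin H) (x : S) (a : A) :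
    (iter M μ ψ φ par ω n).Q i h x a ≤ (H : ℝ) - (h : ℕ) := by
  rw [iter_Q]
  have : ((h : ℕ) : ℝ) ≤ H := Nat.cast_le.mpr h.2.le
  exact max_le (min_le_right _ _) (by linarith)

/-- A sequence that starts with the given data. -/
noncomputable def extend {E : Type*} (e₀ : E) {n : ℕ} (D : Fin n → E) (k : ℕ) : E :=
  if hk : k < n then D ⟨k, hk⟩ else e₀

lemma hist_extend {E : Type*} (e₀ : E) {n : ℕ} (D : Fin n → E) : hist (extend e₀ D) n = D := by
  funext i
  simp [hist, extend]

lemma opdop_eq_iter (e₀ : Episode S A H) (n : ℕ) (D : Fin n → Episode S A H) :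
    opdop M μ ψ φ par n D = iter M μ ψ φ par (extend e₀ D) n := by
  rw [iter, hist_extend]

section Policies

variable [Nonempty A]

lemma iter_pol_prob (h0 : 0 ≤ par.θ) (h1 : par.θ ≤ 1) (ω : ℕ → Episode S A H) (n : ℕ) :
    (∀ h x a, 0 ≤ (iter M μ ψ φ par ω n).pol h x a) ∧
      ∀ h x, ∑ a, (iter M μ ψ φ par ω n).pol h x a = 1 := by
  induction n with
  | zero =>
    have hn : ∀ h x a, 0 ≤ (initial M.b : Iterate S A H).pol h x a := fun h x a => by
      simp [initial]
    have hs : ∀ h x, ∑ a, (initial M.b : Iterate S A H).pol h x a = 1 := fun h x => by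
      simp [initial]
    rw [iter_zero_pol]
    exact ⟨improve_nonneg h0 h1 hn hs, sum_improve h0 h1 hn hs⟩
  | succ n ih =>
    rw [iter_succ_pol]
    exact ⟨improve_nonneg h0 h1 ih.1 ih.2, sum_improve h0 h1 ih.1 ih.2⟩

lemma iter_Y_mem (hχ : 0 ≤ par.χ) (ω : ℕ → Episode S A H) (n : ℕ) :
    (iter M μ ψ φ par ω n).Y ∈ Set.Icc 0 par.χ := by
  cases n with
  | zero => rw [iter_zero_Y]; exact ⟨le_max_left _ _, max_le hχ (min_le_left _ _)⟩
  | succ n => rw [iter_succ_Y]; exact ⟨le_max_left _ _, max_le hχ (min_le_left _ _)⟩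

lemma iter_V_mem (h0 : 0 ≤ par.θ) (h1 : par.θ ≤ 1) (ω : ℕ → Episode S A H) (n : ℕ) (i : Bool)
    (h : Fin (H + 1)) (x : S) :
    (iter M μ ψ φ par ω n).V i h x ∈ Set.Icc 0 ((H : ℝ) - (h : ℕ)) := by
  refine Fin.lastCases ?_ (fun h => ?_) h
  · rw [iter_V_last]; simp
  · rw [iter_V_castSucc, Fin.val_castSucc]
    obtain ⟨hn, hs⟩ := iter_pol_prob (M := M) (μ := μ) (ψ := ψ) (φ := φ) h0 h1 ω n
    refine ⟨Finset.sum_nonneg fun a _ => mul_nonneg (iter_Q_nonneg _ _ _ _ _ _) (hn h x a), ?_⟩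
    calc _ ≤ ∑ a, ((H : ℝ) - (h : ℕ)) * (iter M μ ψ φ par ω n).pol h x a :=
          Finset.sum_le_sum fun a _ => mul_le_mul_of_nonneg_right (iter_Q_le _ _ _ _ _ _) (hn h x a)
      _ = _ := by rw [← Finset.mul_sum, hs, mul_one]

lemma iter_V_mem' (h0 : 0 ≤ par.θ) (h1 : par.θ ≤ 1) (ω : ℕ → Episode S A H) (n : ℕ) (i : Bool)
    (h : Fin (H + 1)) (x : S) : (iter M μ ψ φ par ω n).V i h x ∈ Set.Icc (0 : ℝ) H :=
  ⟨(iter_V_mem h0 h1 ω n i h x).1, (iter_V_mem h0 h1 ω n i h x).2.trans (by simp)⟩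

lemma measurableIterate_iter (hψ : ∀ a, Measurable fun z : S × S => ψ z.1 a z.2)
    (hφ : ∀ a, Measurable fun x => φ x a) (ω : ℕ → Episode S A H) (n : ℕ) :
    MeasurableIterate fun _ : Unit => iter M μ ψ φ par ω n :=
  measurableIterate_opdop M hψ hφ par n measurable_const

lemma measurable_iter_V (hψ : ∀ a, Measurable fun z : S × S => ψ z.1 a z.2)
    (hφ : ∀ a, Measurable fun x => φ x a) (ω : ℕ → Episode S A H) (n : ℕ) (i : Bool)
    (h : Fin (H + 1)) : Measurable ((iter M μ ψ φ par ω n).V i h) :=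
  ((measurableIterate_iter hψ hφ ω n).V i h).comp (measurable_prodMk_left (x := ()))

lemma isPolicy_iter (hψ : ∀ a, Measurable fun z : S × S => ψ z.1 a z.2)
    (hφ : ∀ a, Measurable fun x => φ x a) (h0 : 0 ≤ par.θ) (h1 : par.θ ≤ 1)
    (ω : ℕ → Episode S A H) (n : ℕ) : IsPolicy (iter M μ ψ φ par ω n).pol :=
  ⟨fun h a => ((measurableIterate_iter hψ hφ ω n).pol h a).comp
    (measurable_prodMk_left (x := ())), (iter_pol_prob h0 h1 ω n).1, (iter_pol_prob h0 h1 ω n).2⟩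

lemma isPolicy_opdop (hψ : ∀ a, Measurable fun z : S × S => ψ z.1 a z.2)
    (hφ : ∀ a, Measurable fun x => φ x a) (h0 : 0 ≤ par.θ) (h1 : par.θ ≤ 1) (n : ℕ)
    (D : Fin n → Episode S A H) : IsPolicy (opdop M μ ψ φ par n D).pol := by
  rw [opdop_eq_iter (defaultEpisode M)]
  exact isPolicy_iter hψ hφ h0 h1 _ n

/-! ### The law of the run -/

lemma measurable_snoc {E : Type*} [MeasurableSpace E] (n : ℕ) :
    Measurable fun z : (Fin n → E) × E => (Fin.snoc z.1 z.2 : Fin (n + 1) → E) := by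
  refine measurable_pi_iff.mpr fun i => ?_
  refine Fin.lastCases ?_ (fun j => ?_) i
  · simpa using measurable_snd
  · simpa [Function.comp_def] using (measurable_pi_apply j).comp measurable_fst

/-- The standing assumptions under which the law of the run is well behaved. -/
structure Regular (ψ : S → A → S → EuclideanSpace ℝ (Fin d₁))
    (φ : S → A → EuclideanSpace ℝ (Fin d₂)) (par : Params) : Prop where
  psi : ∀ a, Measurable fun z : S × S => ψ z.1 a z.2
  phi : ∀ a, Measurable fun x => φ x a
  theta_nonneg : 0 ≤ par.θ
  theta_le_one : par.θ ≤ 1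

lemma isProbabilityMeasure_episodeLaw (hR : Regular ψ φ par) (n : ℕ) (D : Fin n → Episode S A H) :
    IsProbabilityMeasure (episodeLaw M μ ψ φ par n D) :=
  isProbabilityMeasure_trajLaw M.markov
    (isPolicy_opdop hR.psi hR.phi hR.theta_nonneg hR.theta_le_one n D) _

lemma measurable_episodeLaw (hR : Regular ψ φ par) (n : ℕ) :
    Measurable (episodeLaw M μ ψ φ par n) :=
  ((measurable_and_isProbabilityMeasure_trajLaw H M.P M.markov
    (fun D => (opdop M μ ψ φ par n D).pol)
    (isPolicy_opdop hR.psi hR.phi hR.theta_nonneg hR.theta_le_one n)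
    (measurableIterate_opdop M hR.psi hR.phi par n measurable_id).pol).1).comp
      (measurable_id.prodMk measurable_const)

lemma lintegral_runLaw_succ (hR : Regular ψ φ par) (n : ℕ)
    {F : (Fin (n + 1) → Episode S A H) → ENNReal} (hF : Measurable F) :
    ∫⁻ D, F D ∂(runLaw M μ ψ φ par (n + 1)) = ∫⁻ D, ∫⁻ e, F (Fin.snoc D e)
      ∂(episodeLaw M μ ψ φ par n D) ∂(runLaw M μ ψ φ par n) := by
  let κ : Kernel (Fin n → Episode S A H) (Episode S A H) :=
    ⟨episodeLaw M μ ψ φ par n, measurable_episodeLaw hR n⟩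
  have hκ : IsMarkovKernel κ := ⟨isProbabilityMeasure_episodeLaw hR n⟩
  have hs : ∀ D : Fin n → Episode S A H, Measurable fun e =>
      (Fin.snoc (α := fun _ => Episode S A H) D e) := fun D =>
    (measurable_snoc n).comp measurable_prodMk_left
  have hm : Measurable fun D : Fin n → Episode S A H => (episodeLaw M μ ψ φ par n D).map
      fun e => Fin.snoc (α := fun _ => Episode S A H) D e := by
    refine Measure.measurable_of_measurable_coe _ fun B hB => ?_
    simp_rw [fun D => Measure.map_apply (μ := episodeLaw M μ ψ φ par n D) (hs D) hB]
    exact Kernel.measurable_kernel_prodMk_left (κ := κ) (measurable_snoc n hB)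
  change ∫⁻ D, F D ∂((runLaw M μ ψ φ par n).bind fun D => (episodeLaw M μ ψ φ par n D).map
      fun e => Fin.snoc (α := fun _ => Episode S A H) D e) = _
  rw [Measure.lintegral_bind hm.aemeasurable hF.aemeasurable]
  exact lintegral_congr fun D => lintegral_map hF (hs D)

lemma isProbabilityMeasure_runLaw (hR : Regular ψ φ par) (n : ℕ) :
    IsProbabilityMeasure (runLaw M μ ψ φ par n) := by
  induction n with
  | zero => exact Measure.dirac.isProbabilityMeasure
  | succ n ih =>
    refine ⟨?_⟩
    have h := lintegral_runLaw_succ (M := M) (μ := μ) hR n (measurable_const (a := (1 : ENNReal)))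
    have := isProbabilityMeasure_episodeLaw (M := M) (μ := μ) hR n
    simpa using h

lemma extend_snoc_lt {E : Type*} (e₀ : E) {n : ℕ} (D : Fin n → E) (e : E) {k : ℕ} (hk : k < n) :
    extend e₀ (Fin.snoc (α := fun _ => E) D e) k = extend e₀ D k := by
  simp [extend, hk, hk.trans (Nat.lt_succ_self n), Fin.snoc]

lemma extend_snoc_self {E : Type*} (e₀ : E) {n : ℕ} (D : Fin n → E) (e : E) :
    extend e₀ (Fin.snoc (α := fun _ => E) D e) n = e := by
  simp [extend, Fin.snoc]

lemma hist_extend_snoc {E : Type*} (e₀ : E) {n : ℕ} (D : Fin n → E) (e : E) {k : ℕ} (hk : k ≤ n) :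
    hist (extend e₀ (Fin.snoc (α := fun _ => E) D e)) k = hist (extend e₀ D) k :=
  funext fun i => extend_snoc_lt e₀ D e (i.2.trans_le hk)

lemma measurable_extend {E : Type*} [MeasurableSpace E] (e₀ : E) (n k : ℕ) :
    Measurable fun D : Fin n → E => extend e₀ D k := by
  unfold extend
  by_cases hk : k < n
  · simpa [hk] using measurable_pi_apply _
  · simp [hk]

lemma measurable_hist_extend {E : Type*} [MeasurableSpace E] (e₀ : E) (n k : ℕ) :
    Measurable fun D : Fin n → E => hist (extend e₀ D) k :=
  measurable_pi_iff.mpr fun _ => measurable_extend e₀ n _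

/-- A product of factors with conditional expectations at most one. -/
theorem lintegral_prod_le_one (hR : Regular ψ φ par)
    (g : (k : ℕ) → (Fin k → Episode S A H) → Episode S A H → ENNReal)
    (hg : ∀ k, Measurable fun z : (Fin k → Episode S A H) × Episode S A H => g k z.1 z.2)
    (h1 : ∀ k D, ∫⁻ e, g k D e ∂(episodeLaw M μ ψ φ par k D) ≤ 1) (e₀ : Episode S A H) (n : ℕ) :
    ∫⁻ D, ∏ k ∈ Finset.range n, g k (hist (extend e₀ D) k) (extend e₀ D k)
      ∂(runLaw M μ ψ φ par n) ≤ 1 := by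
  have hm : ∀ n m : ℕ, Measurable fun D : Fin n → Episode S A H =>
      ∏ k ∈ Finset.range m, g k (hist (extend e₀ D) k) (extend e₀ D k) := fun n m =>
    Finset.measurable_prod _ fun k _ => (hg k).comp
      ((measurable_hist_extend e₀ n k).prodMk (measurable_extend e₀ n k))
  induction n with
  | zero =>
    have := isProbabilityMeasure_runLaw (M := M) (μ := μ) hR 0
    simp
  | succ n ih =>
    rw [lintegral_runLaw_succ hR n (hm _ _)]
    refine le_trans (lintegral_mono fun D => ?_) ih
    have : ∀ e, ∏ k ∈ Finset.range (n + 1),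
        g k (hist (extend e₀ (Fin.snoc (α := fun _ => Episode S A H) D e)) k)
          (extend e₀ (Fin.snoc (α := fun _ => Episode S A H) D e) k)
        = (∏ k ∈ Finset.range n, g k (hist (extend e₀ D) k) (extend e₀ D k)) * g n D e := by
      intro e
      rw [Finset.prod_range_succ, extend_snoc_self, hist_extend_snoc e₀ D e le_rfl, hist_extend]
      congr 1
      refine Finset.prod_congr rfl fun k hk => ?_
      have hk := Finset.mem_range.mp hk
      rw [extend_snoc_lt e₀ D e hk, hist_extend_snoc e₀ D e hk.le]
    simp_rw [this]
    have hgn : Measurable (g n D) := (hg n).comp measurable_prodMk_left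
    rw [lintegral_const_mul _ hgn]
    exact mul_le_of_le_one_right' (h1 n D)

/-- An exponential deviation inequality for sums of adapted variables. -/
theorem runLaw_exp_deviation (hR : Regular ψ φ par)
    (z : (k : ℕ) → (Fin k → Episode S A H) → Episode S A H → ℝ)
    (hz : ∀ k, Measurable fun q : (Fin k → Episode S A H) × Episode S A H => z k q.1 q.2)
    (h1 : ∀ k D, ∫⁻ e, ENNReal.ofReal (Real.exp (z k D e)) ∂(episodeLaw M μ ψ φ par k D) ≤ 1)
    (e₀ : Episode S A H) {n K : ℕ} (hn : n ≤ K) {δ : ℝ} (hδ : 0 < δ) :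
    runLaw M μ ψ φ par K {D | Real.log (1 / δ) ≤
      ∑ k ∈ Finset.range n, z k (hist (extend e₀ D) k) (extend e₀ D k)} ≤ ENNReal.ofReal δ := by
  -- Factors from episode `n` on are set to 1, so an event about the first `n` episodes is measured
  -- under the law of all `K` of them without computing marginals.
  let g : (k : ℕ) → (Fin k → Episode S A H) → Episode S A H → ENNReal := fun k D e =>
    if k < n then ENNReal.ofReal (Real.exp (z k D e)) else 1
  have hgm : ∀ k, Measurable fun q : (Fin k → Episode S A H) × Episode S A H => g k q.1 q.2 := by
    intro k
    by_cases hk : k < n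
    · simpa [g, hk] using (hz k).exp.ennreal_ofReal
    · simp [g, hk]
  have hg1 : ∀ k D, ∫⁻ e, g k D e ∂(episodeLaw M μ ψ φ par k D) ≤ 1 := by
    intro k D
    have := isProbabilityMeasure_episodeLaw (M := M) (μ := μ) hR k D
    by_cases hk : k < n
    · simpa [g, hk] using h1 k D
    · simp [g, hk]
  have key := lintegral_prod_le_one (M := M) (μ := μ) hR g hgm hg1 e₀ K
  have hprod : ∀ D : Fin K → Episode S A H,
      ∏ k ∈ Finset.range K, g k (hist (extend e₀ D) k) (extend e₀ D k) = ENNReal.ofReal (Real.exp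
        (∑ k ∈ Finset.range n, z k (hist (extend e₀ D) k) (extend e₀ D k))) := by
    intro D
    rw [Real.exp_sum, ENNReal.ofReal_prod_of_nonneg fun _ _ => (Real.exp_pos _).le,
      ← Finset.prod_subset (Finset.range_subset_range.mpr hn) fun k _ hk => by
        simp [g, Finset.mem_range.not.mp hk]]
    exact Finset.prod_congr rfl fun k hk => by simp [g, Finset.mem_range.mp hk]
  simp_rw [hprod] at key
  have hm : Measurable fun D : Fin K → Episode S A H => ENNReal.ofReal (Real.exp
      (∑ k ∈ Finset.range n, z k (hist (extend e₀ D) k) (extend e₀ D k))) :=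
    (Real.measurable_exp.comp (Finset.measurable_sum _ fun k _ => (hz k).comp
      ((measurable_hist_extend e₀ K k).prodMk (measurable_extend e₀ K k)))).ennreal_ofReal
  have hmarkov := (meas_ge_le_lintegral_div (μ := runLaw M μ ψ φ par K) hm.aemeasurable
    (ε := ENNReal.ofReal (1 / δ)) (by simpa using hδ) ENNReal.ofReal_ne_top)
  refine (measure_mono fun D hD => ?_).trans (hmarkov.trans ?_)
  · simp only [Set.mem_ofPred_eq] at hD ⊢
    refine ENNReal.ofReal_le_ofReal ?_
    rwa [← Real.log_le_iff_le_exp (by positivity)]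
  · calc _ ≤ 1 / ENNReal.ofReal (1 / δ) := ENNReal.div_le_div_right key _
      _ = ENNReal.ofReal δ := by
        rw [one_div δ, ENNReal.ofReal_inv_of_pos hδ, one_div, inv_inv]

end Policies

end Iterates

/-! ### Concentration of the regression noise and optimism -/

section Regression

lemma lintegral_ofReal_le_of_le {Ω : Type*} [MeasurableSpace Ω] {ν : Measure Ω}
    [IsProbabilityMeasure ν] {f : Ω → ℝ} (hf : Integrable f ν) {c : ℝ}
    (h0 : ∀ ω, 0 ≤ f ω) (hle : ∫ ω, f ω ∂ν ≤ c) {g : Ω → ℝ} (hg : ∀ ω, g ω ≤ f ω) :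
    ∫⁻ ω, ENNReal.ofReal (g ω) ∂ν ≤ ENNReal.ofReal c := by
  refine (lintegral_mono fun ω => ENNReal.ofReal_le_ofReal (hg ω)).trans ?_
  rw [← ofReal_integral_eq_lintegral_ofReal hf (Filter.Eventually.of_forall h0)]
  exact ENNReal.ofReal_le_ofReal hle

/-- Hoeffding's lemma for centered variables with values in `[-1, 1]`. -/
lemma integral_exp_mul_le {Ω : Type*} [MeasurableSpace Ω] {ν : Measure Ω}
    [IsProbabilityMeasure ν] {ε : Ω → ℝ} (hm : Measurable ε) (hb : ∀ ω, |ε ω| ≤ 1)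
    (h0 : ∫ ω, ε ω ∂ν = 0) (s : ℝ) :
    Integrable (fun ω => Real.exp (s * ε ω)) ν ∧
      ∫ ω, Real.exp (s * ε ω) ∂ν ≤ Real.exp (s ^ 2 / 2) := by
  have habs : ∀ ω, |s * ε ω| ≤ |s| := fun ω => by
    rw [abs_mul]; exact mul_le_of_le_one_right (abs_nonneg s) (hb ω)
  have hint : Integrable (fun ω => Real.exp (s * ε ω)) ν :=
    integrable_of_measurable_of_bounded (hm.const_mul s).exp (C := Real.exp |s|) fun ω => by
      rw [abs_of_pos (Real.exp_pos _)]
      exact Real.exp_le_exp.mpr ((le_abs_self _).trans (habs ω))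
  refine ⟨hint, ?_⟩
  rcases eq_or_ne s 0 with rfl | hs
  · simp
  have hε : Integrable ε ν := integrable_of_measurable_of_bounded hm hb
  have hle : ∀ ω, Real.exp (s * ε ω)
      ≤ Real.exp (s ^ 2 / 2) + s * (Real.sinh |s| / |s|) * ε ω := fun ω => by
    have := exp_le_hoeffding (abs_pos.mpr hs) (habs ω)
    rw [sq_abs] at this
    linarith
  refine (integral_mono hint ((integrable_const _).add (hε.const_mul _)) hle).trans ?_
  simp only [Pi.add_apply]
  rw [integral_add (integrable_const _) (hε.const_mul _), integral_const_mul, h0]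
  simp

/-- The one-step supermartingale property behind the self-normalized bound. -/
lemma lintegral_selfNormalized_step {Ω : Type*} [MeasurableSpace Ω] {ν : Measure Ω}
    [IsProbabilityMeasure ν] {ε : Ω → ℝ} (hm : Measurable ε) (hb : ∀ ω, |ε ω| ≤ 1)
    (h0 : ∫ ω, ε ω ∂ν = 0) {u : ℝ} (hu : 0 ≤ u) (m : ℝ) :
    ∫⁻ ω, ENNReal.ofReal (Real.exp ((2 * ε ω * m + ε ω ^ 2 * u - m ^ 2) / (1 + u) / 2
      - u / (1 + u) / 2)) ∂ν ≤ 1 := by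
  have hu1 : 0 < 1 + u := by linarith
  -- With m = s(1 + u) the exponent equals sε - s²(1 + u)/2 - (1 - ε²)u/(2(1 + u)). The compensator
  -- u/(2(1 + u)) pays for the quadratic term since ε² ≤ 1, and sε - s²/2 is what Hoeffding's lemma
  -- can bound.
  set s : ℝ := m / (1 + u) with hs
  obtain ⟨hint, hle⟩ := integral_exp_mul_le hm hb h0 s
  have key : ∀ ω, (2 * ε ω * m + ε ω ^ 2 * u - m ^ 2) / (1 + u) / 2 - u / (1 + u) / 2
      ≤ s * ε ω - s ^ 2 / 2 := by
    intro ω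
    have h1 : ε ω ^ 2 ≤ 1 := (sq_le_one_iff_abs_le_one _).mpr (hb ω)
    have hm' : m = s * (1 + u) := by rw [hs]; field_simp
    rw [hm']
    have e1 : (2 * ε ω * (s * (1 + u)) + ε ω ^ 2 * u - (s * (1 + u)) ^ 2) / (1 + u) / 2
        - u / (1 + u) / 2 = s * ε ω - s ^ 2 * (1 + u) / 2 - (1 - ε ω ^ 2) * u / (1 + u) / 2 := by
      field_simp
      ring
    rw [e1]
    have h2 : 0 ≤ (1 - ε ω ^ 2) * u / (1 + u) / 2 := by
      have : 0 ≤ 1 - ε ω ^ 2 := by linarith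
      positivity
    nlinarith [mul_nonneg (sq_nonneg s) hu]
  have h := lintegral_ofReal_le_of_le (ν := ν) (f := fun ω =>
      Real.exp (s * ε ω) * Real.exp (-(s ^ 2 / 2))) (hint.mul_const _) (c := 1)
    (fun ω => by positivity) (by
      rw [integral_mul_const]
      calc _ ≤ Real.exp (s ^ 2 / 2) * Real.exp (-(s ^ 2 / 2)) :=
            mul_le_mul_of_nonneg_right hle (Real.exp_pos _).le
        _ = 1 := by rw [← Real.exp_add]; simp)
    (g := fun ω => Real.exp ((2 * ε ω * m + ε ω ^ 2 * u - m ^ 2) / (1 + u) / 2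
      - u / (1 + u) / 2)) fun ω => by
        rw [← Real.exp_add]
        exact Real.exp_le_exp.mpr (by linarith [key ω])
  simpa using h

variable {S A : Type*} [MeasurableSpace S] [MeasurableSpace A] [Fintype A]
  [DiscreteMeasurableSpace A] {H d₁ d₂ d : ℕ} {M : CMDP S A H} {μ : Measure S}
  {ψ : S → A → S → EuclideanSpace ℝ (Fin d₁)} {φ : S → A → EuclideanSpace ℝ (Fin d₂)}
  {par : Params}

lemma integrable_smul_psi (hL : M.IsLinearKernel μ ψ φ d) {V : S → ℝ} (hV : Measurable V)
    (hVb : ∀ x, V x ∈ Set.Icc (0 : ℝ) H) (x : S) (a : A) :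
    Integrable (fun x' => V x' • ψ x a x') μ := by
  refine ((hL.integrable_psi x a).norm.const_mul (H : ℝ)).mono'
    (hV.aestronglyMeasurable.smul (hL.integrable_psi x a).aestronglyMeasurable)
    (Filter.Eventually.of_forall fun x' => ?_)
  rw [norm_smul, Real.norm_eq_abs, abs_of_nonneg (hVb x').1]
  exact mul_le_mul_of_nonneg_right (hVb x').2 (norm_nonneg _)

/-- The expected value at the next state is linear in the feature of the value function. -/
lemma kernelFeature_dotProduct (hL : M.IsLinearKernel μ ψ φ d) {h : Fin H}
    {θ : EuclideanSpace ℝ (Fin d₁)} {x : S} {a : A} (h0 : ∀ x', 0 ≤ inner ℝ (ψ x a x') θ)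
    (hP : M.P h (x, a) = μ.withDensity fun x' => ENNReal.ofReal (inner ℝ (ψ x a x') θ))
    {V : S → ℝ} (hV : Measurable V) (hVb : ∀ x, V x ∈ Set.Icc (0 : ℝ) H) :
    (kernelFeature μ ψ V x a).ofLp ⬝ᵥ θ.ofLp = ∫ x', V x' ∂(M.P h (x, a)) := by
  have hψm : Measurable fun x' => ψ x a x' := (hL.measurable_psi a).comp measurable_prodMk_left
  have hm : Measurable fun x' => ENNReal.ofReal (inner ℝ (ψ x a x') θ) :=
    (hψm.inner measurable_const).ennreal_ofReal
  rw [hP, integral_withDensity_eq_integral_toReal_smul hm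
    (Filter.Eventually.of_forall fun _ => ENNReal.ofReal_lt_top), ← inner_eq_dotProduct,
    real_inner_comm, kernelFeature, ← integral_inner (integrable_smul_psi hL hV hVb x a)]
  refine integral_congr_ae (Filter.Eventually.of_forall fun x' => ?_)
  simp only [smul_eq_mul]
  rw [ENNReal.toReal_ofReal (h0 x'), real_inner_smul_right, real_inner_comm, mul_comm]

variable (M μ ψ φ par) in
/-- The feature of the estimated value function at the visited pair. -/
noncomputable def visitFeature (i : Bool) (h : Fin H) (ω : ℕ → Episode S A H) (k : ℕ) :
    EuclideanSpace ℝ (Fin d₁) :=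
  kernelFeature μ ψ ((iter M μ ψ φ par ω k).V i h.succ) ((ω k).1 h.castSucc) ((ω k).2 h)

variable (M μ ψ φ par) in
/-- The regression noise, normalized by `H`. -/
noncomputable def visitNoise (θ : EuclideanSpace ℝ (Fin d₁)) (i : Bool) (h : Fin H)
    (ω : ℕ → Episode S A H) (k : ℕ) : ℝ :=
  ((iter M μ ψ φ par ω k).V i h.succ ((ω k).1 h.succ)
    - (visitFeature M μ ψ φ par i h ω k).ofLp ⬝ᵥ θ.ofLp) / H

/-- Adaptedness is expressed as dependence on finitely many coordinates of the sequence: the iterate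
sees the episodes strictly before it, while features and noise also see the current one. -/
lemma iter_congr {ω ω' : ℕ → Episode S A H} {n : ℕ} (h : ∀ j < n, ω j = ω' j) :
    iter M μ ψ φ par ω n = iter M μ ψ φ par ω' n := by
  unfold iter
  congr 1
  exact funext fun i => h i i.2

lemma visitFeature_congr {ω ω' : ℕ → Episode S A H} {k : ℕ} (h : ∀ j ≤ k, ω j = ω' j) (i : Bool)
    (s : Fin H) : visitFeature M μ ψ φ par i s ω k = visitFeature M μ ψ φ par i s ω' k := by
  unfold visitFeature
  rw [iter_congr fun j hj => h j hj.le, h k le_rfl]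

lemma visitNoise_congr {ω ω' : ℕ → Episode S A H} {k : ℕ} (h : ∀ j ≤ k, ω j = ω' j)
    (θ : EuclideanSpace ℝ (Fin d₁)) (i : Bool) (s : Fin H) :
    visitNoise M μ ψ φ par θ i s ω k = visitNoise M μ ψ φ par θ i s ω' k := by
  unfold visitNoise
  rw [iter_congr fun j hj => h j hj.le, visitFeature_congr h, h k le_rfl]

lemma invForm_congr {m : ℕ} {v v' : ℕ → EuclideanSpace ℝ (Fin m)} {n : ℕ}
    (h : ∀ j < n, v j = v' j) (x y : Fin m → ℝ) : invForm v n x y = invForm v' n x y := by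
  unfold invForm
  rw [show (fun τ : Fin n => v τ) = fun τ : Fin n => v' τ from funext fun τ => h τ τ.2]

lemma noiseSum_congr {m : ℕ} {v v' : ℕ → EuclideanSpace ℝ (Fin m)} {ε ε' : ℕ → ℝ} {n : ℕ}
    (h : ∀ j < n, v j = v' j) (h' : ∀ j < n, ε j = ε' j) : noiseSum v ε n = noiseSum v' ε' n :=
  Finset.sum_congr rfl fun τ _ => by rw [h τ τ.2, h' τ τ.2]

variable [SFinite μ] [Nonempty A]

lemma measurable_hist (n : ℕ) : Measurable fun ω : ℕ → Episode S A H => hist ω n :=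
  measurable_pi_iff.mpr fun _ => measurable_pi_apply _

lemma measurableIterate_iter_run (hR : Regular ψ φ par) (n : ℕ) :
    MeasurableIterate fun ω => iter M μ ψ φ par ω n :=
  measurableIterate_opdop M hR.psi hR.phi par n (measurable_hist n)

lemma measurable_run_state (k : ℕ) (h : Fin (H + 1)) :
    Measurable fun ω : ℕ → Episode S A H => (ω k).1 h :=
  (measurable_pi_apply h).comp (measurable_fst.comp (measurable_pi_apply k))

lemma measurable_run_action (k : ℕ) (h : Fin H) :
    Measurable fun ω : ℕ → Episode S A H => (ω k).2 h :=
  (measurable_pi_apply h).comp (measurable_snd.comp (measurable_pi_apply k))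

lemma measurable_visitFeature (hR : Regular ψ φ par) (i : Bool) (h : Fin H) (k : ℕ) :
    Measurable fun ω => visitFeature M μ ψ φ par i h ω k :=
  measurable_kernelFeature μ hR.psi (V := fun ω => (iter M μ ψ φ par ω k).V i h.succ)
    ((measurableIterate_iter_run hR k).V i h.succ) (measurable_run_state k _)
    (measurable_run_action k _)

lemma measurable_visitNoise (hR : Regular ψ φ par) (θ : EuclideanSpace ℝ (Fin d₁)) (i : Bool)
    (h : Fin H) (k : ℕ) : Measurable fun ω => visitNoise M μ ψ φ par θ i h ω k := by
  have h1 : Measurable fun ω : ℕ → Episode S A H =>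
      (iter M μ ψ φ par ω k).V i h.succ ((ω k).1 h.succ) :=
    ((measurableIterate_iter_run hR k).V i h.succ).comp
      (measurable_id.prodMk (measurable_run_state k _))
  have h2 : Measurable fun ω => (visitFeature M μ ψ φ par i h ω k).ofLp ⬝ᵥ θ.ofLp :=
    Finset.measurable_sum _ fun j _ =>
      (measurable_ofLp_apply (measurable_visitFeature hR i h k) j).mul_const _
  exact (h1.sub h2).div_const _

/-- A deviation inequality in terms of adapted functions of the sequence of episodes. -/
theorem runLaw_adapted_deviation (hR : Regular ψ φ par) {ζ : ℕ → (ℕ → Episode S A H) → ℝ}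
    (hm : ∀ k, Measurable (ζ k))
    (hloc : ∀ k ω ω', (∀ j ≤ k, ω j = ω' j) → ζ k ω = ζ k ω')
    (h1 : ∀ k ω, ∫⁻ e, ENNReal.ofReal (Real.exp (ζ k (Function.update ω k e)))
      ∂(episodeLaw M μ ψ φ par k (hist ω k)) ≤ 1)
    (e₀ : Episode S A H) {n K : ℕ} (hn : n ≤ K) {δ : ℝ} (hδ : 0 < δ) :
    runLaw M μ ψ φ par K {D | Real.log (1 / δ) ≤ ∑ k ∈ Finset.range n, ζ k (extend e₀ D)}
      ≤ ENNReal.ofReal δ := by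
  have hmu : ∀ k, Measurable fun q : (Fin k → Episode S A H) × Episode S A H =>
      Function.update (extend e₀ q.1) k q.2 := by
    refine fun k => measurable_pi_iff.mpr fun j => ?_
    by_cases hj : j = k
    · subst hj; simpa using measurable_snd
    · simpa [Function.update_of_ne hj, Function.comp_def] using
        (measurable_extend e₀ k j).comp measurable_fst
  have key := runLaw_exp_deviation (M := M) (μ := μ) hR
    (fun k D e => ζ k (Function.update (extend e₀ D) k e)) (fun k => (hm k).comp (hmu k))
    (fun k D => by simpa [hist_extend] using h1 k (extend e₀ D)) e₀ hn hδ
  -- Keeping the first `k` episodes and reinserting the next one reproduces the run up to index `k`,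
  -- and `ζ k` sees nothing later.
  have heq : ∀ (D : Fin K → Episode S A H) k, ζ k (Function.update
      (extend e₀ (hist (extend e₀ D) k)) k (extend e₀ D k)) = ζ k (extend e₀ D) := by
    refine fun D k => hloc _ _ _ fun j hj => ?_
    rcases hj.eq_or_lt with rfl | hj
    · simp
    · rw [Function.update_of_ne hj.ne]
      simp [extend, hist, hj]
  simpa only [heq] using key

/-- The increments of the self-normalized process. -/
noncomputable def selfNormalizedIncrement {m : ℕ} (v : ℕ → EuclideanSpace ℝ (Fin m)) (ε : ℕ → ℝ)
    (k : ℕ) : ℝ :=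
  (2 * ε k * invForm v k (v k).ofLp (noiseSum v ε k) + ε k ^ 2 * leverage v k
    - invForm v k (v k).ofLp (noiseSum v ε k) ^ 2) / (1 + leverage v k) / 2
    - leverage v k / (1 + leverage v k) / 2

/-- A bound log(1/δ) on the sum of the increments thus bounds the self-normalized norm squared by 2
log(1/δ) plus the potential ∑ u/(1 + u). -/
lemma sum_selfNormalizedIncrement {m : ℕ} (v : ℕ → EuclideanSpace ℝ (Fin m)) (ε : ℕ → ℝ)
    (n : ℕ) : ∑ k ∈ Finset.range n, selfNormalizedIncrement v ε k
      = (invForm v n (noiseSum v ε n) (noiseSum v ε n)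
          - ∑ k ∈ Finset.range n, leverage v k / (1 + leverage v k)) / 2 := by
  rw [invForm_noiseSum, ← Finset.sum_sub_distrib, Finset.sum_div]
  exact Finset.sum_congr rfl fun k _ => by rw [selfNormalizedIncrement]; ring

lemma measurable_selfNormalizedIncrement {Ω : Type*} [MeasurableSpace Ω] {m : ℕ}
    {v : ℕ → Ω → EuclideanSpace ℝ (Fin m)} (hv : ∀ k, Measurable (v k)) {ε : ℕ → Ω → ℝ}
    (hε : ∀ k, Measurable (ε k)) (k : ℕ) :
    Measurable fun ω => selfNormalizedIncrement (fun k => v k ω) (fun k => ε k ω) k := by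
  have h1 : Measurable fun ω => leverage (fun k => v k ω) k :=
    measurable_quad 1 (fun τ : Fin k => hv τ) (measurable_ofLp_apply (hv k))
      (measurable_ofLp_apply (hv k))
  have h2 : Measurable fun ω => invForm (fun k => v k ω) k (v k ω).ofLp
      (noiseSum (fun k => v k ω) (fun k => ε k ω) k) := by
    refine measurable_quad 1 (fun τ : Fin k => hv τ) (measurable_ofLp_apply (hv k)) fun j => ?_
    simp only [noiseSum, Finset.sum_apply, Pi.smul_apply, smul_eq_mul]
    exact Finset.measurable_sum _ fun τ _ => (hε τ).mul (measurable_ofLp_apply (hv τ) j)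
  unfold selfNormalizedIncrement
  exact ((((((hε k).const_mul 2).mul h2).add (((hε k).pow_const 2).mul h1)).sub
    (h2.pow_const 2)).div (h1.const_add 1)).div_const 2 |>.sub
      ((h1.div (h1.const_add 1)).div_const 2)

lemma selfNormalizedIncrement_congr {m : ℕ} {v v' : ℕ → EuclideanSpace ℝ (Fin m)} {ε ε' : ℕ → ℝ}
    {k : ℕ} (h : ∀ j ≤ k, v j = v' j) (h' : ∀ j ≤ k, ε j = ε' j) :
    selfNormalizedIncrement v ε k = selfNormalizedIncrement v' ε' k := by
  have hlt : ∀ j < k, v j = v' j := fun j hj => h j hj.le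
  have hl : leverage v k = leverage v' k := by
    unfold leverage
    rw [invForm_congr hlt, h k le_rfl]
  unfold selfNormalizedIncrement
  rw [hl, invForm_congr hlt, noiseSum_congr hlt fun j hj => h' j hj.le, h k le_rfl, h' k le_rfl]

/-- The self-normalized deviation inequality for the regression noise. -/
theorem runLaw_selfNormalized (hR : Regular ψ φ par) (hL : M.IsLinearKernel μ ψ φ d)
    (hH : 0 < H) {h : Fin H} {θ : EuclideanSpace ℝ (Fin d₁)}
    (hθ : ∀ x a, (∀ x', 0 ≤ inner ℝ (ψ x a x') θ) ∧
      M.P h (x, a) = μ.withDensity fun x' => ENNReal.ofReal (inner ℝ (ψ x a x') θ))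
    (i : Bool) (e₀ : Episode S A H) {n K : ℕ} (hn : n ≤ K) {δ : ℝ} (hδ : 0 < δ) :
    runLaw M μ ψ φ par K {D | Real.log (1 / δ) ≤ ∑ k ∈ Finset.range n,
      selfNormalizedIncrement (visitFeature M μ ψ φ par i h (extend e₀ D))
        (visitNoise M μ ψ φ par θ i h (extend e₀ D)) k} ≤ ENNReal.ofReal δ := by
  have hmeas : ∀ k, Measurable fun ω => selfNormalizedIncrement (visitFeature M μ ψ φ par i h ω)
      (visitNoise M μ ψ φ par θ i h ω) k := fun k =>
    measurable_selfNormalizedIncrement (fun k => measurable_visitFeature hR i h k)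
      (fun k => measurable_visitNoise hR θ i h k) k
  refine runLaw_adapted_deviation hR (ζ := fun k ω => selfNormalizedIncrement
    (visitFeature M μ ψ φ par i h ω) (visitNoise M μ ψ φ par θ i h ω) k) hmeas ?_ ?_ e₀ hn hδ
  · exact fun k ω ω' hω => selfNormalizedIncrement_congr
      (fun j hj => visitFeature_congr (fun l hl => hω l (hl.trans hj)) i h)
      fun j hj => visitNoise_congr (fun l hl => hω l (hl.trans hj)) θ i h
  intro k ω
  set V := (iter M μ ψ φ par ω k).V i h.succ with hV
  set v := visitFeature M μ ψ φ par i h ω with hv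
  set ε := visitNoise M μ ψ φ par θ i h ω with hε
  let F : S → A → EuclideanSpace ℝ (Fin d₁) := fun x a => kernelFeature μ ψ V x a
  let E : S → A → S → ℝ := fun x a x' => (V x' - (F x a).ofLp ⬝ᵥ θ.ofLp) / H
  let U : S → A → ℝ := fun x a => invForm v k (F x a).ofLp (F x a).ofLp
  let N : S → A → ℝ := fun x a => invForm v k (F x a).ofLp (noiseSum v ε k)
  -- With the past frozen, the exponentiated increment is a function of the transition at step `h`
  -- alone, so it suffices to bound its integral under the kernel uniformly in (x, a).
  let G : S → A → S → ENNReal := fun x a x' => ENNReal.ofReal (Real.exp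
    ((2 * E x a x' * N x a + E x a x' ^ 2 * U x a - N x a ^ 2) / (1 + U x a) / 2
      - U x a / (1 + U x a) / 2))
  have hupd : ∀ e, ∀ j < k, Function.update ω k e j = ω j := fun e j hj => by
    rw [Function.update_of_ne hj.ne]
  have hG : ∀ e, ENNReal.ofReal (Real.exp (selfNormalizedIncrement
      (visitFeature M μ ψ φ par i h (Function.update ω k e))
      (visitNoise M μ ψ φ par θ i h (Function.update ω k e)) k))
      = G (e.1 h.castSucc) (e.2 h) (e.1 h.succ) := by
    intro e
    have hvk : visitFeature M μ ψ φ par i h (Function.update ω k e) k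
        = F (e.1 h.castSucc) (e.2 h) := by
      unfold visitFeature
      rw [iter_congr (hupd e), Function.update_self]
    have hεk : visitNoise M μ ψ φ par θ i h (Function.update ω k e) k
        = E (e.1 h.castSucc) (e.2 h) (e.1 h.succ) := by
      unfold visitNoise
      rw [hvk, iter_congr (hupd e), Function.update_self]
    have hlt : ∀ j < k, visitFeature M μ ψ φ par i h (Function.update ω k e) j = v j :=
      fun j hj => visitFeature_congr (fun l hl => hupd e l (hl.trans_lt hj)) i h
    have hlt' : ∀ j < k, visitNoise M μ ψ φ par θ i h (Function.update ω k e) j = ε j :=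
      fun j hj => visitNoise_congr (fun l hl => hupd e l (hl.trans_lt hj)) θ i h
    unfold selfNormalizedIncrement leverage
    rw [hvk, hεk, invForm_congr hlt, invForm_congr hlt, noiseSum_congr hlt hlt']
  have hVm : Measurable V := measurable_iter_V hR.psi hR.phi ω k i h.succ
  have hVb : ∀ x, V x ∈ Set.Icc (0 : ℝ) H :=
    iter_V_mem' hR.theta_nonneg hR.theta_le_one ω k i h.succ
  have hHpos : (0 : ℝ) < H := Nat.cast_pos.mpr hH
  have hmG : Measurable fun e : Episode S A H => G (e.1 h.castSucc) (e.2 h) (e.1 h.succ) := by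
    simp_rw [← hG]
    have hu : Measurable fun e : Episode S A H => Function.update ω k e := measurable_update ω
    exact ((hmeas k).comp hu).exp.ennreal_ofReal
  simp_rw [hG]
  refine lintegral_trajLaw_step_le H M.P M.markov _
    (isPolicy_opdop hR.psi hR.phi hR.theta_nonneg hR.theta_le_one k _) h G hmG 1 (fun x a => ?_) _
  have hPr := (M.markov h).isProbabilityMeasure (x, a)
  -- `V` is determined by the earlier episodes, so it is a fixed function here and the noise is
  -- centered.
  have hmean : (F x a).ofLp ⬝ᵥ θ.ofLp = ∫ x', V x' ∂(M.P h (x, a)) :=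
    kernelFeature_dotProduct hL (hθ x a).1 (hθ x a).2 hVm hVb
  have hVi : Integrable V (M.P h (x, a)) :=
    integrable_of_measurable_of_bounded hVm fun x => by
      rw [abs_of_nonneg (hVb x).1]; exact (hVb x).2
  have h0 : 0 ≤ ∫ x', V x' ∂(M.P h (x, a)) := integral_nonneg fun x => (hVb x).1
  have h1 : ∫ x', V x' ∂(M.P h (x, a)) ≤ H := by
    have := abs_integral_le_of_bounded (μ := M.P h (x, a)) (f := V) (C := H) fun x => by
      rw [abs_of_nonneg (hVb x).1]; exact (hVb x).2
    exact (le_abs_self _).trans this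
  refine lintegral_selfNormalized_step (ε := E x a) ((hVm.sub_const _).div_const _) (fun x' => ?_)
    ?_ (quad_nonneg _ _) _
  · simp only [E, hmean]
    rw [abs_div, abs_of_pos hHpos, div_le_one hHpos, abs_le]
    constructor <;> linarith [(hVb x').1, (hVb x').2]
  · simp only [E, hmean]
    rw [integral_div, integral_sub hVi (integrable_const _)]
    simp

/-! Optimism. -/

variable (M μ ψ φ par) in
/-- The exploration bonus of episode `n + 1` at step `h`. -/
noncomputable def totalBonus (i : Bool) (h : Fin H) (ω : ℕ → Episode S A H) (n : ℕ) (x : S)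
    (a : A) : ℝ :=
  bonus par.β par.lam (fun τ : Fin n => φ ((ω τ).1 h.castSucc) ((ω τ).2 h)) (φ x a)
    + bonus par.β par.lam (fun τ : Fin n => visitFeature M μ ψ φ par i h ω τ)
        (kernelFeature μ ψ ((iter M μ ψ φ par ω n).V i h.succ) x a)

/-- If the regression noise is controlled then the estimate is optimistic, and its error is at most
twice the bonus. -/
theorem optimism (hR : Regular ψ φ par) (hL : M.IsLinearKernel μ ψ φ d) (hH : 0 < H)
    (hlam : par.lam = 1) {h : Fin H} {θ : EuclideanSpace ℝ (Fin d₁)} (hθn : ‖θ‖ ≤ √(d₁ : ℝ))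
    (hθ : ∀ x a, (∀ x', 0 ≤ inner ℝ (ψ x a x') θ) ∧
      M.P h (x, a) = μ.withDensity fun x' => ENNReal.ofReal (inner ℝ (ψ x a x') θ))
    (i : Bool) (ω : ℕ → Episode S A H) (n : ℕ) {R : ℝ}
    (hnoise : √(invForm (visitFeature M μ ψ φ par i h ω) n
      (noiseSum (visitFeature M μ ψ φ par i h ω) (visitNoise M μ ψ φ par θ i h ω) n)
      (noiseSum (visitFeature M μ ψ φ par i h ω) (visitNoise M μ ψ φ par θ i h ω) n)) ≤ R)
    (hβ : H * R + √(d : ℝ) ≤ par.β) (x : S) (a : A) :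
    M.fn i h x a + ∫ x', (iter M μ ψ φ par ω n).V i h.succ x' ∂(M.P h (x, a))
        ≤ (iter M μ ψ φ par ω n).Q i h x a ∧
      (iter M μ ψ φ par ω n).Q i h x a
        ≤ M.fn i h x a + ∫ x', (iter M μ ψ φ par ω n).V i h.succ x' ∂(M.P h (x, a))
          + min (H : ℝ) (2 * totalBonus M μ ψ φ par i h ω n x a) := by
  set V := (iter M μ ψ φ par ω n).V i h.succ with hV
  set v := visitFeature M μ ψ φ par i h ω with hv
  set ε := visitNoise M μ ψ φ par θ i h ω with hε
  have hVm : ∀ k, Measurable ((iter M μ ψ φ par ω k).V i h.succ) := fun k =>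
    measurable_iter_V hR.psi hR.phi ω k i h.succ
  have hVb : ∀ k x, (iter M μ ψ φ par ω k).V i h.succ x ∈ Set.Icc (0 : ℝ) H := fun k =>
    iter_V_mem' hR.theta_nonneg hR.theta_le_one ω k i h.succ
  have hPr := (M.markov h).isProbabilityMeasure (x, a)
  have hHpos : (0 : ℝ) < H := Nat.cast_pos.mpr hH
  set k := kernelFeature μ ψ V x a with hk
  have hmean : k.ofLp ⬝ᵥ θ.ofLp = ∫ x', V x' ∂(M.P h (x, a)) :=
    kernelFeature_dotProduct hL (hθ x a).1 (hθ x a).2 (hVm n) (hVb n)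
  have hd1 : √(d₁ : ℝ) ≤ √(d : ℝ) := Real.sqrt_le_sqrt
    (Nat.cast_le.mpr ((le_max_left _ _).trans hL.dim_le))
  have hd2 : √(d₂ : ℝ) ≤ √(d : ℝ) := Real.sqrt_le_sqrt
    (Nat.cast_le.mpr ((le_max_right _ _).trans hL.dim_le))
  have hR0 : 0 ≤ R := (Real.sqrt_nonneg _).trans hnoise
  -- the transition part
  have herr1 : |k.ofLp ⬝ᵥ ridge 1 (fun τ : Fin n => v τ) (fun τ : Fin n =>
      (iter M μ ψ φ par ω τ).V i h.succ ((ω τ).1 h.succ)) - k.ofLp ⬝ᵥ θ.ofLp|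
      ≤ bonus par.β 1 (fun τ : Fin n => v τ) k := by
    refine (ridge_error (fun τ : Fin n => v τ) _ (fun τ : Fin n => H * ε τ) θ (fun τ => ?_)
      k.ofLp).trans ?_
    · simp only [hε, visitNoise]
      field_simp
      ring
    · unfold bonus
      rw [mul_comm]
      refine mul_le_mul_of_nonneg_right ?_ (Real.sqrt_nonneg _)
      have hS : ∑ τ : Fin n, ((H : ℝ) * ε τ) • (v τ).ofLp = (H : ℝ) • noiseSum v ε n := by
        rw [noiseSum, Finset.smul_sum]
        exact Finset.sum_congr rfl fun τ _ => by rw [smul_smul]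
      rw [hS, Matrix.mulVec_smul, dotProduct_smul, smul_dotProduct, smul_eq_mul, smul_eq_mul,
        ← mul_assoc, Real.sqrt_mul (by positivity), Real.sqrt_mul_self hHpos.le]
      have : (H : ℝ) * √(invForm v n (noiseSum v ε n) (noiseSum v ε n)) ≤ H * R :=
        mul_le_mul_of_nonneg_left hnoise hHpos.le
      unfold invForm at this
      linarith
  -- the reward part
  obtain ⟨θr, θg, hθf, hfl⟩ := hL.reward h
  obtain ⟨θf, hθfn, hfeq⟩ : ∃ θf : EuclideanSpace ℝ (Fin d₂), ‖θf‖ ≤ √(d₂ : ℝ) ∧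
      ∀ x a, M.fn i h x a = (φ x a).ofLp ⬝ᵥ θf.ofLp := by
    cases i
    · exact ⟨θg, (le_max_right _ _).trans hθf, fun x a => by
        rw [← inner_eq_dotProduct]; exact (hfl x a).2⟩
    · exact ⟨θr, (le_max_left _ _).trans hθf, fun x a => by
        rw [← inner_eq_dotProduct]; exact (hfl x a).1⟩
  set vf : Fin n → EuclideanSpace ℝ (Fin d₂) := fun τ => φ ((ω τ).1 h.castSucc) ((ω τ).2 h)
    with hvf
  have herr2 : |(φ x a).ofLp ⬝ᵥ ridge 1 vf (fun τ : Fin n =>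
      M.fn i h ((ω τ).1 h.castSucc) ((ω τ).2 h)) - (φ x a).ofLp ⬝ᵥ θf.ofLp|
      ≤ bonus par.β 1 vf (φ x a) := by
    -- Rewards and utilities are observed without noise; only the regularization bias remains.
    refine (ridge_error vf _ (fun _ => 0) θf (fun τ => ?_) _).trans ?_
    · rw [hfeq]; simp [hvf]
    · unfold bonus
      rw [mul_comm]
      refine mul_le_mul_of_nonneg_right ?_ (Real.sqrt_nonneg _)
      simp only [zero_smul, Finset.sum_const_zero, zero_dotProduct, Real.sqrt_zero, zero_add]
      have := mul_nonneg hHpos.le hR0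
      linarith
  have hQ : (iter M μ ψ φ par ω n).Q i h x a = max (min ((φ x a).ofLp ⬝ᵥ ridge 1 vf (fun τ : Fin n =>
      M.fn i h ((ω τ).1 h.castSucc) ((ω τ).2 h)) + k.ofLp ⬝ᵥ ridge 1 (fun τ : Fin n => v τ)
      (fun τ : Fin n => (iter M μ ψ φ par ω τ).V i h.succ ((ω τ).1 h.succ))
      + totalBonus M μ ψ φ par i h ω n x a) ((H : ℝ) - (h : ℕ))) 0 := by
    rw [iter_Q]
    unfold qEstimate totalBonus
    rw [hlam]
    rfl
  have htb : totalBonus M μ ψ φ par i h ω n x a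
      = bonus par.β 1 vf (φ x a) + bonus par.β 1 (fun τ : Fin n => v τ) k := by
    rw [totalBonus, hlam]
  have hf := M.fn_mem i h x a
  -- The sharp range of the next value function makes the backup at most 1 + (H - h - 1), so
  -- truncating Q at H - h preserves optimism.
  have hVb' : ∀ x, V x ∈ Set.Icc (0 : ℝ) ((H : ℝ) - (h : ℕ) - 1) := fun x => by
    have := iter_V_mem (M := M) (μ := μ) (ψ := ψ) (φ := φ) hR.theta_nonneg hR.theta_le_one ω n i
      h.succ x
    simp only [Fin.val_succ, Nat.cast_add, Nat.cast_one] at this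
    exact ⟨this.1, by linarith [this.2]⟩
  have h0 : 0 ≤ ∫ x', V x' ∂(M.P h (x, a)) := integral_nonneg fun x => (hVb' x).1
  have h1 : ∫ x', V x' ∂(M.P h (x, a)) ≤ (H : ℝ) - (h : ℕ) - 1 := by
    have := abs_integral_le_of_bounded (μ := M.P h (x, a)) (f := V) fun x => by
      rw [abs_of_nonneg (hVb' x).1]; exact (hVb' x).2
    exact (le_abs_self _).trans this
  rw [hmean] at herr1
  rw [← hfeq] at herr2
  obtain ⟨l1, u1⟩ := abs_le.mp herr1
  obtain ⟨l2, u2⟩ := abs_le.mp herr2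
  rw [hQ, htb]
  have hh : (0 : ℝ) ≤ (h : ℕ) := Nat.cast_nonneg _
  constructor
  · exact le_max_of_le_left (le_min (by linarith) (by linarith [hf.2]))
  · refine max_le ?_ ?_
    · rw [← min_add_add_left]
      refine le_min ((min_le_right _ _).trans ?_) ((min_le_left _ _).trans ?_)
      · linarith [hf.1]
      · linarith
    · have : 0 ≤ min (H : ℝ) (2 * (bonus par.β 1 vf (φ x a)
          + bonus par.β 1 (fun τ : Fin n => v τ) k)) := by
        refine le_min hHpos.le ?_
        linarith
      linarith [hf.1]

end Regression

/-! ### Concentration of the bonuses -/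

section BonusConcentration

variable {S A : Type*} [MeasurableSpace S] [MeasurableSpace A] [Fintype A]
  [DiscreteMeasurableSpace A] {H d₁ d₂ : ℕ} {M : CMDP S A H} {μ : Measure S} [SFinite μ]
  [Nonempty A]
  {ψ : S → A → S → EuclideanSpace ℝ (Fin d₁)} {φ : S → A → EuclideanSpace ℝ (Fin d₂)}
  {par : Params}

lemma bonus_nonneg {n m : ℕ} {β : ℝ} (hβ : 0 ≤ β) (lam : ℝ)
    (v : Fin n → EuclideanSpace ℝ (Fin m)) (u : EuclideanSpace ℝ (Fin m)) :
    0 ≤ bonus β lam v u := mul_nonneg hβ (Real.sqrt_nonneg _)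

lemma totalBonus_nonneg (hβ : 0 ≤ par.β) (i : Bool) (h : Fin H) (ω : ℕ → Episode S A H) (n : ℕ)
    (x : S) (a : A) : 0 ≤ totalBonus M μ ψ φ par i h ω n x a :=
  add_nonneg (bonus_nonneg hβ _ _ _) (bonus_nonneg hβ _ _ _)

variable (M μ ψ φ par) in
/-- The bound for the error of the estimated action-value function. -/
noncomputable def errorBound (i : Bool) (ω : ℕ → Episode S A H) (n : ℕ) (h : Fin H) (x : S)
    (a : A) : ℝ := min (H : ℝ) (2 * totalBonus M μ ψ φ par i h ω n x a)

lemma errorBound_nonneg (hβ : 0 ≤ par.β) (i : Bool) (ω : ℕ → Episode S A H) (n : ℕ) (h : Fin H)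
    (x : S) (a : A) : 0 ≤ errorBound M μ ψ φ par i ω n h x a :=
  le_min (Nat.cast_nonneg H) (mul_nonneg zero_le_two (totalBonus_nonneg hβ i h ω n x a))

lemma measurable_errorBound_run (hR : Regular ψ φ par) (i : Bool) (n : ℕ) (h : Fin H) (a : A) :
    Measurable fun z : (ℕ → Episode S A H) × S => errorBound M μ ψ φ par i z.1 n h z.2 a := by
  have hv : ∀ τ : ℕ, Measurable fun z : (ℕ → Episode S A H) × S =>
      visitFeature M μ ψ φ par i h z.1 τ := fun τ =>
    (measurable_visitFeature hR i h τ).comp measurable_fst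
  have hf : ∀ τ : ℕ, Measurable fun z : (ℕ → Episode S A H) × S =>
      φ ((z.1 τ).1 h.castSucc) ((z.1 τ).2 h) := fun τ =>
    (measurable_uncurry_of_forall hR.phi).comp
      (((measurable_run_state τ _).comp measurable_fst).prodMk
        ((measurable_run_action τ _).comp measurable_fst))
  have hk : Measurable fun z : (ℕ → Episode S A H) × S =>
      kernelFeature μ ψ ((iter M μ ψ φ par z.1 n).V i h.succ) z.2 a :=
    measurable_kernelFeature μ hR.psi (V := fun z : (ℕ → Episode S A H) × S =>
      (iter M μ ψ φ par z.1 n).V i h.succ)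
      (((measurableIterate_iter_run hR n).V i h.succ).comp
        ((measurable_fst.comp measurable_fst).prodMk measurable_snd))
      measurable_snd measurable_const
  exact measurable_const.min (((measurable_bonus _ _ (fun τ : Fin n => hf τ)
    ((hR.phi a).comp measurable_snd)).add (measurable_bonus _ _ (fun τ : Fin n => hv τ)
      hk)).const_mul 2)

lemma isCost_errorBound (hR : Regular ψ φ par) (hβ : 0 ≤ par.β) (i : Bool)
    (ω : ℕ → Episode S A H) (n : ℕ) : IsCost (errorBound M μ ψ φ par i ω n) :=
  ⟨fun h a => Measurable.comp (g := fun z : (ℕ → Episode S A H) × S =>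
    errorBound M μ ψ φ par i z.1 n h z.2 a) (f := Prod.mk ω)
      (measurable_errorBound_run hR i n h a) measurable_prodMk_left, H,
    fun h x a => by
      rw [abs_of_nonneg (errorBound_nonneg hβ i ω n h x a)]; exact min_le_left _ _⟩

lemma errorBound_congr {ω ω' : ℕ → Episode S A H} {n : ℕ} (h : ∀ j < n, ω j = ω' j) (i : Bool) :
    errorBound M μ ψ φ par i ω n = errorBound M μ ψ φ par i ω' n := by
  funext s x a
  have e₁ : (fun τ : Fin n => visitFeature M μ ψ φ par i s ω τ)
      = fun τ : Fin n => visitFeature M μ ψ φ par i s ω' τ :=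
    funext fun τ => visitFeature_congr (fun j hj => h j (hj.trans_lt τ.2)) i s
  have e₂ : (fun τ : Fin n => φ ((ω τ).1 s.castSucc) ((ω τ).2 s))
      = fun τ : Fin n => φ ((ω' τ).1 s.castSucc) ((ω' τ).2 s) := funext fun τ => by rw [h τ τ.2]
  have e₃ : iter M μ ψ φ par ω n = iter M μ ψ φ par ω' n := iter_congr h
  exact congrArg (fun t => min (H : ℝ) (2 * t)) (congrArg₂ (· + ·)
    (congrArg (fun v => bonus par.β par.lam v (φ x a)) e₂)
    (congrArg₂ (bonus par.β par.lam) e₁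
      (congrArg (fun I : Iterate S A H => kernelFeature μ ψ (I.V i s.succ) x a) e₃)))

/-- From exp(-x) ≤ 1 - x/2 on [0, 1], the mean of exp(-X) is at most 1 - E/2 ≤ exp(-E/2). The factor
1/2 in front of the mean buys a deviation of order log(1/δ) without a square root of the number of
terms. -/
lemma lintegral_exp_le_one_of_mem_Icc {Ω : Type*} [MeasurableSpace Ω] {ν : Measure Ω}
    [IsProbabilityMeasure ν] {X : Ω → ℝ} (hX : Measurable X) (h0 : ∀ ω, 0 ≤ X ω)
    (h1 : ∀ ω, X ω ≤ 1) :
    ∫⁻ ω, ENNReal.ofReal (Real.exp ((∫ ω', X ω' ∂ν) / 2 - X ω)) ∂ν ≤ 1 := by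
  set E := ∫ ω', X ω' ∂ν with hE
  have hXi : Integrable X ν := integrable_of_measurable_of_bounded hX (C := 1) fun ω => by
    rw [abs_of_nonneg (h0 ω)]; exact h1 ω
  have h := lintegral_ofReal_le_of_le (ν := ν) (f := fun ω => Real.exp (E / 2) * (1 - X ω / 2))
    (((integrable_const _).sub (hXi.div_const 2)).const_mul _) (c := 1)
    (fun ω => mul_nonneg (Real.exp_pos _).le (by linarith [h1 ω])) (by
      rw [integral_const_mul, integral_sub (integrable_const _) (hXi.div_const 2), integral_div,
        ← hE]
      have h2 := Real.add_one_le_exp (-(E / 2))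
      have h3 : Real.exp (E / 2) * Real.exp (-(E / 2)) = 1 := by rw [← Real.exp_add]; simp
      simp only [integral_const, probReal_univ, smul_eq_mul, one_mul]
      nlinarith [Real.exp_pos (E / 2)])
    (g := fun ω => Real.exp (E / 2 - X ω)) fun ω => by
      rw [sub_eq_add_neg, Real.exp_add]
      exact mul_le_mul_of_nonneg_left (exp_neg_le_one_sub_half (h0 ω) (h1 ω)) (Real.exp_pos _).le
  simpa using h

variable (M μ ψ φ par) in
/-- The expected minus the realized error bounds of an episode, normalized. -/
noncomputable def errorIncrement (i : Bool) (k : ℕ) (ω : ℕ → Episode S A H) : ℝ :=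
  (∫ e, e.cost (errorBound M μ ψ φ par i ω k) / (H : ℝ) ^ 2
      ∂(episodeLaw M μ ψ φ par k (hist ω k))) / 2
    - (ω k).cost (errorBound M μ ψ φ par i ω k) / (H : ℝ) ^ 2

lemma measurable_cost_errorBound_run (hR : Regular ψ φ par) (i : Bool) (k : ℕ) :
    Measurable fun z : (ℕ → Episode S A H) × Episode S A H =>
      z.2.cost (errorBound M μ ψ φ par i z.1 k) := by
  unfold Episode.cost
  refine Finset.measurable_sum _ fun h _ => ?_
  have hg : Measurable fun z : ((ℕ → Episode S A H) × S) × A =>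
      errorBound M μ ψ φ par i z.1.1 k h z.1.2 z.2 :=
    measurable_uncurry_of_forall (f := fun (z : (ℕ → Episode S A H) × S) a =>
      errorBound M μ ψ φ par i z.1 k h z.2 a) (measurable_errorBound_run hR i k h)
  have hf : Measurable fun z : (ℕ → Episode S A H) × Episode S A H =>
      ((z.1, z.2.1 h.castSucc), z.2.2 h) :=
    (measurable_fst.prodMk ((measurable_pi_apply _).comp
      (measurable_fst.comp measurable_snd))).prodMk
        ((measurable_pi_apply _).comp (measurable_snd.comp measurable_snd))
  simpa only [Function.comp_def] using hg.comp hf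

lemma measurable_errorIncrement (hR : Regular ψ φ par) (i : Bool) (k : ℕ) :
    Measurable (errorIncrement M μ ψ φ par i k) := by
  have hjoint := (measurable_cost_errorBound_run (M := M) (μ := μ) hR i k).div_const ((H : ℝ) ^ 2)
  let κ : Kernel (ℕ → Episode S A H) (Episode S A H) :=
    ⟨fun ω => episodeLaw M μ ψ φ par k (hist ω k),
      (measurable_episodeLaw hR k).comp (measurable_hist k)⟩
  have hκ : IsMarkovKernel κ := ⟨fun ω => isProbabilityMeasure_episodeLaw hR k _⟩
  have h1 : Measurable fun ω => ∫ e, e.cost (errorBound M μ ψ φ par i ω k) / (H : ℝ) ^ 2 ∂(κ ω) :=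
    (hjoint.stronglyMeasurable.integral_kernel_prod_right' (κ := κ)).measurable
  have h2 : Measurable fun ω : ℕ → Episode S A H =>
      (ω k).cost (errorBound M μ ψ φ par i ω k) / (H : ℝ) ^ 2 :=
    Measurable.comp (g := fun z : (ℕ → Episode S A H) × Episode S A H =>
      z.2.cost (errorBound M μ ψ φ par i z.1 k) / (H : ℝ) ^ 2) (f := fun ω => (ω, ω k)) hjoint
        (measurable_id.prodMk (measurable_pi_apply k))
  exact (h1.div_const 2).sub h2

lemma errorIncrement_congr (i : Bool) {k : ℕ} {ω ω' : ℕ → Episode S A H}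
    (h : ∀ j ≤ k, ω j = ω' j) :
    errorIncrement M μ ψ φ par i k ω = errorIncrement M μ ψ φ par i k ω' := by
  have h1 : hist ω k = hist ω' k := funext fun j => h j j.2.le
  have h2 := errorBound_congr (M := M) (μ := μ) (ψ := ψ) (φ := φ) (par := par)
    (fun j (hj : j < k) => h j hj.le) i
  unfold errorIncrement
  rw [h1, h2, h k le_rfl]

lemma lintegral_errorIncrement_le (hR : Regular ψ φ par) (hβ : 0 ≤ par.β) (hH : 0 < H) (i : Bool)
    (k : ℕ) (ω : ℕ → Episode S A H) :
    ∫⁻ e, ENNReal.ofReal (Real.exp (errorIncrement M μ ψ φ par i k (Function.update ω k e)))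
      ∂(episodeLaw M μ ψ φ par k (hist ω k)) ≤ 1 := by
  have hHpos : (0 : ℝ) < H := Nat.cast_pos.mpr hH
  have hupd : ∀ e, ∀ j < k, Function.update ω k e j = ω j := fun e j hj => by
    rw [Function.update_of_ne hj.ne]
  have := isProbabilityMeasure_episodeLaw (M := M) (μ := μ) hR k (hist ω k)
  have hc := isCost_errorBound (M := M) (μ := μ) hR hβ i ω k
  have hX : Measurable fun e : Episode S A H =>
      e.cost (errorBound M μ ψ φ par i ω k) / (H : ℝ) ^ 2 :=
    (measurable_cost hc.measurable).div_const _
  have key := lintegral_exp_le_one_of_mem_Icc (ν := episodeLaw M μ ψ φ par k (hist ω k)) hX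
    (fun e => div_nonneg (Finset.sum_nonneg fun h _ => errorBound_nonneg hβ i ω k h _ _)
      (by positivity)) (fun e => by
      rw [div_le_one (by positivity), pow_two]
      refine (le_abs_self _).trans (Episode.abs_cost_le (C := H) (fun h x a => ?_) e)
      rw [abs_of_nonneg (errorBound_nonneg hβ i ω k h x a)]
      exact min_le_left _ _)
  refine le_trans (le_of_eq (lintegral_congr fun e => ?_)) key
  have h1 : hist (Function.update ω k e) k = hist ω k := funext fun j => hupd e j j.2
  have h2 := errorBound_congr (M := M) (μ := μ) (ψ := ψ) (φ := φ) (par := par) (hupd e) i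
  unfold errorIncrement
  rw [h1, h2, Function.update_self]

/-- With high probability the expected error bounds are dominated by the realized ones. -/
theorem runLaw_errorBound (hR : Regular ψ φ par) (hβ : 0 ≤ par.β) (hH : 0 < H) (i : Bool)
    (e₀ : Episode S A H) (K : ℕ) {δ : ℝ} (hδ : 0 < δ) :
    runLaw M μ ψ φ par K {D | Real.log (1 / δ) ≤ ∑ k ∈ Finset.range K,
      errorIncrement M μ ψ φ par i k (extend e₀ D)} ≤ ENNReal.ofReal δ :=
  runLaw_adapted_deviation hR (measurable_errorIncrement hR i)
    (fun _ _ _ h => errorIncrement_congr i h) (lintegral_errorIncrement_le hR hβ hH i) e₀ le_rfl hδ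

lemma sum_errorIncrement (i : Bool) (ω : ℕ → Episode S A H) (K : ℕ) :
    ∑ k ∈ Finset.range K, errorIncrement M μ ψ φ par i k ω = ((∑ k ∈ Finset.range K,
        trajValue H M.P (iter M μ ψ φ par ω k).pol (errorBound M μ ψ φ par i ω k) M.x₁) / 2
      - ∑ k ∈ Finset.range K, (ω k).cost (errorBound M μ ψ φ par i ω k)) / (H : ℝ) ^ 2 := by
  rw [Finset.sum_div, ← Finset.sum_sub_distrib, Finset.sum_div]
  refine Finset.sum_congr rfl fun k _ => ?_
  unfold errorIncrement
  rw [integral_div]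
  unfold trajValue episodeLaw iter
  ring

/-! The sum of the realized bonuses. -/

/-- The cap at 1 turns the leverage into the quantity u/(1 + u) that the elliptical potential
controls, with no upper bound on u. -/
lemma sqrt_capped_le {u : ℝ} (hu : 0 ≤ u) : (min 1 √u) ^ 2 ≤ 2 * (u / (1 + u)) := by
  have h1 : 0 < 1 + u := by linarith
  rw [← mul_div_assoc, le_div_iff₀ h1]
  rcases le_total u 1 with h | h
  · rw [min_eq_right (Real.sqrt_le_one.mpr h), Real.sq_sqrt hu]
    nlinarith
  · rw [min_eq_left (Real.one_le_sqrt.mpr h)]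
    linarith

/-- Cauchy-Schwarz over the episodes; this is where the factor √K of the exploration cost arises. -/
lemma sum_min_one_sqrt_leverage_le {m : ℕ} (v : ℕ → EuclideanSpace ℝ (Fin m)) (K : ℕ) {W : ℝ}
    (hW : ∑ k ∈ Finset.range K, leverage v k / (1 + leverage v k) ≤ W) :
    ∑ k ∈ Finset.range K, min 1 √(leverage v k) ≤ √(K * (2 * W)) := by
  refine Real.le_sqrt_of_sq_le ?_
  refine (sq_sum_le_card_mul_sum_sq).trans ?_
  rw [Finset.card_range]
  refine mul_le_mul_of_nonneg_left ?_ (Nat.cast_nonneg K)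
  calc _ ≤ ∑ k ∈ Finset.range K, 2 * (leverage v k / (1 + leverage v k)) :=
        Finset.sum_le_sum fun k _ => sqrt_capped_le (leverage_nonneg v k)
    _ ≤ _ := by rw [← Finset.mul_sum]; linarith

/-- Moves the cap from the whole bonus to each of its two parts: if either part reaches 1, the
right-hand side is already at least 2β ≥ c. -/
lemma min_le_capped {c β s t : ℝ} (hc : c ≤ 2 * β) (hβ : 0 ≤ β) (hs : 0 ≤ s) (ht : 0 ≤ t) :
    min c (2 * (β * s + β * t)) ≤ 2 * β * (min 1 s + min 1 t) := by
  rcases le_total 1 s with h1 | h1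
  · rw [min_eq_left h1]
    have : 0 ≤ min 1 t := le_min zero_le_one ht
    exact (min_le_left _ _).trans (by nlinarith)
  rcases le_total 1 t with h2 | h2
  · rw [min_eq_left h2]
    have : 0 ≤ min 1 s := le_min zero_le_one hs
    exact (min_le_left _ _).trans (by nlinarith)
  rw [min_eq_right h1, min_eq_right h2]
  exact (min_le_right _ _).trans (by linarith)

/-- The sum of the realized error bounds, given elliptical potential bounds. -/
theorem sum_cost_errorBound_le (hlam : par.lam = 1) (hβ : 0 ≤ par.β) (hHβ : (H : ℝ) ≤ 2 * par.β)
    (i : Bool) (ω : ℕ → Episode S A H) (K : ℕ) {W : ℝ}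
    (hW₁ : ∀ h, ∑ k ∈ Finset.range K, leverage (visitFeature M μ ψ φ par i h ω) k
      / (1 + leverage (visitFeature M μ ψ φ par i h ω) k) ≤ W)
    (hW₂ : ∀ h : Fin H, ∑ k ∈ Finset.range K,
      leverage (fun k => φ ((ω k).1 h.castSucc) ((ω k).2 h)) k
      / (1 + leverage (fun k => φ ((ω k).1 h.castSucc) ((ω k).2 h)) k) ≤ W) :
    ∑ k ∈ Finset.range K, (ω k).cost (errorBound M μ ψ φ par i ω k)
      ≤ H * (4 * par.β * √(K * (2 * W))) := by
  unfold Episode.cost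
  rw [Finset.sum_comm]
  calc _ ≤ ∑ _h : Fin H, 4 * par.β * √(K * (2 * W)) := Finset.sum_le_sum fun h _ => ?_
    _ = _ := by simp
  have hterm : ∀ k, errorBound M μ ψ φ par i ω k h ((ω k).1 h.castSucc) ((ω k).2 h)
      ≤ 2 * par.β * (min 1 √(leverage (fun k => φ ((ω k).1 h.castSucc) ((ω k).2 h)) k)
        + min 1 √(leverage (visitFeature M μ ψ φ par i h ω) k)) := by
    intro k
    unfold errorBound totalBonus bonus
    rw [hlam]
    exact min_le_capped hHβ hβ (Real.sqrt_nonneg _) (Real.sqrt_nonneg _)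
  refine (Finset.sum_le_sum fun k _ => hterm k).trans ?_
  rw [← Finset.mul_sum, Finset.sum_add_distrib]
  have h1 := sum_min_one_sqrt_leverage_le _ K (hW₁ h)
  have h2 := sum_min_one_sqrt_leverage_le _ K (hW₂ h)
  nlinarith

end BonusConcentration

/-! ### Mirror descent and the dual update -/

section MirrorDescent

variable {A : Type*} [Fintype A]

/-- Hoeffding's lemma for the finite distribution `m`: after centering `q` at its mean, the linear
term of the chord sums to zero. -/
lemma log_sum_exp_le {m q : A → ℝ} (hm : ∀ a, 0 ≤ m a) (hs : ∑ a, m a = 1) {α Q : ℝ}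
    (hα : 0 < α) (hQ : 0 < Q) (hq : ∀ a, q a ∈ Set.Icc 0 Q) (hZ : 0 < ∑ a, m a * Real.exp (α * q a)) :
    Real.log (∑ a, m a * Real.exp (α * q a)) ≤ α * ∑ a, m a * q a + (α * Q) ^ 2 / 2 := by
  set e := ∑ a, m a * q a with he
  have he0 : 0 ≤ e := Finset.sum_nonneg fun a _ => mul_nonneg (hm a) (hq a).1
  have heQ : e ≤ Q := by
    calc e ≤ ∑ a, m a * Q := Finset.sum_le_sum fun a _ => mul_le_mul_of_nonneg_left (hq a).2 (hm a)
      _ = Q := by rw [← Finset.sum_mul, hs, one_mul]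
  have hc : 0 < α * Q := mul_pos hα hQ
  rw [Real.log_le_iff_le_exp hZ, Real.exp_add]
  have hterm : ∀ a, m a * Real.exp (α * q a) ≤ Real.exp (α * e) *
      (m a * Real.exp ((α * Q) ^ 2 / 2)
        + (Real.sinh (α * Q) / (α * Q)) * (α * (m a * q a) - α * e * m a)) := by
    intro a
    have h1 : |α * (q a - e)| ≤ α * Q := by
      rw [abs_mul, abs_of_pos hα]
      refine mul_le_mul_of_nonneg_left (abs_le.mpr ⟨?_, ?_⟩) hα.le <;>
        linarith [(hq a).1, (hq a).2]
    have h2 := exp_le_hoeffding hc h1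
    have h3 : Real.exp (α * q a) = Real.exp (α * e) * Real.exp (α * (q a - e)) := by
      rw [← Real.exp_add]; congr 1; ring
    rw [h3]
    calc _ = Real.exp (α * e) * (m a * Real.exp (α * (q a - e))) := by ring
      _ ≤ Real.exp (α * e) * (m a * (Real.exp ((α * Q) ^ 2 / 2)
          + α * (q a - e) * (Real.sinh (α * Q) / (α * Q)))) := by
        gcongr
        exact hm a
      _ = _ := by ring
  refine (Finset.sum_le_sum fun a _ => hterm a).trans (le_of_eq ?_)
  rw [← Finset.mul_sum, Finset.sum_add_distrib, ← Finset.sum_mul, ← Finset.mul_sum,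
    Finset.sum_sub_distrib, ← Finset.mul_sum, ← Finset.mul_sum, hs, ← he]
  ring

/-- The regret of exponentiated gradient ascent with uniform mixing. -/
theorem mirror_descent_regret [Nonempty A] {p q : ℕ → A → ℝ} {θ α Q : ℝ} (hθ0 : 0 ≤ θ)
    (hθ1 : θ < 1) (hα : 0 < α) (hQ : 0 < Q) (hq : ∀ k a, q k a ∈ Set.Icc 0 Q)
    (hp0 : ∀ a, p 0 a = 1 / Fintype.card A)
    (hstep : ∀ k a, p (k + 1) a = ((1 - θ) * p k a + θ / Fintype.card A) * Real.exp (α * q k a)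
      / ∑ a', ((1 - θ) * p k a' + θ / Fintype.card A) * Real.exp (α * q k a'))
    (hsum : ∀ k, ∑ a, p k a = 1) {π : A → ℝ} (hπ : ∀ a, 0 ≤ π a) (hπs : ∑ a, π a = 1) (K : ℕ) :
    α * ∑ k ∈ Finset.range K, ∑ a, q k a * (π a - p k a) ≤ Real.log (Fintype.card A)
      + K * (-Real.log (1 - θ) + α * (θ * Q) + (α * Q) ^ 2 / 2) := by
  have hcard : (0 : ℝ) < Fintype.card A := Nat.cast_pos.mpr Fintype.card_pos
  have h1θ : 0 < 1 - θ := by linarith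
  have hmpos : ∀ k, (∀ a, 0 < p k a) → ∀ a, 0 < (1 - θ) * p k a + θ / Fintype.card A :=
    fun k hk a => add_pos_of_pos_of_nonneg (mul_pos h1θ (hk a)) (by positivity)
  have hpos : ∀ k a, 0 < p k a := by
    intro k
    induction k with
    | zero => intro a; rw [hp0]; positivity
    | succ k ih =>
      intro a
      rw [hstep]
      exact div_pos (mul_pos (hmpos k ih a) (Real.exp_pos _))
        (Finset.sum_pos (fun a _ => mul_pos (hmpos k ih a) (Real.exp_pos _)) Finset.univ_nonempty)
  -- The potential ∑ π log p_k is minus the relative entropy of π to p_k, up to a constant; it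
  -- telescopes from -log|A| to a nonpositive value.
  have hone : ∀ k, α * ∑ a, q k a * (π a - p k a) ≤ ∑ a, π a * Real.log (p (k + 1) a)
      - ∑ a, π a * Real.log (p k a) + (-Real.log (1 - θ) + α * (θ * Q) + (α * Q) ^ 2 / 2) := by
    intro k
    set m : A → ℝ := fun a => (1 - θ) * p k a + θ / Fintype.card A with hm
    have hmp : ∀ a, 0 < m a := hmpos k (hpos k)
    have hms : ∑ a, m a = 1 := by
      simp only [hm, Finset.sum_add_distrib, ← Finset.mul_sum, hsum, Finset.sum_const,
        Finset.card_univ, nsmul_eq_mul]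
      field_simp
      ring
    set Z := ∑ a, m a * Real.exp (α * q k a) with hZ
    have hZpos : 0 < Z :=
      Finset.sum_pos (fun a _ => mul_pos (hmp a) (Real.exp_pos _)) Finset.univ_nonempty
    have hlogZ := log_sum_exp_le (fun a => (hmp a).le) hms hα hQ (hq k) hZpos
    -- Mixing enters twice: it shifts the average payoff by at most θQ here, and the bound m ≥ (1 -
    -- θ)p costs -log(1 - θ) below.
    have hqm : ∑ a, m a * q k a ≤ ∑ a, q k a * p k a + θ * Q := by
      have hnn : 0 ≤ ∑ a, q k a * p k a :=
        Finset.sum_nonneg fun a _ => mul_nonneg (hq k a).1 (hpos k a).le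
      have h1 : ∑ a, m a * q k a = (1 - θ) * ∑ a, q k a * p k a
          + θ / Fintype.card A * ∑ a, q k a := by
        rw [Finset.mul_sum, Finset.mul_sum, ← Finset.sum_add_distrib]
        exact Finset.sum_congr rfl fun a _ => by simp only [hm]; ring
      have h2 : ∑ a, q k a ≤ Fintype.card A * Q := by
        refine (Finset.sum_le_sum fun a _ => (hq k a).2).trans (by simp)
      have h3 : θ / Fintype.card A * ∑ a, q k a ≤ θ * Q := by
        calc _ ≤ θ / Fintype.card A * (Fintype.card A * Q) :=
              mul_le_mul_of_nonneg_left h2 (by positivity)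
          _ = θ * Q := by field_simp
      rw [h1]
      nlinarith
    have hlog : ∀ a, Real.log (1 - θ) + Real.log (p k a) + α * q k a - Real.log Z
        ≤ Real.log (p (k + 1) a) := by
      intro a
      have e1 : p (k + 1) a = m a * Real.exp (α * q k a) / Z := hstep k a
      rw [e1, Real.log_div (mul_pos (hmp a) (Real.exp_pos _)).ne' hZpos.ne',
        Real.log_mul (hmp a).ne' (Real.exp_pos _).ne', Real.log_exp]
      have : Real.log ((1 - θ) * p k a) ≤ Real.log (m a) :=
        Real.log_le_log (mul_pos h1θ (hpos k a)) (le_add_of_nonneg_right (by positivity))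
      rw [Real.log_mul h1θ.ne' (hpos k a).ne'] at this
      linarith
    have hsumlog : Real.log (1 - θ) + ∑ a, π a * Real.log (p k a) + α * ∑ a, q k a * π a
        - Real.log Z ≤ ∑ a, π a * Real.log (p (k + 1) a) := by
      have h := Finset.sum_le_sum fun a (_ : a ∈ Finset.univ) =>
        mul_le_mul_of_nonneg_left (hlog a) (hπ a)
      have e : ∑ a, π a * (Real.log (1 - θ) + Real.log (p k a) + α * q k a - Real.log Z)
          = (∑ a, π a) * Real.log (1 - θ) + ∑ a, π a * Real.log (p k a)
            + α * ∑ a, q k a * π a - (∑ a, π a) * Real.log Z := by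
        rw [Finset.sum_mul, Finset.sum_mul, Finset.mul_sum, ← Finset.sum_add_distrib,
          ← Finset.sum_add_distrib, ← Finset.sum_sub_distrib]
        exact Finset.sum_congr rfl fun a _ => by ring
      rw [e, hπs] at h
      linarith
    have e2 : ∑ a, q k a * (π a - p k a) = ∑ a, q k a * π a - ∑ a, q k a * p k a := by
      rw [← Finset.sum_sub_distrib]
      exact Finset.sum_congr rfl fun a _ => by ring
    rw [e2]
    have := mul_le_mul_of_nonneg_left hqm hα.le
    nlinarith
  rw [Finset.mul_sum]
  refine (Finset.sum_le_sum fun k _ => hone k).trans ?_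
  rw [Finset.sum_add_distrib, Finset.sum_range_sub (fun k => ∑ a, π a * Real.log (p k a))]
  have h0 : ∑ a, π a * Real.log (p 0 a) = -Real.log (Fintype.card A) := by
    simp only [hp0, one_div, Real.log_inv, ← Finset.sum_mul, hπs, one_mul]
  have hK : ∑ a, π a * Real.log (p K a) ≤ 0 :=
    Finset.sum_nonpos fun a _ => mul_nonpos_of_nonneg_of_nonpos (hπ a)
      (Real.log_nonpos (hpos K a).le (by
        rw [← hsum K]
        exact Finset.single_le_sum (fun a _ => (hpos K a).le) (Finset.mem_univ a)))
  rw [h0]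
  simp only [Finset.sum_const, Finset.card_range, nsmul_eq_mul]
  linarith

/-- The regret of projected gradient ascent on `[0, χ]`. -/
theorem dual_regret {Y s : ℕ → ℝ} {χ η G : ℝ} (hη : 0 < η) (hY0 : Y 0 = 0)
    (hY : ∀ k, Y (k + 1) = max 0 (min χ (Y k + η * s k))) (hs : ∀ k, |s k| ≤ G) {y : ℝ}
    (hy : y ∈ Set.Icc 0 χ) (K : ℕ) :
    y * ∑ k ∈ Finset.range K, s k ≤ ∑ k ∈ Finset.range K, Y k * s k + y ^ 2 / (2 * η)
      + K * (η * G ^ 2 / 2) := by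
  have hstep : ∀ k, (Y (k + 1) - y) ^ 2 ≤ (Y k - y) ^ 2 + 2 * η * (Y k - y) * s k
      + η ^ 2 * G ^ 2 := by
    intro k
    -- Projection onto [0, χ] does not increase the distance to a point of that interval.
    have h1 : (Y (k + 1) - y) ^ 2 ≤ (Y k + η * s k - y) ^ 2 := by
      rw [hY, sq_le_sq]
      set z := Y k + η * s k
      rcases le_total z 0 with h | h
      · rw [max_eq_left ((min_le_right _ _).trans h), abs_of_nonpos (by linarith [hy.1]),
          abs_of_nonpos (by linarith [hy.1])]
        linarith
      · rcases le_total χ z with h' | h'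
        · rw [min_eq_left h', max_eq_right (hy.1.trans hy.2), abs_of_nonneg (by linarith [hy.2]),
            abs_of_nonneg (by linarith [hy.2])]
          linarith
        · rw [min_eq_right h', max_eq_right h]
    have h2 : s k ^ 2 ≤ G ^ 2 := sq_le_sq' (abs_le.mp (hs k)).1 (abs_le.mp (hs k)).2
    nlinarith [mul_le_mul_of_nonneg_left h2 (sq_nonneg η)]
  have hsum : ∀ n, (Y n - y) ^ 2 ≤ y ^ 2 + ∑ k ∈ Finset.range n, (2 * η * (Y k - y) * s k
      + η ^ 2 * G ^ 2) := by
    intro n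
    induction n with
    | zero => simp [hY0]
    | succ n ih => rw [Finset.sum_range_succ]; linarith [hstep n]
  have h := (sq_nonneg _).trans (hsum K)
  have e : ∑ k ∈ Finset.range K, (2 * η * (Y k - y) * s k + η ^ 2 * G ^ 2)
      = 2 * η * (∑ k ∈ Finset.range K, Y k * s k - y * ∑ k ∈ Finset.range K, s k)
        + K * (η ^ 2 * G ^ 2) := by
    rw [Finset.sum_add_distrib, Finset.mul_sum, ← Finset.sum_sub_distrib, Finset.mul_sum]
    simp only [Finset.sum_const, Finset.card_range, nsmul_eq_mul]
    congr 1
    exact Finset.sum_congr rfl fun k _ => by ring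
  rw [e] at h
  have h2 : y * ∑ k ∈ Finset.range K, s k - ∑ k ∈ Finset.range K, Y k * s k
      ≤ (y ^ 2 + K * (η ^ 2 * G ^ 2)) / (2 * η) := by
    rw [le_div_iff₀ (by positivity)]
    linarith
  have e3 : (y ^ 2 + K * (η ^ 2 * G ^ 2)) / (2 * η) = y ^ 2 / (2 * η) + K * (η * G ^ 2 / 2) := by
    field_simp
  linarith

end MirrorDescent

/-! ### Regret of the Lagrangian along an optimistic run -/

section PrimalDual

variable {S A : Type*} [MeasurableSpace S] [MeasurableSpace A] [Fintype A]
  [DiscreteMeasurableSpace A] {H d₁ d₂ : ℕ} {M : CMDP S A H} {μ : Measure S} [SFinite μ]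
  [Nonempty A]
  {ψ : S → A → S → EuclideanSpace ℝ (Fin d₁)} {φ : S → A → EuclideanSpace ℝ (Fin d₂)}
  {par : Params}

variable (M μ ψ φ par) in
/-- The estimates of the first `K` episodes are optimistic with the error bound `errorBound`. -/
def OptimisticRun (ω : ℕ → Episode S A H) (K : ℕ) : Prop :=
  ∀ n < K, ∀ i h x a,
    M.fn i h x a + ∫ x', (iter M μ ψ φ par ω n).V i h.succ x' ∂(M.P h (x, a))
        ≤ (iter M μ ψ φ par ω n).Q i h x a ∧
      (iter M μ ψ φ par ω n).Q i h x a
        ≤ M.fn i h x a + ∫ x', (iter M μ ψ φ par ω n).V i h.succ x' ∂(M.P h (x, a))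
          + errorBound M μ ψ φ par i ω n h x a

lemma exists_bound_iter_V (hR : Regular ψ φ par) (ω : ℕ → Episode S A H) (n : ℕ) (i : Bool)
    (h : Fin (H + 1)) (x : S) : |(iter M μ ψ φ par ω n).V i h x| ≤ H := by
  have := iter_V_mem' (M := M) (μ := μ) (ψ := ψ) (φ := φ) hR.theta_nonneg hR.theta_le_one ω n i h x
  rw [abs_of_nonneg this.1]; exact this.2

/-- The estimated value of the played policy exceeds its value at most by the expected errors. -/
lemma iter_V_le_value (hR : Regular ψ φ par) (hβ : 0 ≤ par.β) {ω : ℕ → Episode S A H} {K : ℕ}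
    (ho : OptimisticRun M μ ψ φ par ω K) {n : ℕ} (hn : n < K) (i : Bool) :
    (iter M μ ψ φ par ω n).V i 0 M.x₁ ≤ M.value (M.fn i) (iter M μ ψ φ par ω n).pol
      + trajValue H M.P (iter M μ ψ φ par ω n).pol (errorBound M μ ψ φ par i ω n) M.x₁ := by
  have hπ := isPolicy_iter (M := M) (μ := μ) hR.psi hR.phi hR.theta_nonneg hR.theta_le_one ω n
  have hc := isCost_errorBound (M := M) (μ := μ) hR hβ i ω n
  have h := le_trajValue_of_subsolution H M.P M.markov _ hπ _ ((M.isCost_fn i).add hc)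
    ((iter M μ ψ φ par ω n).V i) (measurable_iter_V hR.psi hR.phi ω n i)
    ⟨H, exists_bound_iter_V hR ω n i⟩ (fun x => (iter_V_last ω n i x).le) (fun h x => by
      rw [iter_V_castSucc]
      refine Finset.sum_le_sum fun a _ => ?_
      rw [mul_comm]
      refine mul_le_mul_of_nonneg_left ?_ (hπ.nonneg h x a)
      linarith [(ho n hn i h x a).2]) M.x₁
  rw [trajValue_add (M.isCost_fn i) hc M.markov hπ] at h
  exact h

/-- The comparison of a fixed policy with the estimated values. -/
lemma value_le_sum_iter_V (hR : Regular ψ φ par) (hχ : 0 ≤ par.χ) {ω : ℕ → Episode S A H} {K : ℕ}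
    (ho : OptimisticRun M μ ψ φ par ω K) {π : PolicyFun S A H} (hπ : IsPolicy π) {R : ℝ}
    (hreg : ∀ h x, ∑ k ∈ Finset.range K, ∑ a,
      ((iter M μ ψ φ par ω k).Q true h x a + (iter M μ ψ φ par ω k).Y *
        (iter M μ ψ φ par ω k).Q false h x a) * (π h x a - (iter M μ ψ φ par ω k).pol h x a) ≤ R) :
    ∑ k ∈ Finset.range K, (M.value M.r π + (iter M μ ψ φ par ω k).Y * M.value M.g π)
      ≤ ∑ k ∈ Finset.range K, ((iter M μ ψ φ par ω k).V true 0 M.x₁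
        + (iter M μ ψ φ par ω k).Y * (iter M μ ψ φ par ω k).V false 0 M.x₁) + H * R := by
  set I := iter M μ ψ φ par ω with hI
  have hYn : ∀ k, 0 ≤ (I k).Y := fun k => (iter_Y_mem hχ ω k).1
  -- A supersolution for the fixed comparator π. Summing over episodes before the backward recursion
  -- lets the regret at each single state be used, whatever states π visits; R is paid once per
  -- remaining step, of which there are H - h as `h` counts from zero.
  let v : Fin (H + 1) → S → ℝ := fun h x =>
    ∑ k ∈ Finset.range K, ((I k).V true h x + (I k).Y * (I k).V false h x)
      + ((H : ℝ) - (h : ℕ)) * R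
  have hVm : ∀ k i h, Measurable ((I k).V i h) := fun k i h =>
    measurable_iter_V hR.psi hR.phi ω k i h
  have hVb : ∀ k i h x, |(I k).V i h x| ≤ H := fun k i h x => exists_bound_iter_V hR ω k i h x
  have hvm : ∀ h, Measurable (v h) := fun h =>
    (Finset.measurable_sum _ fun k _ => (hVm k true h).add ((hVm k false h).const_mul _)).add_const _
  have hvb : ∃ C, ∀ h x, |v h x| ≤ C := by
    refine ⟨∑ k ∈ Finset.range K, ((H : ℝ) + (I k).Y * H) + H * |R|, fun h x => ?_⟩
    refine (abs_add_le _ _).trans (add_le_add ((Finset.abs_sum_le_sum_abs _ _).trans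
      (Finset.sum_le_sum fun k _ => ?_)) ?_)
    · refine (abs_add_le _ _).trans (add_le_add (hVb k true h x) ?_)
      rw [abs_mul, abs_of_nonneg (hYn k)]
      exact mul_le_mul_of_nonneg_left (hVb k false h x) (hYn k)
    · rw [abs_mul]
      have h1 : ((h : ℕ) : ℝ) ≤ H := Nat.cast_le.mpr (Nat.lt_succ_iff.mp h.2)
      have h2 : (0 : ℝ) ≤ (h : ℕ) := Nat.cast_nonneg _
      refine mul_le_mul_of_nonneg_right ?_ (abs_nonneg R)
      rw [abs_of_nonneg (by linarith)]
      linarith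
  let c : Fin H → S → A → ℝ := fun h x a => (K : ℝ) * M.r h x a
    + (∑ k ∈ Finset.range K, (I k).Y) * M.g h x a
  have hc : IsCost c := (M.isCost_r.const_mul _).add (M.isCost_g.const_mul _)
  have key := trajValue_le_of_supersolution M.markov hπ hc hvm hvb (fun x => by
    simp [v, hI, iter_V_last]) (fun h x => ?_) M.x₁
  · have e1 : trajValue H M.P π c M.x₁ = K * M.value M.r π
        + (∑ k ∈ Finset.range K, (I k).Y) * M.value M.g π := by
      rw [trajValue_add (M.isCost_r.const_mul _) (M.isCost_g.const_mul _) M.markov hπ,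
        trajValue_const_mul, trajValue_const_mul]
      rfl
    have e2 : ∑ k ∈ Finset.range K, (M.value M.r π + (I k).Y * M.value M.g π)
        = K * M.value M.r π + (∑ k ∈ Finset.range K, (I k).Y) * M.value M.g π := by
      rw [Finset.sum_add_distrib, Finset.sum_mul]; simp
    rw [e2, ← e1]
    simpa [v] using key
  · have hstep : ∀ a, c h x a + ∫ x', v h.succ x' ∂(M.P h (x, a))
        ≤ ∑ k ∈ Finset.range K, ((I k).Q true h x a + (I k).Y * (I k).Q false h x a)
          + ((H : ℝ) - (h : ℕ) - 1) * R := by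
      intro a
      have hPr := (M.markov h).isProbabilityMeasure (x, a)
      have hVi : ∀ k i, Integrable ((I k).V i h.succ) (M.P h (x, a)) := fun k i =>
        integrable_of_measurable_of_bounded (hVm k i _) (hVb k i _)
      have hint : ∫ x', v h.succ x' ∂(M.P h (x, a)) = ∑ k ∈ Finset.range K,
          (∫ x', (I k).V true h.succ x' ∂(M.P h (x, a))
            + (I k).Y * ∫ x', (I k).V false h.succ x' ∂(M.P h (x, a)))
          + ((H : ℝ) - (h : ℕ) - 1) * R := by
        simp only [v]
        have hc : ∀ k, Integrable (fun x' => (I k).Y * (I k).V false h.succ x') (M.P h (x, a)) :=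
          fun k => (hVi k false).const_mul _
        have hk : ∀ k, Integrable (fun x' => (I k).V true h.succ x'
            + (I k).Y * (I k).V false h.succ x') (M.P h (x, a)) := fun k => (hVi k true).add (hc k)
        have hs : Integrable (fun x' => ∑ k ∈ Finset.range K, ((I k).V true h.succ x'
            + (I k).Y * (I k).V false h.succ x')) (M.P h (x, a)) :=
          integrable_finsetSum _ fun k _ => hk k
        rw [integral_add hs (integrable_const _), integral_finsetSum _ fun k _ => hk k]
        congr 1
        · refine Finset.sum_congr rfl fun k _ => ?_
          rw [integral_add (hVi k true) (hc k), integral_const_mul]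
        · simp only [Fin.val_succ, Nat.cast_add, Nat.cast_one, integral_const, probReal_univ,
            one_smul]
          ring
      have hcs : c h x a = ∑ k ∈ Finset.range K, (M.r h x a + (I k).Y * M.g h x a) := by
        simp only [c]
        rw [Finset.sum_add_distrib, Finset.sum_mul]; simp
      rw [hint, hcs, ← add_assoc, ← Finset.sum_add_distrib]
      refine add_le_add_left (Finset.sum_le_sum fun k hk => ?_) _
      have hk := Finset.mem_range.mp hk
      have h1 := (ho k hk true h x a).1
      have h2 := mul_le_mul_of_nonneg_left (ho k hk false h x a).1 (hYn k)
      simp only [CMDP.fn, cond_true, cond_false] at h1 h2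
      linarith
    refine (sum_policy_mul_mono hπ h x hstep).trans ?_
    have e3 : ∑ a, π h x a * (∑ k ∈ Finset.range K, ((I k).Q true h x a
        + (I k).Y * (I k).Q false h x a) + ((H : ℝ) - (h : ℕ) - 1) * R)
        = ∑ k ∈ Finset.range K, ∑ a, ((I k).Q true h x a + (I k).Y * (I k).Q false h x a) * π h x a
          + ((H : ℝ) - (h : ℕ) - 1) * R := by
      simp only [mul_add, Finset.sum_add_distrib, ← Finset.sum_mul, hπ.sum_eq_one, one_mul]
      congr 1
      simp_rw [Finset.mul_sum]
      rw [← Finset.sum_add_distrib]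
      rw [show (∑ k ∈ Finset.range K, ∑ a, ((I k).Q true h x a + (I k).Y * (I k).Q false h x a)
        * π h x a) = ∑ a, ∑ k ∈ Finset.range K, ((I k).Q true h x a
          + (I k).Y * (I k).Q false h x a) * π h x a from Finset.sum_comm]
      refine Finset.sum_congr rfl fun a _ => ?_
      rw [← Finset.sum_add_distrib]
      exact Finset.sum_congr rfl fun k _ => by ring
    have e4 : ∑ k ∈ Finset.range K, ((I k).V true h.castSucc x
        + (I k).Y * (I k).V false h.castSucc x) = ∑ k ∈ Finset.range K, ∑ a,
          ((I k).Q true h x a + (I k).Y * (I k).Q false h x a) * (I k).pol h x a := by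
      refine Finset.sum_congr rfl fun k _ => ?_
      rw [hI, iter_V_castSucc, iter_V_castSucc, Finset.mul_sum, ← Finset.sum_add_distrib]
      exact Finset.sum_congr rfl fun a _ => by ring
    have hr := hreg h x
    simp only [mul_sub, Finset.sum_sub_distrib] at hr
    rw [e3]
    change _ ≤ ∑ k ∈ Finset.range K, ((I k).V true h.castSucc x
        + (I k).Y * (I k).V false h.castSucc x) + ((H : ℝ) - (h.castSucc : ℕ)) * R
    rw [e4, Fin.val_castSucc]
    linarith

/-- The regret bound for the Lagrangian. -/
theorem lagrangian_regret (hR : Regular ψ φ par) (hβ : 0 ≤ par.β) (hη : 0 < par.η)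
    (hχ : 0 ≤ par.χ) {ω : ℕ → Episode S A H} {K : ℕ}
    (ho : OptimisticRun M μ ψ φ par ω K) {π : PolicyFun S A H} (hπ : IsPolicy π)
    (hπb : M.b ≤ M.value M.g π) {R : ℝ}
    (hreg : ∀ h x, ∑ k ∈ Finset.range K, ∑ a,
      ((iter M μ ψ φ par ω k).Q true h x a + (iter M μ ψ φ par ω k).Y *
        (iter M μ ψ φ par ω k).Q false h x a) * (π h x a - (iter M μ ψ φ par ω k).pol h x a) ≤ R)
    {y : ℝ} (hy : y ∈ Set.Icc 0 par.χ) :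
    ∑ k ∈ Finset.range K, (M.value M.r π - M.value M.r (iter M μ ψ φ par ω k).pol)
      + y * ∑ k ∈ Finset.range K, (M.b - M.value M.g (iter M μ ψ φ par ω k).pol)
      ≤ H * R + y ^ 2 / (2 * par.η) + K * (par.η * (H : ℝ) ^ 2 / 2)
        + ∑ k ∈ Finset.range K, trajValue H M.P (iter M μ ψ φ par ω k).pol
            (errorBound M μ ψ φ par true ω k) M.x₁
        + y * ∑ k ∈ Finset.range K, trajValue H M.P (iter M μ ψ φ par ω k).pol
            (errorBound M μ ψ φ par false ω k) M.x₁ := by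
  have h1 := value_le_sum_iter_V hR hχ ho hπ hreg
  set I := iter M μ ψ φ par ω with hI
  -- The initial value V_{g,1}^0 = b makes the first dual step vanish, so iterate 0 has Y = 0, as
  -- `dual_regret` requires.
  have h2 := dual_regret (Y := fun k => (I k).Y) (s := fun k => M.b - (I k).V false 0 M.x₁)
    (χ := par.χ) (G := H) hη (by
      simp only [hI, iter_zero_Y, dualUpdate, initial]
      simp [hχ]) (fun k => by
      simp only [hI, iter_succ_Y, dualUpdate]
      rfl) (fun k => by
      have hv := iter_V_mem' (M := M) (μ := μ) (ψ := ψ) (φ := φ) hR.theta_nonneg hR.theta_le_one ω k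
        false 0 M.x₁
      rw [abs_le]
      constructor <;> linarith [hv.1, hv.2, M.b_mem.1, M.b_mem.2]) hy K
  have h3 : ∑ k ∈ Finset.range K, (I k).V true 0 M.x₁ ≤ ∑ k ∈ Finset.range K,
      (M.value M.r (I k).pol + trajValue H M.P (I k).pol (errorBound M μ ψ φ par true ω k) M.x₁) :=
    Finset.sum_le_sum fun k hk => iter_V_le_value hR hβ ho (Finset.mem_range.mp hk) true
  have h4 : y * ∑ k ∈ Finset.range K, (I k).V false 0 M.x₁ ≤ y * ∑ k ∈ Finset.range K,
      (M.value M.g (I k).pol + trajValue H M.P (I k).pol (errorBound M μ ψ φ par false ω k) M.x₁) :=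
    mul_le_mul_of_nonneg_left (Finset.sum_le_sum fun k hk =>
      iter_V_le_value hR hβ ho (Finset.mem_range.mp hk) false) hy.1
  -- Feasibility of the comparator, weighted by the nonnegative dual variables.
  have h5 : (∑ k ∈ Finset.range K, (I k).Y) * M.b
      ≤ (∑ k ∈ Finset.range K, (I k).Y) * M.value M.g π :=
    mul_le_mul_of_nonneg_left hπb (Finset.sum_nonneg fun k _ => (iter_Y_mem hχ ω k).1)
  simp only [Finset.sum_add_distrib, Finset.sum_sub_distrib, mul_sub, ← Finset.sum_mul, mul_add]
    at h1 h2 h3 h4 ⊢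
  linarith

/-- The policies of the run satisfy the mirror descent regret bound at every state. -/
lemma iter_mirror_descent (hR : Regular ψ φ par) (hθ : par.θ < 1) (hα : 0 < par.α)
    (hχ : 0 ≤ par.χ) (hH : 0 < H) (ω : ℕ → Episode S A H) (K : ℕ) {π : PolicyFun S A H}
    (hπ : IsPolicy π) (h : Fin H) (x : S) :
    par.α * ∑ k ∈ Finset.range K, ∑ a,
      ((iter M μ ψ φ par ω k).Q true h x a + (iter M μ ψ φ par ω k).Y *
        (iter M μ ψ φ par ω k).Q false h x a) * (π h x a - (iter M μ ψ φ par ω k).pol h x a)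
      ≤ Real.log (Fintype.card A) + K * (-Real.log (1 - par.θ)
        + par.α * (par.θ * ((1 + par.χ) * H)) + (par.α * ((1 + par.χ) * H)) ^ 2 / 2) := by
  set I := iter M μ ψ φ par ω with hI
  have hHpos : (0 : ℝ) < H := Nat.cast_pos.mpr hH
  refine mirror_descent_regret (p := fun k a => (I k).pol h x a) hR.theta_nonneg hθ hα
    (by positivity) (fun k a => ?_) (fun a => ?_) (fun k a => ?_)
    (fun k => (iter_pol_prob hR.theta_nonneg hR.theta_le_one ω k).2 h x)
    (fun a => hπ.nonneg h x a) (hπ.sum_eq_one h x) K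
  · have hY := iter_Y_mem (M := M) (μ := μ) (ψ := ψ) (φ := φ) hχ ω k
    have hq : ∀ i, (I k).Q i h x a ∈ Set.Icc (0 : ℝ) H := fun i =>
      ⟨iter_Q_nonneg ω k i h x a, (iter_Q_le ω k i h x a).trans (by simp)⟩
    refine ⟨add_nonneg (hq true).1 (mul_nonneg hY.1 (hq false).1), ?_⟩
    have := mul_le_mul hY.2 (hq false).2 (hq false).1 hχ
    linarith [(hq true).2]
  -- Iterate 0 is already one improvement step; as the initial Q vanishes, that step leaves the
  -- uniform policy unchanged.
  · have hcard : (Fintype.card A : ℝ) ≠ 0 := Nat.cast_ne_zero.mpr Fintype.card_ne_zero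
    simp only [hI, iter_zero_pol, improve, mix, initial]
    simp only [mul_zero, add_zero, Real.exp_zero, mul_one, Finset.sum_const, Finset.card_univ,
      nsmul_eq_mul]
    field_simp
  · simp only [hI, iter_succ_pol]
    rfl

end PrimalDual

/-! ### The tuned parameters -/

section Numerics

variable {d H K : ℕ} {p : ℝ}

/-- With K ≥ 2 the logarithm is bounded below, so numerical constants can be absorbed into it. -/
lemma log_two_le_logTerm (hd : 1 ≤ d) (hH : 1 ≤ H) (hK : 2 ≤ K) (hp : 0 < p) (hp1 : p < 1) :
    Real.log 2 ≤ logTerm d H K p := by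
  have hd' : (1 : ℝ) ≤ d := Nat.one_le_cast.mpr hd
  have hH' : (1 : ℝ) ≤ H := Nat.one_le_cast.mpr hH
  have hK' : (2 : ℝ) ≤ K := by exact_mod_cast hK
  refine Real.log_le_log two_pos ?_
  rw [le_div_iff₀ hp]
  have h1 : (2 : ℝ) ≤ H * K := by nlinarith
  nlinarith

lemma logTerm_nonneg (hd : 1 ≤ d) (hH : 1 ≤ H) (hK : 1 ≤ K) (hp : 0 < p) (hp1 : p < 1) :
    0 ≤ logTerm d H K p := by
  have hd' : (1 : ℝ) ≤ d := Nat.one_le_cast.mpr hd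
  have hH' : (1 : ℝ) ≤ H := Nat.one_le_cast.mpr hH
  have hK' : (1 : ℝ) ≤ K := Nat.one_le_cast.mpr hK
  refine Real.log_nonneg ?_
  rw [le_div_iff₀ hp]
  have h1 : (1 : ℝ) ≤ H * K := by nlinarith
  nlinarith

lemma logTerm_nonneg' (hH : 1 ≤ H) (hK : 1 ≤ K) (hp : 0 < p) (hp1 : p < 1) :
    0 ≤ logTerm d H K p := by
  rcases Nat.eq_zero_or_pos d with rfl | hd
  · simp [logTerm]
  · exact logTerm_nonneg hd hH hK hp hp1

/-- The logarithm of the number of events in the union bound. -/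
lemma log_confidence_le (hd : 1 ≤ d) (hH : 1 ≤ H) (hK : 2 ≤ K) (hp : 0 < p) (hp1 : p < 1) :
    Real.log (1 / (p / (4 * (H * K)))) ≤ 3 * logTerm d H K p := by
  have hd' : (1 : ℝ) ≤ d := Nat.one_le_cast.mpr hd
  have hH' : (1 : ℝ) ≤ H := Nat.one_le_cast.mpr hH
  have hK' : (2 : ℝ) ≤ K := by exact_mod_cast hK
  have h1 : (2 : ℝ) ≤ H * K := by nlinarith
  have h2 := log_two_le_logTerm hd hH hK hp hp1
  have e : 1 / (p / (4 * (H * K))) = 2 * (2 * (H * K / p)) := by field_simp; ring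
  have hX : 0 < (H : ℝ) * K / p := by positivity
  rw [e, Real.log_mul two_ne_zero (by positivity), Real.log_mul two_ne_zero hX.ne']
  have h3 : Real.log (H * K / p) ≤ logTerm d H K p := by
    refine Real.log_le_log hX ?_
    exact (le_mul_of_one_le_left hX.le hd').trans (mul_div_assoc _ _ _).ge
  linarith

/-- Here d H² dominates the squared norms of both kinds of features. The factor 3 is the exponent in
the crude bound m + n d H² ≤ (dHK)³. -/
lemma potential_le {m : ℕ} (hm : m ≤ d) (hd : 1 ≤ d) (hH : 1 ≤ H) (hK : 2 ≤ K) (hp : 0 < p)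
    (hp1 : p < 1) {n : ℕ} (hn : n ≤ K) :
    (m : ℝ) * Real.log (m + n * (d * (H : ℝ) ^ 2)) ≤ 3 * (d * logTerm d H K p) := by
  have hd' : (1 : ℝ) ≤ d := Nat.one_le_cast.mpr hd
  have hH' : (1 : ℝ) ≤ H := Nat.one_le_cast.mpr hH
  have hK' : (2 : ℝ) ≤ K := by exact_mod_cast hK
  have hm' : (m : ℝ) ≤ d := Nat.cast_le.mpr hm
  have hn' : (n : ℝ) ≤ K := Nat.cast_le.mpr hn
  have hL := logTerm_nonneg hd hH (by omega) hp hp1 (K := K)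
  rcases Nat.eq_zero_or_pos m with rfl | hmpos
  · simp only [Nat.cast_zero, zero_mul]; positivity
  have hmp : (0 : ℝ) < m := Nat.cast_pos.mpr hmpos
  set X : ℝ := d * (H * K) with hX
  have h1 : (2 : ℝ) ≤ H * K := by nlinarith
  have hX2 : 2 ≤ X := by nlinarith
  have hdX : (d : ℝ) ≤ X := le_mul_of_one_le_right (by positivity) (by linarith)
  have hXX : (K : ℝ) * (d * (H : ℝ) ^ 2) ≤ X ^ 2 := by
    have : X ^ 2 = (K : ℝ) * (d * (H : ℝ) ^ 2) * (d * K) := by rw [hX]; ring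
    rw [this]
    exact le_mul_of_one_le_right (by positivity) (by nlinarith)
  have hle : (m : ℝ) + n * (d * (H : ℝ) ^ 2) ≤ X ^ 3 := by
    have h2 : (n : ℝ) * (d * (H : ℝ) ^ 2) ≤ K * (d * (H : ℝ) ^ 2) := by gcongr
    nlinarith [mul_nonneg (by linarith : 0 ≤ X) (by nlinarith : 0 ≤ X ^ 2 - X - 1)]
  have hlog : Real.log (m + n * (d * (H : ℝ) ^ 2)) ≤ 3 * logTerm d H K p := by
    calc _ ≤ Real.log (X ^ 3) := Real.log_le_log (by positivity) hle
      _ = 3 * Real.log X := by rw [Real.log_pow]; norm_num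
      _ ≤ _ := by
        refine mul_le_mul_of_nonneg_left (Real.log_le_log (by linarith) ?_) (by norm_num)
        rw [le_div_iff₀ hp]
        nlinarith
  calc _ ≤ (m : ℝ) * (3 * logTerm d H K p) := mul_le_mul_of_nonneg_left hlog hmp.le
    _ ≤ d * (3 * logTerm d H K p) := mul_le_mul_of_nonneg_right hm' (by positivity)
    _ = _ := by ring

/-- The analysis produces H³√K; this rewrites it in terms of T = HK. -/
lemma rpow_mul_sqrt (H K : ℕ) :
    (H : ℝ) ^ (5 / 2 : ℝ) * √((H : ℝ) * K) = (H : ℝ) ^ 3 * √(K : ℝ) := by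
  have h0 : (0 : ℝ) ≤ H := Nat.cast_nonneg _
  have e : (H : ℝ) ^ (5 / 2 : ℝ) = (H : ℝ) ^ 2 * √(H : ℝ) := by
    rw [Real.sqrt_eq_rpow, show (5 / 2 : ℝ) = (2 : ℕ) + 1 / 2 by norm_num,
      Real.rpow_add_of_nonneg h0 (by norm_num) (by norm_num), Real.rpow_natCast]
  rw [e, Real.sqrt_mul h0]
  linear_combination (H : ℝ) ^ 2 * √(K : ℝ) * Real.mul_self_sqrt h0

/-- The mirror descent bound for the tuned step size. -/
lemma mirror_descent_numeric (hH : 1 ≤ H) (hK : 2 ≤ K) {γ l α x : ℝ} (hγ : 0 < γ) (hγH : γ ≤ H)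
    (hl : Real.log 2 ≤ l) (hα : α = √l / ((H : ℝ) ^ 2 * √(K : ℝ)))
    (hx : α * x ≤ l + K * (-Real.log (1 - 1 / K) + α * (1 / K * ((1 + 2 * H / γ) * H))
      + (α * ((1 + 2 * H / γ) * H)) ^ 2 / 2)) :
    x ≤ (H : ℝ) ^ 2 * √(K : ℝ) * (√l * (4 + 9 / (2 * γ ^ 2)) + 3 / γ) := by
  have hH' : (1 : ℝ) ≤ H := Nat.one_le_cast.mpr hH
  have hK' : (2 : ℝ) ≤ K := by exact_mod_cast hK
  have hlpos : 0 < l := (Real.log_pos one_lt_two).trans_le hl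
  set s := √l with hs
  set k := √(K : ℝ) with hk
  have hs0 : 0 < s := Real.sqrt_pos.mpr hlpos
  have hk0 : 0 < k := Real.sqrt_pos.mpr (by linarith)
  have hss : s ^ 2 = l := Real.sq_sqrt hlpos.le
  have hkk : k ^ 2 = K := Real.sq_sqrt (by linarith)
  have hk1 : 1 ≤ k := by nlinarith
  have hα0 : 0 < α := by rw [hα]; positivity
  -- For K ≥ 2 the left side is at most K/(K - 1) ≤ 2 ≤ 3 log 2.
  have hlog : (K : ℝ) * -Real.log (1 - 1 / K) ≤ 3 * l := by
    have h1 : (0 : ℝ) < 1 - 1 / K := by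
      rw [sub_pos, div_lt_one (by linarith)]; linarith
    have h2 := Real.one_sub_inv_le_log_of_pos h1
    have h3 : (1 : ℝ) - (1 - 1 / (K : ℝ))⁻¹ = -(1 / (K - 1)) := by
      have : (K : ℝ) - 1 ≠ 0 := by linarith
      have h4 : (K : ℝ) ≠ 0 := by linarith
      have h5 : 1 - 1 / (K : ℝ) = (K - 1) / K := by field_simp
      rw [h5, inv_div]
      field_simp
      ring
    have h4 : (K : ℝ) * (1 / (K - 1)) ≤ 2 := by
      rw [mul_one_div, div_le_iff₀ (by linarith)]; linarith
    have h5 := mul_le_mul_of_nonneg_left (by linarith : -Real.log (1 - 1 / (K : ℝ)) ≤ 1 / (K - 1))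
      (by linarith : (0 : ℝ) ≤ K)
    linarith [Real.log_two_gt_d9]
  set q := (1 + 2 * (H : ℝ) / γ) * H with hq
  have hq0 : 0 ≤ q := by positivity
  -- Uses γ ≤ H, so that 1 ≤ H/γ.
  have hq3 : q ≤ 3 * (H : ℝ) ^ 2 / γ := by
    rw [hq, le_div_iff₀ hγ]
    have : (1 + 2 * (H : ℝ) / γ) * H * γ = γ * H + 2 * H ^ 2 := by field_simp
    rw [this]
    nlinarith
  have hq2 : q ^ 2 ≤ (3 * (H : ℝ) ^ 2 / γ) ^ 2 := by gcongr
  -- 4 = 1 + 3, from the initial entropy and the mixing cost. The chosen α gives the first and last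
  -- terms the same order H²√(Kl), for fixed γ.
  have hdiv : x ≤ 4 * l / α + q + K * α * q ^ 2 / 2 := by
    have e1 : (K : ℝ) * (-Real.log (1 - 1 / K) + α * (1 / K * q) + (α * q) ^ 2 / 2)
        = K * -Real.log (1 - 1 / K) + α * q + α * (K * α * q ^ 2 / 2) := by
      field_simp
    rw [e1] at hx
    have e2 : α * (4 * l / α) = 4 * l := by field_simp
    refine le_of_mul_le_mul_left ?_ hα0
    linarith
  have e1 : 4 * l / α = (H : ℝ) ^ 2 * k * (s * 4) := by
    rw [hα, ← hss]; field_simp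
  have e2 : (K : ℝ) * α * q ^ 2 / 2 = k * s / (2 * (H : ℝ) ^ 2) * q ^ 2 := by
    rw [hα, ← hkk]; field_simp
  have h3 : k * s / (2 * (H : ℝ) ^ 2) * q ^ 2
      ≤ k * s / (2 * (H : ℝ) ^ 2) * (3 * (H : ℝ) ^ 2 / γ) ^ 2 := by gcongr
  have e3 : k * s / (2 * (H : ℝ) ^ 2) * (3 * (H : ℝ) ^ 2 / γ) ^ 2
      = (H : ℝ) ^ 2 * k * (s * (9 / (2 * γ ^ 2))) := by field_simp; ring
  have h4 : 3 * (H : ℝ) ^ 2 / γ ≤ (H : ℝ) ^ 2 * k * (3 / γ) := by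
    have : 3 * (H : ℝ) ^ 2 / γ * 1 ≤ 3 * (H : ℝ) ^ 2 / γ * k := by gcongr
    calc _ ≤ 3 * (H : ℝ) ^ 2 / γ * k := by linarith
      _ = _ := by ring
  rw [e1, e2] at hdiv
  rw [e3] at h3
  linarith

end Numerics

/-! ### The good event -/

section GoodEvent

variable {S A : Type*} [MeasurableSpace S] [MeasurableSpace A] [Fintype A]
  [DiscreteMeasurableSpace A] {H d₁ d₂ d K : ℕ} {M : CMDP S A H} {μ : Measure S} [SFinite μ]
  [Nonempty A]
  {ψ : S → A → S → EuclideanSpace ℝ (Fin d₁)} {φ : S → A → EuclideanSpace ℝ (Fin d₂)}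
  {par : Params} {p : ℝ}

lemma sum_leverage_visitFeature_le (hR : Regular ψ φ par) (hL : M.IsLinearKernel μ ψ φ d)
    (hd : 1 ≤ d) (hH : 1 ≤ H) (hK : 2 ≤ K) (hp : 0 < p) (hp1 : p < 1) (i : Bool) (h : Fin H)
    (ω : ℕ → Episode S A H) {n : ℕ} (hn : n ≤ K) :
    ∑ k ∈ Finset.range n, leverage (visitFeature M μ ψ φ par i h ω) k
      / (1 + leverage (visitFeature M μ ψ φ par i h ω) k) ≤ 3 * (d * logTerm d H K p) := by
  refine (sum_leverage_le _ n (B := d * (H : ℝ) ^ 2) fun k _ => ?_).trans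
    (potential_le ((le_max_left _ _).trans hL.dim_le) hd hH hK hp hp1 hn)
  have h1 := hL.norm_integral_psi_le _ (measurable_iter_V (M := M) (μ := μ) hR.psi hR.phi ω k i h.succ)
    (iter_V_mem' hR.theta_nonneg hR.theta_le_one ω k i h.succ) ((ω k).1 h.castSucc) ((ω k).2 h)
  have hd₁ : (d₁ : ℝ) ≤ d := Nat.cast_le.mpr ((le_max_left _ _).trans hL.dim_le)
  calc ‖visitFeature M μ ψ φ par i h ω k‖ ^ 2 ≤ (√(d₁ : ℝ) * H) ^ 2 :=
        pow_le_pow_left₀ (norm_nonneg _) h1 2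
    _ = d₁ * (H : ℝ) ^ 2 := by rw [mul_pow, Real.sq_sqrt (Nat.cast_nonneg _)]
    _ ≤ _ := by gcongr

lemma sum_leverage_phi_le (hL : M.IsLinearKernel μ ψ φ d)
    (hd : 1 ≤ d) (hH : 1 ≤ H) (hK : 2 ≤ K) (hp : 0 < p) (hp1 : p < 1) (h : Fin H)
    (ω : ℕ → Episode S A H) {n : ℕ} (hn : n ≤ K) :
    ∑ k ∈ Finset.range n, leverage (fun k => φ ((ω k).1 h.castSucc) ((ω k).2 h)) k
      / (1 + leverage (fun k => φ ((ω k).1 h.castSucc) ((ω k).2 h)) k)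
      ≤ 3 * (d * logTerm d H K p) := by
  refine (sum_leverage_le _ n (B := d * (H : ℝ) ^ 2) fun k _ => ?_).trans
    (potential_le ((le_max_right _ _).trans hL.dim_le) hd hH hK hp hp1 hn)
  have hH' : (1 : ℝ) ≤ H := Nat.one_le_cast.mpr hH
  calc ‖φ ((ω k).1 h.castSucc) ((ω k).2 h)‖ ^ 2 ≤ √(d : ℝ) ^ 2 :=
        pow_le_pow_left₀ (norm_nonneg _) (hL.norm_phi_le _ _) 2
    _ = d := Real.sq_sqrt (Nat.cast_nonneg _)
    _ ≤ _ := le_mul_of_one_le_right (Nat.cast_nonneg _) (one_le_pow₀ hH')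

variable (M μ ψ φ par) in
/-- The total expected error bound of the first `K` episodes. -/
noncomputable def totalError (i : Bool) (ω : ℕ → Episode S A H) (K : ℕ) : ℝ :=
  ∑ k ∈ Finset.range K, trajValue H M.P (iter M μ ψ φ par ω k).pol
    (errorBound M μ ψ φ par i ω k) M.x₁

/-- With high probability the run is optimistic with small total error. -/
theorem runLaw_optimisticRun (hR : Regular ψ φ par) (hL : M.IsLinearKernel μ ψ φ d)
    (hd : 1 ≤ d) (hH : 1 ≤ H) (hK : 2 ≤ K) (hp : 0 < p) (hp1 : p < 1) {C₁ : ℝ} (hC₁ : 5 ≤ C₁)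
    (hlam : par.lam = 1) (hβ : par.β = C₁ * √((d : ℝ) * (H : ℝ) ^ 2 * logTerm d H K p))
    (e₀ : Episode S A H) :
    ENNReal.ofReal (1 - p) ≤ runLaw M μ ψ φ par K {D |
      OptimisticRun M μ ψ φ par (extend e₀ D) K ∧ ∀ i, totalError M μ ψ φ par i (extend e₀ D) K
        ≤ (20 * C₁ + 6) * ((H : ℝ) ^ 2 * √(K : ℝ) * (d * logTerm d H K p))} := by
  have hHpos : 0 < H := hH
  have hd' : (1 : ℝ) ≤ d := Nat.one_le_cast.mpr hd
  have hH' : (1 : ℝ) ≤ H := Nat.one_le_cast.mpr hH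
  have hK' : (2 : ℝ) ≤ K := by exact_mod_cast hK
  set L := logTerm d H K p with hLdef
  have hL2 : Real.log 2 ≤ L := log_two_le_logTerm hd hH hK hp hp1
  have hLhalf : 1 / 2 ≤ L := by linarith [Real.log_two_gt_d9]
  have hconf := log_confidence_le hd hH hK hp hp1
  -- There are 2HK noise events, one for each step, function and episode, and 2 bonus events; their
  -- total is at most 4HK.
  set δ := p / (4 * ((H : ℝ) * K)) with hδ
  have hδ0 : 0 < δ := by positivity
  have hdL : L ≤ d * L := le_mul_of_one_le_left (by linarith) hd'
  set t := √((d : ℝ) * L) with ht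
  have htt : t ^ 2 = d * L := Real.sq_sqrt (by linarith)
  have ht0 : 0 ≤ t := Real.sqrt_nonneg _
  have hthalf : 1 / 2 ≤ t := Real.le_sqrt_of_sq_le (by linarith)
  have hβ' : par.β = C₁ * (H * t) := by
    rw [hβ, show (d : ℝ) * (H : ℝ) ^ 2 * L = (H : ℝ) ^ 2 * (d * L) by ring,
      Real.sqrt_mul (by positivity), Real.sqrt_sq (by linarith)]
  have hHt : (H : ℝ) ≤ 2 * (H * t) := by nlinarith
  have hHt0 : 0 ≤ (H : ℝ) * t := by positivity
  have hβ0 : 0 ≤ par.β := by rw [hβ']; positivity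
  have hHβ : (H : ℝ) ≤ 2 * par.β := by rw [hβ']; nlinarith
  have hsd : √(d : ℝ) ≤ 2 * (H * t) := by
    refine Real.sqrt_le_iff.mpr ⟨by positivity, ?_⟩
    have : (2 * ((H : ℝ) * t)) ^ 2 = 4 * (H : ℝ) ^ 2 * (d * L) := by rw [← htt]; ring
    rw [this]
    have h1 : (1 : ℝ) ≤ (H : ℝ) ^ 2 := one_le_pow₀ hH'
    have h2 : (d : ℝ) ≤ 2 * (d * L) := by nlinarith
    nlinarith
  -- The noise needs 3Ht and the regularization bias √d ≤ 2Ht; this is why C₁ ≥ 5 suffices.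
  have hβR : H * (3 * t) + √(d : ℝ) ≤ par.β := by rw [hβ']; nlinarith
  choose θ hθn hθ using hL.transition
  let bad₁ : Fin H × Bool × Fin K → Set (Fin K → Episode S A H) := fun z =>
    {D | Real.log (1 / δ) ≤ ∑ k ∈ Finset.range z.2.2,
      selfNormalizedIncrement (visitFeature M μ ψ φ par z.2.1 z.1 (extend e₀ D))
        (visitNoise M μ ψ φ par (θ z.1) z.2.1 z.1 (extend e₀ D)) k}
  let bad₂ : Bool → Set (Fin K → Episode S A H) := fun i =>
    {D | Real.log (1 / δ) ≤ ∑ k ∈ Finset.range K, errorIncrement M μ ψ φ par i k (extend e₀ D)}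
  have hb₁ : ∀ z, runLaw M μ ψ φ par K (bad₁ z) ≤ ENNReal.ofReal δ := fun z =>
    runLaw_selfNormalized hR hL hHpos (hθ z.1) z.2.1 e₀ z.2.2.2.le hδ0
  have hb₂ : ∀ i, runLaw M μ ψ φ par K (bad₂ i) ≤ ENNReal.ofReal δ := fun i =>
    runLaw_errorBound hR hβ0 hHpos i e₀ K hδ0
  have hprob := isProbabilityMeasure_runLaw (M := M) (μ := μ) hR K
  set good := {D : Fin K → Episode S A H |
      OptimisticRun M μ ψ φ par (extend e₀ D) K ∧ ∀ i, totalError M μ ψ φ par i (extend e₀ D) K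
        ≤ (20 * C₁ + 6) * ((H : ℝ) ^ 2 * √(K : ℝ) * (d * L))} with hgood
  -- Only subadditivity is applied to this cover, so the good event need not be measurable.
  have hcover : (Set.univ : Set (Fin K → Episode S A H))
      ⊆ good ∪ ((⋃ z, bad₁ z) ∪ ⋃ i, bad₂ i) := by
    intro D _
    by_cases hB : D ∈ (⋃ z, bad₁ z) ∪ ⋃ i, bad₂ i
    · exact Or.inr hB
    left
    simp only [Set.mem_union, Set.mem_iUnion, not_or, not_exists] at hB
    obtain ⟨hn₁, hn₂⟩ := hB
    refine ⟨fun n hn i h x a => ?_, fun i => ?_⟩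
    · have h1 : ∑ k ∈ Finset.range n, selfNormalizedIncrement
          (visitFeature M μ ψ φ par i h (extend e₀ D))
          (visitNoise M μ ψ φ par (θ h) i h (extend e₀ D)) k < Real.log (1 / δ) :=
        not_le.mp fun hc => hn₁ (h, i, ⟨n, hn⟩) hc
      have h2 := sum_leverage_visitFeature_le hR hL hd hH hK hp hp1 i h (extend e₀ D) hn.le
      simp only [sum_selfNormalizedIncrement] at h1
      refine optimism hR hL hHpos hlam (hθn h) (hθ h) i (extend e₀ D) n (R := 3 * t) ?_ hβR x a
      -- 2 log(1/δ) ≤ 6L and the potential is at most 3dL, together at most 9dL = (3t)².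
      refine Real.sqrt_le_iff.mpr ⟨by positivity, ?_⟩
      rw [mul_pow, htt]
      linarith
    · have h1 : ∑ k ∈ Finset.range K, errorIncrement M μ ψ φ par i k (extend e₀ D)
          < Real.log (1 / δ) := not_le.mp fun hc => hn₂ i hc
      rw [sum_errorIncrement, div_lt_iff₀ (by positivity)] at h1
      have h2 := sum_cost_errorBound_le hlam hβ0 hHβ i (extend e₀ D) K
        (fun h => sum_leverage_visitFeature_le hR hL hd hH hK hp hp1 i h (extend e₀ D) le_rfl)
        (fun h => sum_leverage_phi_le hL hd hH hK hp hp1 h (extend e₀ D) le_rfl)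
      have hk0 : 0 ≤ √(K : ℝ) := Real.sqrt_nonneg _
      have hk1 : 1 ≤ √(K : ℝ) := Real.one_le_sqrt.mpr (by linarith)
      -- 6 ≤ (5/2)² gives a rational constant.
      have h3 : √(K * (2 * (3 * (d * L)))) ≤ √(K : ℝ) * (5 / 2 * t) := by
        refine Real.sqrt_le_iff.mpr ⟨by positivity, ?_⟩
        have : (√(K : ℝ) * (5 / 2 * t)) ^ 2 = K * (25 / 4 * (d * L)) := by
          rw [← htt, mul_pow, Real.sq_sqrt (by linarith)]; ring
        rw [this]
        refine mul_le_mul_of_nonneg_left ?_ (by linarith)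
        linarith
      have h4 : (H : ℝ) * (4 * par.β * √(K * (2 * (3 * (d * L)))))
          ≤ 10 * C₁ * ((H : ℝ) ^ 2 * √(K : ℝ) * (d * L)) := by
        calc _ ≤ (H : ℝ) * (4 * par.β * (√(K : ℝ) * (5 / 2 * t))) := by gcongr
          _ = _ := by rw [hβ', ← htt]; ring
      have h5 : Real.log (1 / δ) * (H : ℝ) ^ 2 ≤ 3 * ((H : ℝ) ^ 2 * √(K : ℝ) * (d * L)) := by
        have h6 : L ≤ √(K : ℝ) * (d * L) := hdL.trans (le_mul_of_one_le_left (by linarith) hk1)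
        calc _ ≤ (3 * (√(K : ℝ) * (d * L))) * (H : ℝ) ^ 2 := by gcongr; linarith
          _ = _ := by ring
      -- Half the expected error is at most the realized error plus the logarithmic term, hence the
      -- constant 2(10 C₁ + 3).
      unfold totalError
      linarith
  have hsum₁ : runLaw M μ ψ φ par K (⋃ z, bad₁ z)
      ≤ ENNReal.ofReal (2 * (H * K) * δ) := by
    refine (measure_iUnion_fintype_le _ _).trans ((Finset.sum_le_sum fun z _ => hb₁ z).trans ?_)
    rw [Finset.sum_const, Finset.card_univ, nsmul_eq_mul, ENNReal.ofReal_mul (by positivity)]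
    gcongr
    simp only [Fintype.card_prod, Fintype.card_fin, Fintype.card_bool]
    rw [← ENNReal.ofReal_natCast]
    exact ENNReal.ofReal_le_ofReal (by push_cast; linarith)
  have hsum₂ : runLaw M μ ψ φ par K (⋃ i, bad₂ i) ≤ ENNReal.ofReal (2 * δ) := by
    refine (measure_iUnion_fintype_le _ _).trans ((Finset.sum_le_sum fun z _ => hb₂ z).trans ?_)
    rw [Finset.sum_const, Finset.card_univ, nsmul_eq_mul, ENNReal.ofReal_mul (by positivity)]
    simp
  have htot : 2 * ((H : ℝ) * K) * δ + 2 * δ ≤ p := by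
    have h1 : (2 : ℝ) ≤ H * K := by nlinarith
    have h2 : 4 * ((H : ℝ) * K) * δ = p := by rw [hδ]; field_simp
    nlinarith
  rw [ENNReal.ofReal_sub _ hp.le, ENNReal.ofReal_one, tsub_le_iff_right]
  calc (1 : ENNReal) = runLaw M μ ψ φ par K Set.univ := measure_univ.symm
    _ ≤ runLaw M μ ψ φ par K (good ∪ ((⋃ z, bad₁ z) ∪ ⋃ i, bad₂ i)) := measure_mono hcover
    _ ≤ runLaw M μ ψ φ par K good + (runLaw M μ ψ φ par K (⋃ z, bad₁ z)
        + runLaw M μ ψ φ par K (⋃ i, bad₂ i)) :=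
      (measure_union_le _ _).trans (add_le_add le_rfl (measure_union_le _ _))
    _ ≤ runLaw M μ ψ φ par K good + ENNReal.ofReal p := by
      refine add_le_add le_rfl ((add_le_add hsum₁ hsum₂).trans ?_)
      rw [← ENNReal.ofReal_add (by positivity) (by positivity)]
      exact ENNReal.ofReal_le_ofReal htot

end GoodEvent

/-! ### Regret and violation -/

/-- The constant of the regret and violation bounds. -/
noncomputable def boundConstant (C₁ γ cA : ℝ) : ℝ :=
  √cA * (4 + 9 / (2 * γ ^ 2)) + 5 / (γ * √(Real.log 2 / cA)) + 2 / √(Real.log 2 / cA)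
    + 3 * (20 * C₁ + 6)

lemma boundConstant_pos {C₁ γ cA : ℝ} (hC₁ : 0 ≤ C₁) (hγ : 0 < γ) :
    0 < boundConstant C₁ γ cA := by
  unfold boundConstant
  positivity

section Bounds

variable {S A : Type*} [MeasurableSpace S] [MeasurableSpace A] [Fintype A]
  [DiscreteMeasurableSpace A] {H d₁ d₂ d K : ℕ} {M : CMDP S A H} {μ : Measure S} [SFinite μ]
  [Nonempty A]
  {ψ : S → A → S → EuclideanSpace ℝ (Fin d₁)} {φ : S → A → EuclideanSpace ℝ (Fin d₂)}
  {par : Params} {p γ : ℝ} {πstar : PolicyFun S A H}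

lemma CMDP.one_le_horizon (M : CMDP S A H) : 1 ≤ H := by
  rcases Nat.eq_zero_or_pos H with rfl | h
  · exact absurd (M.b_mem.1.trans_le M.b_mem.2) (by simp)
  · exact h

lemma CMDP.Slater.le_horizon (hM : M.Slater γ) : γ ≤ H := by
  obtain ⟨-, π, hπ, h⟩ := hM
  linarith [(M.value_g_mem hπ).2, M.b_mem.1]

lemma opdop_extend (e₀ : Episode S A H) (D : Fin K → Episode S A H) (k : Fin K) :
    (opdop M μ ψ φ par k fun i => D (Fin.castLE k.2.le i))
      = iter M μ ψ φ par (extend e₀ D) k := by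
  unfold iter
  congr 1
  funext i
  simp only [hist, extend]
  rw [dif_pos (i.2.trans k.2)]
  rfl

lemma regret_eq (e₀ : Episode S A H) (D : Fin K → Episode S A H) :
    regret M μ ψ φ par πstar D = ∑ k ∈ Finset.range K,
      (M.value M.r πstar - M.value M.r (iter M μ ψ φ par (extend e₀ D) k).pol) := by
  rw [Finset.sum_range fun k =>
    M.value M.r πstar - M.value M.r (iter M μ ψ φ par (extend e₀ D) k).pol]
  exact Finset.sum_congr rfl fun k _ => by rw [played, opdop_extend e₀]

lemma violation_eq (e₀ : Episode S A H) (D : Fin K → Episode S A H) :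
    violation M μ ψ φ par D = max (∑ k ∈ Finset.range K,
      (M.b - M.value M.g (iter M μ ψ φ par (extend e₀ D) k).pol)) 0 := by
  rw [Finset.sum_range fun k => M.b - M.value M.g (iter M μ ψ φ par (extend e₀ D) k).pol]
  unfold violation
  congr 1
  exact Finset.sum_congr rfl fun k _ => by rw [played, opdop_extend e₀]

/-- The regret is not too negative when the violation is small. -/
lemma sum_value_sub_ge (hM : M.Slater γ) (hstar : M.IsSolution πstar) {π : ℕ → PolicyFun S A H}
    (hπ : ∀ k, IsPolicy (π k)) (hK : 1 ≤ K) :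
    -(H / γ * max (∑ k ∈ Finset.range K, (M.b - M.value M.g (π k))) 0)
      ≤ ∑ k ∈ Finset.range K, (M.value M.r πstar - M.value M.r (π k)) := by
  have hK0 : (0 : ℝ) < K := Nat.cast_pos.mpr hK
  -- By convexity the average over the episodes is the value pair of a single policy, to which the
  -- Lipschitz bound applies.
  have hmem := M.convex_valueSet.sum_mem (t := Finset.range K) (w := fun _ => 1 / (K : ℝ))
    (z := fun k => (M.value M.r (π k), M.value M.g (π k))) (fun _ _ => by positivity)
    (by simp [hK0.ne']) fun k _ => ⟨π k, hπ k, rfl⟩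
  have h := M.value_sub_le_of_mem_valueSet hM hstar hmem
  rw [← Finset.smul_sum] at h
  simp only [Prod.smul_fst, Prod.smul_snd, Prod.fst_sum, Prod.snd_sum, smul_eq_mul] at h
  simp only [Finset.sum_sub_distrib, Finset.sum_const, Finset.card_range, nsmul_eq_mul]
  set G := ∑ k ∈ Finset.range K, M.value M.g (π k)
  set R := ∑ k ∈ Finset.range K, M.value M.r (π k)
  have e : max (M.b - 1 / (K : ℝ) * G) 0 = 1 / K * max (K * M.b - G) 0 := by
    rw [mul_max_of_nonneg _ _ (by positivity)]
    congr 1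
    · field_simp
    · simp
  rw [e] at h
  have h2 := mul_le_mul_of_nonneg_left h hK0.le
  have e1 : (K : ℝ) * (1 / K * R - M.value M.r πstar) = R - K * M.value M.r πstar := by
    field_simp
  have e2 : (K : ℝ) * (H / γ * (1 / K * max (K * M.b - G) 0)) = H / γ * max (K * M.b - G) 0 := by
    field_simp
  rw [e1, e2] at h2
  linarith

/-- The bounds on an optimistic run. -/
theorem bounds_of_optimisticRun (hM : M.Slater γ) (hL : M.IsLinearKernel μ ψ φ d)
    (hstar : M.IsSolution πstar) (hK : 2 ≤ K) {C₁ cA X : ℝ} (hC₁ : 0 ≤ C₁) (hcA : 0 < cA)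
    (hA : Real.log 2 ≤ Real.log (Fintype.card A)) (hX : 0 ≤ X)
    (hAX : Real.log (Fintype.card A) ≤ cA * X ^ 2)
    (hpar : par = tuned C₁ γ p (Fintype.card A) d H K) {ω : ℕ → Episode S A H}
    (ho : OptimisticRun M μ ψ φ par ω K)
    (herr : ∀ i, totalError M μ ψ φ par i ω K
      ≤ (20 * C₁ + 6) * ((H : ℝ) ^ 2 * √(K : ℝ) * X)) :
    ∑ k ∈ Finset.range K, (M.value M.r πstar - M.value M.r (iter M μ ψ φ par ω k).pol)
        ≤ boundConstant C₁ γ cA * ((H : ℝ) ^ 3 * √(K : ℝ) * X) ∧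
      max (∑ k ∈ Finset.range K, (M.b - M.value M.g (iter M μ ψ φ par ω k).pol)) 0
        ≤ boundConstant C₁ γ cA * ((H : ℝ) ^ 3 * √(K : ℝ) * X) := by
  have hγ := hM.1
  have hH := M.one_le_horizon
  have hγH := hM.le_horizon
  have hH' : (1 : ℝ) ≤ H := Nat.one_le_cast.mpr hH
  have hK' : (2 : ℝ) ≤ K := by exact_mod_cast hK
  have hlog2 := Real.log_pos one_lt_two
  set l := Real.log (Fintype.card A) with hl
  have hlpos : 0 < l := hlog2.trans_le hA
  set k := √(K : ℝ) with hk
  have hk0 : 0 < k := Real.sqrt_pos.mpr (by linarith)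
  have hkk : k ^ 2 = K := Real.sq_sqrt (by linarith)
  -- A lower bound for X, forced by log 2 ≤ log|A| ≤ cA X². It allows every term without a factor X
  -- to be absorbed into H³√K X.
  set c₀ := √(Real.log 2 / cA) with hc₀
  have hc₀pos : 0 < c₀ := Real.sqrt_pos.mpr (by positivity)
  have hc₀X : c₀ ≤ X := by
    refine Real.sqrt_le_iff.mpr ⟨hX, ?_⟩
    rw [div_le_iff₀ hcA]
    linarith
  have hsl : √l ≤ √cA * X := by
    refine Real.sqrt_le_iff.mpr ⟨by positivity, ?_⟩
    rwa [mul_pow, Real.sq_sqrt hcA.le]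
  have hXc : 1 ≤ X / c₀ := (one_le_div hc₀pos).mpr hc₀X
  have hα : par.α = √l / ((H : ℝ) ^ 2 * k) := by rw [hpar]; rfl
  have hα0 : 0 < par.α := by
    rw [hα]; have := Real.sqrt_pos.mpr hlpos; positivity
  have hη : par.η = 1 / k := by rw [hpar]; rfl
  have hθ : par.θ = 1 / (K : ℝ) := by rw [hpar]; rfl
  have hχ : par.χ = 2 * (H : ℝ) / γ := by rw [hpar]; rfl
  have hβ0 : 0 ≤ par.β := by rw [hpar]; exact mul_nonneg hC₁ (Real.sqrt_nonneg _)
  have hχ0 : 0 ≤ par.χ := by rw [hχ]; positivity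
  have hη0 : 0 < par.η := by rw [hη]; positivity
  have hθ1 : par.θ < 1 := by rw [hθ, div_lt_one (by linarith)]; linarith
  have hR : Regular ψ φ par :=
    ⟨hL.measurable_psi, hL.measurable_phi, by rw [hθ]; positivity, hθ1.le⟩
  set R := (H : ℝ) ^ 2 * k * (√l * (4 + 9 / (2 * γ ^ 2)) + 3 / γ) with hRdef
  have hreg : ∀ h x, ∑ k ∈ Finset.range K, ∑ a,
      ((iter M μ ψ φ par ω k).Q true h x a + (iter M μ ψ φ par ω k).Y *
        (iter M μ ψ φ par ω k).Q false h x a)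
          * (πstar h x a - (iter M μ ψ φ par ω k).pol h x a) ≤ R := by
    intro h x
    have hmd := iter_mirror_descent (M := M) (μ := μ) hR hθ1 hα0 hχ0 hH ω K hstar.1 h x
    rw [hθ, hχ] at hmd
    exact mirror_descent_numeric hH hK hγ hγH hA hα hmd
  have hlag : ∀ y ∈ Set.Icc 0 par.χ, _ := fun y hy =>
    lagrangian_regret hR hβ0 hη0 hχ0 ho hstar.1 hstar.2.1 hreg hy
  have hπ := isPolicy_iter (M := M) (μ := μ) hR.psi hR.phi hR.theta_nonneg hR.theta_le_one ω
  have hlow := sum_value_sub_ge hM hstar hπ (K := K) (by omega)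
  set Rg := ∑ k ∈ Finset.range K, (M.value M.r πstar - M.value M.r (iter M μ ψ φ par ω k).pol)
  set Vg := ∑ k ∈ Finset.range K, (M.b - M.value M.g (iter M μ ψ φ par ω k).pol)
  have hEr := herr true
  have hEg := herr false
  unfold totalError at hEr hEg
  set Er := ∑ k ∈ Finset.range K, trajValue H M.P (iter M μ ψ φ par ω k).pol
    (errorBound M μ ψ φ par true ω k) M.x₁
  set Eg := ∑ k ∈ Finset.range K, trajValue H M.P (iter M μ ψ φ par ω k).pol
    (errorBound M μ ψ φ par false ω k) M.x₁
  set B := (H : ℝ) ^ 3 * k * X with hB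
  have hB0 : 0 ≤ B := by positivity
  have hmono : ∀ j ≤ 3, ∀ c : ℝ, 0 ≤ c → (H : ℝ) ^ j * k * c ≤ (H : ℝ) ^ 3 * k * c := by
    intro j hj c hc
    gcongr
  have hHR : H * R ≤ (√cA * (4 + 9 / (2 * γ ^ 2)) + 3 / (γ * c₀)) * B := by
    have e : H * R = (H : ℝ) ^ 3 * k * (√l * (4 + 9 / (2 * γ ^ 2)) + 3 / γ * 1) := by
      rw [hRdef]; ring
    rw [e]
    calc _ ≤ (H : ℝ) ^ 3 * k * (√cA * X * (4 + 9 / (2 * γ ^ 2)) + 3 / γ * (X / c₀)) := by gcongr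
      _ = _ := by rw [hB]; field_simp
  have hunit : ∀ j ≤ 3, (H : ℝ) ^ j * k ≤ 1 / c₀ * B := by
    intro j hj
    calc _ = (H : ℝ) ^ j * k * 1 := by ring
      _ ≤ (H : ℝ) ^ 3 * k * 1 := hmono j hj 1 zero_le_one
      _ ≤ (H : ℝ) ^ 3 * k * (X / c₀) := by gcongr
      _ = _ := by rw [hB]; ring
  have hKη : (K : ℝ) * (par.η * (H : ℝ) ^ 2 / 2) = (H : ℝ) ^ 2 * k / 2 := by
    rw [hη, ← hkk]; field_simp
  have hEB : (20 * C₁ + 6) * ((H : ℝ) ^ 2 * k * X) ≤ (20 * C₁ + 6) * B := by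
    gcongr
    exact hmono 2 (by norm_num) X hX
  have hE0 : 0 ≤ (20 * C₁ + 6) * B := by positivity
  have hc0B : 0 ≤ 1 / c₀ * B := by positivity
  have hgB : 0 ≤ 1 / (γ * c₀) * B := by positivity
  have hu2 := hunit 2 (by norm_num)
  have hconst : boundConstant C₁ γ cA * B
      = (√cA * (4 + 9 / (2 * γ ^ 2)) + 3 / (γ * c₀)) * B + 2 * (1 / (γ * c₀) * B)
        + 2 * (1 / c₀ * B) + 3 * ((20 * C₁ + 6) * B) := by
    unfold boundConstant
    rw [← hc₀]
    ring
  rw [hconst]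
  refine ⟨?_, ?_⟩
  · have h := hlag 0 ⟨le_rfl, hχ0⟩
    simp only [zero_mul, add_zero] at h
    rw [hKη] at h
    have e0 : (0 : ℝ) ^ 2 / (2 * par.η) = 0 := by simp
    rw [e0] at h
    linarith
  · have hpos0 : 0 ≤ (√cA * (4 + 9 / (2 * γ ^ 2)) + 3 / (γ * c₀)) * B := by positivity
    refine max_le ?_ (by linarith)
    rcases le_or_gt Vg 0 with hV | hV
    · linarith
    rw [max_eq_left hV.le] at hlow
    have h := hlag par.χ ⟨hχ0, le_rfl⟩
    rw [hKη] at h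
    have e0 : par.χ ^ 2 / (2 * par.η) = par.χ * (H * k / γ) := by
      rw [hη, hχ]; field_simp
    rw [e0] at h
    -- χ is twice the Slater constant H/γ: one half cancels the possibly negative regret, the other
    -- half remains in front of the violation.
    have h1 : H / γ * Vg ≤ H * R + par.χ * (H * k / γ) + (H : ℝ) ^ 2 * k / 2 + Er
        + par.χ * Eg := by
      have : par.χ * Vg = H / γ * Vg + H / γ * Vg := by rw [hχ]; ring
      linarith
    -- Dividing by H/γ reduces the terms with factor χ by a power of H and only decreases the rest,
    -- so the violation has the same order as the regret.
    have hg1 : γ / H ≤ 1 := (div_le_one (by linarith)).mpr hγH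
    have hg0 : 0 < γ / H := by positivity
    have h2 := mul_le_mul_of_nonneg_left h1 hg0.le
    have e1 : γ / H * (H / γ * Vg) = Vg := by
      have : (H : ℝ) ≠ 0 := by linarith
      field_simp
    have e2 : γ / H * (H * R + par.χ * (H * k / γ) + (H : ℝ) ^ 2 * k / 2 + Er + par.χ * Eg)
        = γ / H * (H * R + (H : ℝ) ^ 2 * k / 2 + Er) + 2 * (H * k / γ) + 2 * Eg := by
      have : (H : ℝ) ≠ 0 := by linarith
      rw [hχ]
      field_simp
      ring
    rw [e1, e2] at h2
    have hP : H * R + (H : ℝ) ^ 2 * k / 2 + Er ≤ (√cA * (4 + 9 / (2 * γ ^ 2)) + 3 / (γ * c₀)) * B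
        + 1 / c₀ * B / 2 + (20 * C₁ + 6) * B := by linarith
    have hP0 : 0 ≤ (√cA * (4 + 9 / (2 * γ ^ 2)) + 3 / (γ * c₀)) * B
        + 1 / c₀ * B / 2 + (20 * C₁ + 6) * B := by linarith
    have h3 := (mul_le_mul_of_nonneg_left hP hg0.le).trans (mul_le_of_le_one_left hP0 hg1)
    have h4 : (H : ℝ) * k / γ ≤ 1 / (γ * c₀) * B := by
      have := hunit 1 (by norm_num)
      rw [pow_one] at this
      calc (H : ℝ) * k / γ ≤ 1 / c₀ * B / γ := by gcongr
        _ = _ := by field_simp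
    linarith

end Bounds

end OPDOP

/-! ### The main theorem -/

open OPDOP in
theorem theorem1 :
    ∃ c₁ : ℝ, 0 < c₁ ∧ ∀ C₁ : ℝ, c₁ ≤ C₁ → ∀ γ : ℝ, 0 < γ → ∀ cA : ℝ, 0 < cA →
    ∃ C : ℝ, 0 < C ∧ ∃ C' : ℝ, 0 < C' ∧
    ∀ (S : Type*) [MeasurableSpace S] (A : Type*) [Fintype A] [Nonempty A] [MeasurableSpace A]
      [DiscreteMeasurableSpace A] (H d₁ d₂ d K : ℕ) (M : OPDOP.CMDP S A H)
      (μ : MeasureTheory.Measure S) [MeasureTheory.SigmaFinite μ]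
      (ψ : S → A → S → EuclideanSpace ℝ (Fin d₁)) (φ : S → A → EuclideanSpace ℝ (Fin d₂))
      (πstar : OPDOP.PolicyFun S A H) (p : ℝ),
      M.Slater γ →
      M.IsLinearKernel μ ψ φ d →
      M.IsSolution πstar →
      1 ≤ K →
      0 < p → p < 1 →
      Real.log (Fintype.card A) ≤ cA * ((d : ℝ) ^ 2 * OPDOP.logTerm d H K p ^ 2) →
      ENNReal.ofReal (1 - p) ≤
        OPDOP.runLaw M μ ψ φ (OPDOP.tuned C₁ γ p (Fintype.card A) d H K) K
          {D | OPDOP.regret M μ ψ φ (OPDOP.tuned C₁ γ p (Fintype.card A) d H K) πstar D ≤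
                C * d * (H : ℝ) ^ (5 / 2 : ℝ) * √((H : ℝ) * K) * OPDOP.logTerm d H K p ∧
              OPDOP.violation M μ ψ φ (OPDOP.tuned C₁ γ p (Fintype.card A) d H K) D ≤
                C' * d * (H : ℝ) ^ (5 / 2 : ℝ) * √((H : ℝ) * K) * OPDOP.logTerm d H K p} := by
  refine ⟨5, by norm_num, fun C₁ hC₁ γ hγ cA hcA => ?_⟩
  have hC₁0 : 0 ≤ C₁ := by linarith
  have hC := boundConstant_pos (cA := cA) hC₁0 hγ
  refine ⟨_, hC, _, hC, ?_⟩
  intro S _ A _ _ _ _ H d₁ d₂ d K M μ _ ψ φ πstar p hM hL hstar hK hp hp1 hA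
  set par := tuned C₁ γ p (Fintype.card A) d H K with hpar
  have hH := M.one_le_horizon
  have hH' : (1 : ℝ) ≤ H := Nat.one_le_cast.mpr hH
  have hK' : (1 : ℝ) ≤ K := Nat.one_le_cast.mpr hK
  have hθ : par.θ = 1 / (K : ℝ) := rfl
  have hR : Regular ψ φ par :=
    ⟨hL.measurable_psi, hL.measurable_phi, by rw [hθ]; positivity,
      by rw [hθ]; exact div_le_one_of_le₀ hK' (by positivity)⟩
  have hL0 : 0 ≤ logTerm d H K p := logTerm_nonneg' hH hK hp hp1
  set X := (d : ℝ) * logTerm d H K p with hX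
  have hX0 : 0 ≤ X := by positivity
  have hAX : Real.log (Fintype.card A) ≤ cA * X ^ 2 := by rwa [hX, mul_pow]
  set B := boundConstant C₁ γ cA * ((H : ℝ) ^ 3 * √(K : ℝ) * X) with hB
  have hB0 : 0 ≤ B := by positivity
  have hrhs : boundConstant C₁ γ cA * d * (H : ℝ) ^ (5 / 2 : ℝ) * √((H : ℝ) * K) * logTerm d H K p
      = B := by
    rw [hB, hX, ← rpow_mul_sqrt]; ring
  rw [hrhs]
  have hprob := isProbabilityMeasure_runLaw (M := M) (μ := μ) hR K
  set e₀ : Episode S A H := defaultEpisode M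
  -- For the degenerate cases |A| = 1 and K = 1, where the bounds hold on every run.
  have hsure : (∀ ω : ℕ → Episode S A H, ∑ k ∈ Finset.range K,
      (M.value M.r πstar - M.value M.r (iter M μ ψ φ par ω k).pol) ≤ B ∧
      max (∑ k ∈ Finset.range K, (M.b - M.value M.g (iter M μ ψ φ par ω k).pol)) 0 ≤ B) →
      ENNReal.ofReal (1 - p) ≤ runLaw M μ ψ φ par K
        {D | regret M μ ψ φ par πstar D ≤ B ∧ violation M μ ψ φ par D ≤ B} := by
    intro h
    have : {D : Fin K → Episode S A H | regret M μ ψ φ par πstar D ≤ B ∧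
        violation M μ ψ φ par D ≤ B} = Set.univ := by
      refine Set.eq_univ_of_forall fun D => ?_
      have := h (extend e₀ D)
      rwa [← regret_eq, ← violation_eq] at this
    rw [this, measure_univ]
    exact ENNReal.ofReal_le_one.mpr (by linarith)
  have hπ := fun ω => isPolicy_iter (M := M) (μ := μ) hR.psi hR.phi hR.theta_nonneg
    hR.theta_le_one ω
  -- With a single action α = 0, but then there is only one policy.
  rcases Nat.lt_or_ge (Fintype.card A) 2 with hcard | hcard
  · have hone : Fintype.card A = 1 := by
      have := Fintype.card_pos (α := A)
      omega
    obtain ⟨a₀, ha₀⟩ := Fintype.card_eq_one_iff.mp hone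
    have huniq : ∀ π π' : PolicyFun S A H, IsPolicy π → IsPolicy π' → π = π' := by
      intro π π' h h'
      funext j x a
      have hu : (Finset.univ : Finset A) = {a} := by
        ext b; simp [ha₀ a, ha₀ b]
      have h1 := h.sum_eq_one j x
      have h2 := h'.sum_eq_one j x
      rw [hu, Finset.sum_singleton] at h1 h2
      rw [h1, h2]
    refine hsure fun ω => ?_
    have he : ∀ k, (iter M μ ψ φ par ω k).pol = πstar := fun k =>
      huniq _ _ (hπ ω k) hstar.1
    simp only [he, sub_self, Finset.sum_const_zero]
    refine ⟨hB0, max_le ((Finset.sum_nonpos fun k _ => ?_).trans hB0) hB0⟩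
    linarith [hstar.2.1]
  have hA2 : Real.log 2 ≤ Real.log (Fintype.card A) :=
    Real.log_le_log two_pos (by exact_mod_cast hcard)
  have hlog2 := Real.log_pos one_lt_two
  -- For d = 0 the hypothesis on log|A| would force log 2 ≤ 0.
  have hd : 1 ≤ d := by
    rcases Nat.eq_zero_or_pos d with rfl | hd
    · simp only [CharP.cast_eq_zero, zero_mul] at hX
      rw [hX] at hAX
      linarith
    · exact hd
  -- For K = 1 the mixing weight θ is 1 and the mirror descent bound is unavailable; a single
  -- episode loses at most H, which c₀ ≤ X makes smaller than the claimed bound.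
  rcases hK.eq_or_lt with rfl | hK2
  · set c₀ := √(Real.log 2 / cA) with hc₀
    have hc₀pos : 0 < c₀ := Real.sqrt_pos.mpr (by positivity)
    have hc₀X : c₀ ≤ X := by
      refine Real.sqrt_le_iff.mpr ⟨hX0, ?_⟩
      rw [div_le_iff₀ hcA]
      linarith
    have hHB : (H : ℝ) ≤ B := by
      have h1 : 2 / c₀ ≤ boundConstant C₁ γ cA := by
        unfold boundConstant
        rw [← hc₀]
        have : 0 ≤ √cA * (4 + 9 / (2 * γ ^ 2)) + 5 / (γ * c₀) := by positivity
        linarith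
      have h2 : (H : ℝ) ≤ (H : ℝ) ^ 3 := le_self_pow₀ hH' (by norm_num)
      calc (H : ℝ) ≤ (H : ℝ) ^ 3 := h2
        _ = 1 / c₀ * ((H : ℝ) ^ 3 * 1 * c₀) := by field_simp
        _ ≤ boundConstant C₁ γ cA * ((H : ℝ) ^ 3 * 1 * X) := by
          gcongr
          refine le_trans ?_ h1
          gcongr
          norm_num
        _ = B := by rw [hB]; simp
    refine hsure fun ω => ?_
    simp only [Finset.sum_range_one]
    have h1 := M.value_r_mem (hπ ω 0)
    have h2 := M.value_g_mem (hπ ω 0)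
    have h3 := M.value_r_mem hstar.1
    refine ⟨by linarith [h1.1, h3.2], max_le ?_ hB0⟩
    linarith [h2.1, M.b_mem.2]
  · refine (runLaw_optimisticRun hR hL hd hH hK2 hp hp1 hC₁ rfl rfl e₀).trans
      (measure_mono fun D hD => ?_)
    have := bounds_of_optimisticRun hM hL hstar hK2 hC₁0 hcA hA2 hX0 hAX hpar hD.1 hD.2
    rwa [← regret_eq, ← violation_eq] at this
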